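/- Let $G=(V,E,\sigma)$ be a signed graph on $n$ vertices, i.e. a simple graph with a sign $\sigma(e)\in\{+1,-1\}$ on every edge. Let $m=|E|$, let $\Delta_E$ be the maximum, over the edges, of the number of triangles (of any signs) containing the edge, and let $T_1$ be the number of triangles with exactly one positive edge. An insertion-only stream of $G$ lists every edge of $G$ together with its sign exactly once, in an arbitrary (adversarial) order. A hybrid quantum-classical single-pass streaming algorithm has a memory consisting of a classical bit string and a register of qubits. It first chooses (possibly at random) the initial bit string and the number of qubits, which start in $|0\cdots0\rangle$. On each stream element, and once more at the end of the stream, it executes a finite list of instructions; each is a randomised rewriting of the bit string, a unitary on the qubits, or a projective measurement of the qubits whose outcome is recorded in the bit string. Instructions may depend on the current stream element and the bit string. The answer is a function of the final bit string. The space used is the largest number of classical bits plus qubits in use at any moment of the execution. The algorithm may be chosen depending on $n,\epsilon,\delta$ and on known bounds for $m,\Delta_E,T_1$. **Theorem.** There is an absolute constant $C>0$ such that for all $\epsilon,\delta\in(0,1]$ and all natural numbers $n,M,D,\tau$ with $\tau\ge 1$ there is a hybrid quantum-classical single-pass streaming algorithm such that, for every signed graph $G$ on $n$ vertices with $m\le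 M$, $\Delta_E\le D$ and $T_1\ge\tau$, and for every insertion-only stream of $G$, the algorithm returns, with probability at least $1-\delta$, a number $R$ with $|R-T_1|\le\epsilon T_1$, and its expected space is at most $$C\,\frac{M^{8/5}}{\tau^{6/5}}\,D^{4/5}\,\log n\cdot\frac1{\epsilon^2}\log\frac1\delta$$ quantum and classical bits. In particular, if the bounds are exact ($M=m$, $D=\Delta_E$, $\tau=T_1$), the expected space is $O\!\left(m^{8/5}T_1^{-6/5}\Delta_E^{4/5}\log n\,\epsilon^{-2}\log(1/\delta)\right)$. -/

import Mathlib

open scoped ENNReal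

noncomputable section

/-! ### Signed graphs, their triangles and their edge streams -/

/-- A signed graph: a simple graph together with a sign `±1` for every edge
(the value of `sign` on a pair that is not an edge plays no role). -/
structure SignedGraph (V : Type) where
  graph : SimpleGraph V
  sign : Sym2 V → ℤˣ

namespace SignedGraph

variable {V : Type} [Fintype V]

open scoped Classical in
/-- The set of edges. -/
def edges (G : SignedGraph V) : Finset (Sym2 V) :=
  Finset.univ.filter fun e => e ∈ G.graph.edgeSet

open scoped Classical in
/-- The set of triangles, each given by its three vertices. -/
def triangles (G : SignedGraph V) : Finset (Finset V) :=
  Finset.univ.filter fun t => G.graph.IsNClique 3 t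

open scoped Classical in
/-- The edges of `G` with both ends in `t`; for a triangle `t`, its three edges. -/
def edgesIn (G : SignedGraph V) (t : Finset V) : Finset (Sym2 V) :=
  G.edges.filter fun e => ∀ v ∈ e, v ∈ t

open scoped Classical in
/-- `T_j`, the number of triangles with exactly `j` positive edges. -/
def T (G : SignedGraph V) (j : ℕ) : ℕ :=
  (G.triangles.filter fun t => ((G.edgesIn t).filter fun e => G.sign e = 1).card = j).card

/-- `m`, the number of edges. -/
def numEdges (G : SignedGraph V) : ℕ := G.edges.card

open scoped Classical in
/-- `Δ_E`, the maximum, over all edges, of the number of triangles (of any type) that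
contain the edge. -/
def maxEdgeTriangles (G : SignedGraph V) : ℕ :=
  G.edges.sup fun e => (G.triangles.filter fun t => e ∈ G.edgesIn t).card

/-- `S` is an insertion-only stream of `G`: it lists every edge of `G`, with its sign,
exactly once, in an arbitrary order. -/
def IsStream (G : SignedGraph V) (S : List (Sym2 V × ℤˣ)) : Prop :=
  (S.map Prod.fst).Nodup ∧
    ∀ (e : Sym2 V) (s : ℤˣ), (e, s) ∈ S ↔ e ∈ G.graph.edgeSet ∧ G.sign e = s

end SignedGraph

/-! ### Qubit registers -/

/-- The Hilbert space of `q` qubits; bit strings of length `q` index the computational basis. -/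
abbrev QubitSpace (q : ℕ) : Type := EuclideanSpace ℂ (Fin q → Bool)

/-- A pure state of `q` qubits: a unit vector. -/
def QubitState (q : ℕ) : Type := {ψ : QubitSpace q // ‖ψ‖ = 1}

/-- The state `|0…0⟩`. -/
def QubitState.zero (q : ℕ) : QubitState q :=
  ⟨EuclideanSpace.single (fun _ => false) 1, by simp⟩

/-- A unitary operation applied to a state. -/
def QubitState.evolve {q : ℕ} (U : QubitSpace q ≃ₗᵢ[ℂ] QubitSpace q) (ψ : QubitState q) :
    QubitState q :=
  ⟨U ψ.1, by rw [U.norm_map]; exact ψ.2⟩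

/-- A projective measurement of `q` qubits with `r` outcomes: orthogonal projections that sum
to the identity (hence are mutually orthogonal). -/
structure PVM (q r : ℕ) where
  proj : Fin r → (QubitSpace q →L[ℂ] QubitSpace q)
  isStarProjection : ∀ i, IsStarProjection (proj i)
  sum_eq_one : ∑ i, proj i = 1

namespace PVM

variable {q r : ℕ}

theorem sum_sq_norm (P : PVM q r) (ψ : QubitState q) :
    ∑ i, ‖P.proj i ψ.1‖ ^ 2 = 1 := by
  have key : ∀ i, ((‖P.proj i ψ.1‖ ^ 2 : ℝ) : ℂ) = inner ℂ ψ.1 (P.proj i ψ.1) := by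
    intro i
    have hsa : ContinuousLinearMap.adjoint (P.proj i) = P.proj i :=
      (P.isStarProjection i).isSelfAdjoint
    have hid : P.proj i (P.proj i ψ.1) = P.proj i ψ.1 :=
      congrArg (fun A : QubitSpace q →L[ℂ] QubitSpace q => A ψ.1)
        (P.isStarProjection i).isIdempotentElem
    have h1 := inner_self_eq_norm_sq_to_K (𝕜 := ℂ) (P.proj i ψ.1)
    have h2 := ContinuousLinearMap.adjoint_inner_right (P.proj i) ψ.1 (P.proj i ψ.1)
    rw [hsa, hid] at h2
    rw [h2, h1]
    push_cast
    rfl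
  have hsum : ∑ i, P.proj i ψ.1 = ψ.1 := by
    have := congrArg (fun A : QubitSpace q →L[ℂ] QubitSpace q => A ψ.1) P.sum_eq_one
    simpa using this
  have h : ((∑ i, ‖P.proj i ψ.1‖ ^ 2 : ℝ) : ℂ) = 1 := by
    rw [Complex.ofReal_sum, Finset.sum_congr rfl fun i _ => key i, ← inner_sum, hsum,
      inner_self_eq_norm_sq_to_K, ψ.2]
    norm_num
  exact_mod_cast h

/-- Born's rule: outcome `i` has probability `‖P i ψ‖²`. -/
def outcome (P : PVM q r) (ψ : QubitState q) : PMF (Fin r) :=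
  PMF.ofFintype (fun i => ENNReal.ofReal (‖P.proj i ψ.1‖ ^ 2)) (by
    rw [← ENNReal.ofReal_sum_of_nonneg (fun i _ => by positivity), P.sum_sq_norm ψ,
      ENNReal.ofReal_one])

open scoped Classical in
/-- The post-measurement state `P i ψ / ‖P i ψ‖` after outcome `i`
(arbitrary for an outcome of probability zero). -/
def collapse (P : PVM q r) (ψ : QubitState q) (i : Fin r) : QubitState q :=
  if h : P.proj i ψ.1 = 0 then ψ
  else ⟨((‖P.proj i ψ.1‖⁻¹ : ℝ) : ℂ) • P.proj i ψ.1, by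
    have h' : ‖P.proj i ψ.1‖ ≠ 0 := norm_ne_zero_iff.mpr h
    rw [norm_smul, Complex.norm_real, norm_inv, norm_norm, inv_mul_cancel₀ h']⟩

end PVM

/-! ### Hybrid quantum-classical streaming algorithms

The memory of the algorithm consists of a bit string and of a register of qubits. -/

/-- One operation on the memory: a (randomised) rewriting of the classical bits, a unitary on
the qubits, or a projective measurement of the qubits whose outcome is recorded in the
classical bits. -/
inductive HybridAction (q : ℕ) : Type where
  | classical (newBits : PMF (List Bool))
  | unitary (U : QubitSpace q ≃ₗᵢ[ℂ] QubitSpace q)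
  | measure (r : ℕ) (P : PVM q r) (newBits : Fin r → List Bool)

/-- The effect of an operation on the contents of the memory. -/
def HybridAction.apply {q : ℕ} :
    HybridAction q → List Bool × QubitState q → PMF (List Bool × QubitState q)
  | .classical newBits, c => newBits.map fun x => (x, c.2)
  | .unitary U, c => PMF.pure (c.1, c.2.evolve U)
  | .measure _ P newBits, c => (P.outcome c.2).map fun i => (newBits i, P.collapse c.2 i)

/-- An instruction: the operation to perform is chosen from the contents of the classical
memory (and the size of the register), never from the quantum state. -/
abbrev HybridInstruction : Type := (q : ℕ) → List Bool → HybridAction q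

/-- A hybrid quantum-classical single-pass streaming algorithm that reads tokens from `α` and
returns a real number. Initially it chooses, possibly at random, the contents of the classical
memory and the number of qubits, which start in `|0…0⟩`; on each token it executes a finite list
of instructions, and another one at the end of the stream; its answer is read off the classical
memory. -/
structure HybridStreamingAlgorithm (α : Type) where
  init : PMF (List Bool × ℕ)
  onToken : α → List HybridInstruction
  onEnd : List HybridInstruction
  answer : List Bool → ℝ

/-- Execution of a list of instructions. The second argument and the second component of the
result are the largest number of bits and qubits in use so far. -/
def runInstructions (q : ℕ) :
    List HybridInstruction → List Bool × QubitState q → ℕ →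
      PMF ((List Bool × QubitState q) × ℕ)
  | [], c, s => PMF.pure (c, s)
  | I :: Is, c, s =>
      ((I q c.1).apply c).bind fun c' => runInstructions q Is c' (max s (c'.1.length + q))

namespace HybridStreamingAlgorithm

variable {α : Type}

/-- The joint law of the answer and of the peak memory usage (the largest number of classical
bits plus qubits in use at any moment of the execution) on the stream `S`. -/
def execution (A : HybridStreamingAlgorithm α) (S : List α) : PMF (ℝ × ℕ) :=
  A.init.bind fun i =>
    (runInstructions i.2 (S.flatMap A.onToken ++ A.onEnd) (i.1, QubitState.zero i.2)
      (i.1.length + i.2)).map fun c => (A.answer c.1.1, c.2)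

/-- The probability that the answer on the stream `S` lies in `E`. -/
def answerProb (A : HybridStreamingAlgorithm α) (S : List α) (E : Set ℝ) : ℝ≥0∞ :=
  ((A.execution S).map Prod.fst).toOuterMeasure E

/-- The expectation of the peak memory usage, in classical bits plus qubits, on `S`. -/
def expectedSpace (A : HybridStreamingAlgorithm α) (S : List α) : ℝ≥0∞ :=
  ∑' s : ℕ, ((A.execution S).map Prod.snd) s * (s : ℝ≥0∞)

end HybridStreamingAlgorithm

end

/-!
A triangle with exactly one positive edge is recorded when its last edge arrives: it is then a pair
of earlier *entries* `(x, w, σ)`, `(y, w, σ')`, directed signed edges with a common centre `w` that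
are filed under the ends `x`, `y` of the last edge (a *wedge*). `card_wedges` says that every such
triangle is exactly one wedge. One copy of the algorithm estimates the number `T` of wedges in two
complementary ways, coupled by one coin per token that shows `true` with probability `κ`.

* The quantum estimator keeps a vector in superposition over entries and unused dummy labels, all
  present labels with the same amplitude `α`. A token whose coin shows `false` exchanges two dummies
  for its two entries. A token whose coin shows `true` performs a measurement that projects onto the
  labels it hits, that is, the entries that it could complete to a triangle, and there onto the
  symmetric and antisymmetric parts of the pairing of the two entries of a wedge. The difference of
  the probabilities of these two outcomes is `2 α ^ 2` times the number of wedges closed by the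
  token whose entries are both still present (`pairingPVM_bias`, `quantumBias_eq`); if neither
  occurs, the entries that were hit are gone. An entry survives only as long as no token with coin
  `true` hits it, but which entries survive depends on the coins alone.
* The classical estimator samples the centres by a pairwise independent hash function and stores the
  entries with a sampled centre with probability `q`. Since it knows the coins, it knows which
  stored entries are no longer in the quantum register, and among the stored wedges it counts
  exactly those that the quantum estimator misses (`finalMem_eq`).

A wedge is closed while it is alive independently of the coin of its last token, so after division
by the sampling rates the two expectations add up to `T` (`copyDist_estimate`). The quantum
estimator has values in `{-1, 0, 1}`, scaled by `(M + 1) / κ`. In the classical one only wedges with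
the same centre are correlated; most of these pairs are hit with small probability, because a wedge
with few edges at its ends is hit rarely, and at most `Δ_E` wedges share a centre and an end of the
last edge (`sum_iidExp_card_foundWedges_sq_le`). With `κ = 1 / k` and `k ^ 5 = τ ^ 2 D ^ 2 / M` both
variances are `O(M ^ (8/5) τ ^ (-6/5) D ^ (4/5)) T ^ 2`, and a copy needs `O(log n)` bits and qubits
in expectation (`exists_rates`). If that `k` is less than `1`, storing all the edges is cheap
enough.

The copies run in parallel on one register. Their joint state is a tensor product throughout, so
that they are independent (`branchExp_parallel`), and Chebyshev's inequality and a vote among groups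
of copies give the success probability (`copiesAlgorithm_answerProb`). As the memory never shrinks
during the stream, its peak is its final size (`branchExp_parallel_peak`). The algorithm starts with
probability `p₀`, which is less than `1` only for `δ > 1/2`, where `log (1 / δ)` may be arbitrarily
small.
-/

noncomputable section

/-! ### Expectations over an execution -/

namespace PMF

variable {α β : Type*}

/-- The expectation of a function with values in `[0, ∞]`. -/
def lexp (p : PMF α) (F : α → ℝ≥0∞) : ℝ≥0∞ := ∑' a, p a * F a

theorem lexp_pure (a : α) (F : α → ℝ≥0∞) : (PMF.pure a).lexp F = F a := by
  classical
  unfold lexp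
  rw [tsum_eq_single a]
  · simp
  · intro b hb
    simp [PMF.pure_apply, hb]

theorem lexp_bind (p : PMF α) (f : α → PMF β) (F : β → ℝ≥0∞) :
    (p.bind f).lexp F = p.lexp fun a => (f a).lexp F := by
  simp only [lexp, PMF.bind_apply, ← ENNReal.tsum_mul_right, ← ENNReal.tsum_mul_left]
  rw [ENNReal.tsum_comm]
  simp only [mul_assoc]

theorem lexp_map (p : PMF α) (f : α → β) (F : β → ℝ≥0∞) :
    (p.map f).lexp F = p.lexp (F ∘ f) := by
  rw [PMF.map, lexp_bind]
  simp [lexp_pure, Function.comp_def]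

theorem lexp_congr (p : PMF α) {F F' : α → ℝ≥0∞} (h : ∀ a ∈ p.support, F a = F' a) :
    p.lexp F = p.lexp F' := by
  refine tsum_congr fun a => ?_
  by_cases ha : p a = 0
  · simp [ha]
  · rw [h a ((p.mem_support_iff a).2 ha)]

theorem lexp_fintype [Fintype α] (p : PMF α) (F : α → ℝ≥0∞) :
    p.lexp F = ∑ a, p a * F a := tsum_fintype _

open scoped Classical in
theorem toOuterMeasure_eq_lexp (p : PMF α) (s : Set α) :
    p.toOuterMeasure s = p.lexp fun a => if a ∈ s then 1 else 0 := by
  rw [PMF.toOuterMeasure_apply]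
  refine tsum_congr fun a => ?_
  by_cases h : a ∈ s <;> simp [h]

end PMF

/-- The expectation of `g` (a function of the final bit string and of the peak memory usage) over
an execution, computed without renormalising after measurements: the vector may have any norm, and
its squared norm is the weight of the branch. -/
def branchExp (q : ℕ) (g : List Bool → ℕ → ℝ≥0∞) :
    List HybridInstruction → List Bool → QubitSpace q → ℕ → ℝ≥0∞
  | [], b, φ, s => ENNReal.ofReal (‖φ‖ ^ 2) * g b s
  | I :: Is, b, φ, s =>
    match I q b with
    | .classical p => p.lexp fun x => branchExp q g Is x φ (max s (x.length + q))
    | .unitary U => branchExp q g Is b (U φ) (max s (b.length + q))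
    | .measure _ P nb => ∑ i, branchExp q g Is (nb i) (P.proj i φ) (max s ((nb i).length + q))

theorem branchExp_smul (q : ℕ) (g : List Bool → ℕ → ℝ≥0∞) (Is : List HybridInstruction)
    (b : List Bool) (φ : QubitSpace q) (s : ℕ) (r : ℝ) :
    branchExp q g Is b ((r : ℂ) • φ) s = ENNReal.ofReal (r ^ 2) * branchExp q g Is b φ s := by
  induction Is generalizing b φ s with
  | nil =>
    simp only [branchExp, norm_smul, Complex.norm_real, mul_pow, Real.norm_eq_abs, sq_abs]
    rw [ENNReal.ofReal_mul (sq_nonneg _), mul_assoc]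
  | cons I Is ih =>
    simp only [branchExp]
    cases I q b with
    | classical p =>
      simp only [ih, PMF.lexp]
      rw [← ENNReal.tsum_mul_left]
      exact tsum_congr fun x => by ring
    | unitary U => simp only [map_smul, ih]
    | measure r' P nb => simp only [map_smul, ih, Finset.mul_sum]

/-- The normalisation of the state after a measurement cancels against the probability of the
outcome. -/
theorem lexp_runInstructions (q : ℕ) (g : List Bool → ℕ → ℝ≥0∞) (Is : List HybridInstruction)
    (b : List Bool) (ψ : QubitState q) (s : ℕ) :
    (runInstructions q Is (b, ψ) s).lexp (fun c => g c.1.1 c.2) = branchExp q g Is b ψ.1 s := by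
  induction Is generalizing b ψ s with
  | nil => simp [runInstructions, branchExp, PMF.lexp_pure, ψ.2]
  | cons I Is ih =>
    simp only [runInstructions, branchExp, PMF.lexp_bind]
    cases I q b with
    | classical p =>
      simp only [HybridAction.apply, PMF.lexp_map]
      exact congrArg _ (funext fun x => ih _ _ _)
    | unitary U =>
      simp only [HybridAction.apply, PMF.lexp_pure]
      exact ih _ _ _
    | measure r P nb =>
      simp only [HybridAction.apply, PMF.lexp_map, PMF.lexp_fintype]
      refine Finset.sum_congr rfl fun i _ => ?_
      simp only [Function.comp, ih]
      have hout : P.outcome ψ i = ENNReal.ofReal (‖P.proj i ψ.1‖ ^ 2) := rfl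
      rw [hout]
      by_cases h : P.proj i ψ.1 = 0
      · have h0 : P.proj i ψ.1 = ((0 : ℝ) : ℂ) • ψ.1 := by simp [h]
        conv_rhs => rw [h0, branchExp_smul]
        simp [h]
      · have h' : ‖P.proj i ψ.1‖ ≠ 0 := norm_ne_zero_iff.mpr h
        have h1 : P.proj i ψ.1 = ((‖P.proj i ψ.1‖ : ℝ) : ℂ) • (P.collapse ψ i).1 := by
          have h2 : (P.collapse ψ i).1 = ((‖P.proj i ψ.1‖⁻¹ : ℝ) : ℂ) • P.proj i ψ.1 :=
            congrArg Subtype.val (dif_neg h)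
          rw [h2, smul_smul, ← Complex.ofReal_mul, mul_inv_cancel₀ h']
          simp
        conv_rhs => rw [h1, branchExp_smul]

theorem HybridStreamingAlgorithm.lexp_execution {α : Type} (A : HybridStreamingAlgorithm α)
    (S : List α) (F : ℝ × ℕ → ℝ≥0∞) :
    (A.execution S).lexp F = A.init.lexp fun i =>
      branchExp i.2 (fun b s => F (A.answer b, s)) (S.flatMap A.onToken ++ A.onEnd) i.1
        (QubitState.zero i.2).1 (i.1.length + i.2) := by
  simp only [execution, PMF.lexp_bind, PMF.lexp_map]
  refine congrArg _ (funext fun i => ?_)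
  exact lexp_runInstructions i.2 (fun b s => F (A.answer b, s)) _ _ _ _

theorem HybridStreamingAlgorithm.expectedSpace_eq_lexp {α : Type}
    (A : HybridStreamingAlgorithm α) (S : List α) :
    A.expectedSpace S = (A.execution S).lexp fun x => (x.2 : ℝ≥0∞) := by
  have := PMF.lexp_map (A.execution S) Prod.snd (fun s : ℕ => (s : ℝ≥0∞))
  exact this

open scoped Classical in
theorem HybridStreamingAlgorithm.answerProb_eq_lexp {α : Type}
    (A : HybridStreamingAlgorithm α) (S : List α) (E : Set ℝ) :
    A.answerProb S E = (A.execution S).lexp fun x => if x.1 ∈ E then 1 else 0 := by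
  rw [answerProb, PMF.toOuterMeasure_eq_lexp, PMF.lexp_map]
  rfl

/-! ### Tensor powers -/

section Tensor

variable {ι X : Type*} [Fintype ι]

/-- The elementary tensor `⨂ⱼ φⱼ`, as a function on `ι → X`. -/
def tensorVec (φ : ι → X → ℂ) : (ι → X) → ℂ := fun x => ∏ j, φ j (x j)

/-- The matrix of the operator `⨂ⱼ Aⱼ`. -/
def tensorMat (A : ι → Matrix X X ℂ) : Matrix (ι → X) (ι → X) ℂ :=
  Matrix.of fun x y => ∏ j, A j (x j) (y j)

variable [Fintype X] [DecidableEq ι]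

theorem tensorMat_mulVec (A : ι → Matrix X X ℂ) (φ : ι → X → ℂ) :
    (tensorMat A).mulVec (tensorVec φ) = tensorVec fun j => (A j).mulVec (φ j) := by
  ext x
  simp only [Matrix.mulVec, dotProduct, tensorMat, tensorVec, Matrix.of_apply,
    ← Finset.prod_mul_distrib]
  rw [Finset.prod_univ_sum]
  simp

theorem tensorMat_mul (A B : ι → Matrix X X ℂ) :
    tensorMat A * tensorMat B = tensorMat fun j => A j * B j := by
  ext x y
  simp only [Matrix.mul_apply, tensorMat, Matrix.of_apply, ← Finset.prod_mul_distrib]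
  rw [Finset.prod_univ_sum]
  simp

omit [Fintype X] [DecidableEq ι] in
theorem tensorMat_conjTranspose (A : ι → Matrix X X ℂ) :
    (tensorMat A).conjTranspose = tensorMat fun j => (A j).conjTranspose := by
  ext x y
  simp [tensorMat, Matrix.conjTranspose_apply]

omit [Fintype X] [DecidableEq ι] in
theorem tensorMat_one [DecidableEq X] :
    (tensorMat fun _ : ι => (1 : Matrix X X ℂ)) = 1 := by
  ext x y
  simp only [tensorMat, Matrix.of_apply, Matrix.one_apply, Finset.prod_ite_zero, Finset.mem_univ,
    true_implies, Finset.prod_const_one, funext_iff]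

omit [Fintype X] in
theorem sum_tensorMat {O : Type*} [Fintype O] (P : ι → O → Matrix X X ℂ) :
    ∑ o : ι → O, tensorMat (fun j => P j (o j)) = tensorMat fun j => ∑ o, P j o := by
  ext x y
  simp only [Matrix.sum_apply, tensorMat, Matrix.of_apply]
  rw [Finset.prod_univ_sum]
  simp

/-- The squared Euclidean norm of a complex vector. -/
def normSqVec {X : Type*} [Fintype X] (φ : X → ℂ) : ℝ := ∑ x, ‖φ x‖ ^ 2

theorem normSqVec_tensorVec (φ : ι → X → ℂ) :
    normSqVec (tensorVec φ) = ∏ j, normSqVec (φ j) := by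
  simp only [normSqVec, tensorVec]
  rw [Finset.prod_univ_sum]
  simp [Finset.prod_pow]

end Tensor

/-! ### Programs for one copy, and their parallel repetition -/

/-- A projective measurement with outcomes in `SignType`, in coordinates. -/
structure MatPVM (X : Type) [Fintype X] [DecidableEq X] where
  proj : SignType → Matrix X X ℂ
  isStarProjection : ∀ o, IsStarProjection (proj o)
  sum_eq_one : ∑ o, proj o = 1

/-- An instruction of a program for one copy, whose classical memory is an element of `C` and whose
quantum memory is a vector indexed by `X`. -/
inductive CopyInstr (C X : Type) [Fintype X] [DecidableEq X] : Type where
  | classical (f : C → PMF C)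
  | unitary (U : C → Matrix.unitaryGroup X ℂ)
  | measure (P : C → MatPVM X) (upd : C → SignType → C)

variable {C X : Type} [Fintype X] [DecidableEq X]

/-- The expectation of `g` (a function of the final classical memory) over a run of a program,
computed without renormalising after measurements. -/
def copyExp [Fintype C] (g : C → ℝ) : List (CopyInstr C X) → C → (X → ℂ) → ℝ
  | [], c, φ => normSqVec φ * g c
  | .classical f :: Is, c, φ => ∑ c', (f c c').toReal * copyExp g Is c' φ
  | .unitary U :: Is, c, φ => copyExp g Is c ((U c).1.mulVec φ)
  | .measure P upd :: Is, c, φ => ∑ o, copyExp g Is (upd c o) (((P c).proj o).mulVec φ)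

theorem copyExp_nonneg [Fintype C] {g : C → ℝ} (hg : ∀ c, 0 ≤ g c) (Is : List (CopyInstr C X))
    (c : C) (φ : X → ℂ) : 0 ≤ copyExp g Is c φ := by
  induction Is generalizing c φ with
  | nil => exact mul_nonneg (Finset.sum_nonneg fun _ _ => by positivity) (hg c)
  | cons I Is ih =>
    cases I with
    | classical f =>
      exact Finset.sum_nonneg fun c' _ => mul_nonneg ENNReal.toReal_nonneg (ih c' φ)
    | unitary U => exact ih _ _
    | measure P upd => exact Finset.sum_nonneg fun o _ => ih _ _

theorem copyExp_sum [Fintype C] {κ : Type*} (s : Finset κ) (a : κ → ℝ) (g : κ → C → ℝ)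
    (Is : List (CopyInstr C X)) (c : C) (φ : X → ℂ) :
    copyExp (fun c => ∑ k ∈ s, a k * g k c) Is c φ = ∑ k ∈ s, a k * copyExp (g k) Is c φ := by
  induction Is generalizing c φ with
  | nil =>
    simp only [copyExp, Finset.mul_sum]
    exact Finset.sum_congr rfl fun k _ => by ring
  | cons I Is ih =>
    cases I with
    | classical f =>
      simp only [copyExp, ih, Finset.mul_sum]
      rw [Finset.sum_comm]
      exact Finset.sum_congr rfl fun k _ => Finset.sum_congr rfl fun _ _ => by ring
    | unitary U => exact ih _ _
    | measure P upd =>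
      simp only [copyExp, ih, Finset.mul_sum]
      rw [Finset.sum_comm]

/-- The weight of the final classical memory `c'`. -/
def copyLaw [Fintype C] [DecidableEq C] (Is : List (CopyInstr C X)) (c : C) (φ : X → ℂ)
    (c' : C) : ℝ :=
  copyExp (fun d => if d = c' then 1 else 0) Is c φ

theorem copyExp_eq_sum_copyLaw [Fintype C] [DecidableEq C] (g : C → ℝ)
    (Is : List (CopyInstr C X)) (c : C) (φ : X → ℂ) :
    copyExp g Is c φ = ∑ c', g c' * copyLaw Is c φ c' := by
  have h := copyExp_sum Finset.univ g (fun c' d => if d = c' then 1 else 0) Is c φ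
  simp only [mul_ite, mul_one, mul_zero, Finset.sum_ite_eq, Finset.mem_univ,
    if_true] at h
  exact h

theorem copyLaw_nonneg [Fintype C] [DecidableEq C] (Is : List (CopyInstr C X)) (c : C)
    (φ : X → ℂ) (c' : C) : 0 ≤ copyLaw Is c φ c' :=
  copyExp_nonneg (fun d => by split <;> norm_num) Is c φ

/-- The product of finitely many probability distributions on a finite type. -/
def PMF.piFintype {ι C : Type*} [Fintype ι] [DecidableEq ι] [Fintype C] (p : ι → PMF C) :
    PMF (ι → C) :=
  PMF.ofFintype (fun c => ∏ j, p j (c j)) (by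
    have h : ∀ j, ∑ c, p j c = 1 := fun j => by
      rw [← tsum_fintype (L := .unconditional C)]; exact (p j).tsum_coe
    have h2 := Finset.prod_univ_sum (fun _ : ι => (Finset.univ : Finset C)) (fun j c => p j c)
    simp only [h, Finset.prod_const_one, Fintype.piFinset_univ] at h2
    exact h2.symm)

section Parallel

variable {ι : Type} [Fintype ι] [DecidableEq ι] {Q : ℕ}
  (Θ : QubitSpace Q ≃ₗᵢ[ℂ] EuclideanSpace ℂ (ι → X))

omit [DecidableEq X] in
theorem tensorMat_isStarProjection {P : ι → Matrix X X ℂ} (h : ∀ j, IsStarProjection (P j)) :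
    IsStarProjection (tensorMat P) where
  isIdempotentElem := by
    change tensorMat P * tensorMat P = tensorMat P
    rw [tensorMat_mul]
    exact congrArg _ (funext fun j => (h j).isIdempotentElem)
  isSelfAdjoint := by
    change (tensorMat P).conjTranspose = tensorMat P
    rw [tensorMat_conjTranspose]
    exact congrArg _ (funext fun j => (h j).isSelfAdjoint)

/-- The operator on the qubits that has the given matrix in the coordinates `Θ`. -/
def matOp : Matrix (ι → X) (ι → X) ℂ ≃⋆ₐ[ℂ] (QubitSpace Q →L[ℂ] QubitSpace Q) :=
  (Matrix.toEuclideanCLM (n := ι → X) (𝕜 := ℂ)).trans Θ.symm.conjStarAlgEquiv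

theorem matOp_apply (A : Matrix (ι → X) (ι → X) ℂ) (v : (ι → X) → ℂ) :
    matOp Θ A (Θ.symm (WithLp.toLp 2 v)) = Θ.symm (WithLp.toLp 2 (A.mulVec v)) := by
  simp [matOp, LinearIsometryEquiv.conjStarAlgEquiv_apply]

/-- A unitary on the qubits from unitaries on the copies. -/
def tensorUnitary (U : ι → Matrix.unitaryGroup X ℂ) : QubitSpace Q ≃ₗᵢ[ℂ] QubitSpace Q :=
  Unitary.linearIsometryEquiv ⟨matOp Θ (tensorMat fun j => (U j).1), by
    have h1 : star (tensorMat fun j => (U j).1) * (tensorMat fun j => (U j).1) = 1 := by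
      change (tensorMat fun j => (U j).1).conjTranspose * _ = _
      rw [tensorMat_conjTranspose, tensorMat_mul, ← tensorMat_one]
      exact congrArg _ (funext fun j => (Unitary.mem_iff.1 (U j).2).1)
    have h2 : (tensorMat fun j => (U j).1) * star (tensorMat fun j => (U j).1) = 1 := by
      change _ * (tensorMat fun j => (U j).1).conjTranspose = _
      rw [tensorMat_conjTranspose, tensorMat_mul, ← tensorMat_one]
      exact congrArg _ (funext fun j => (Unitary.mem_iff.1 (U j).2).2)
    rw [Unitary.mem_iff, ← map_star, ← map_mul, ← map_mul, h1, h2, map_one]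
    exact ⟨rfl, rfl⟩⟩

theorem tensorUnitary_apply (U : ι → Matrix.unitaryGroup X ℂ) (φ : ι → X → ℂ) :
    tensorUnitary Θ U (Θ.symm (WithLp.toLp 2 (tensorVec φ))) =
      Θ.symm (WithLp.toLp 2 (tensorVec fun j => (U j).1.mulVec (φ j))) := by
  rw [← tensorMat_mulVec, ← matOp_apply]
  rfl

/-- Outcomes of the joint measurement of all copies, numbered. -/
def outcomeEquiv (ι : Type) [Fintype ι] [DecidableEq ι] :
    Fin (Fintype.card (ι → SignType)) ≃ (ι → SignType) :=
  (Fintype.equivFin (ι → SignType)).symm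

/-- The joint measurement of all copies. -/
def tensorPVM (P : ι → MatPVM X) : PVM Q (Fintype.card (ι → SignType)) where
  proj i := matOp Θ (tensorMat fun j => (P j).proj (outcomeEquiv ι i j))
  isStarProjection i :=
    (tensorMat_isStarProjection fun j => (P j).isStarProjection _).map (matOp Θ)
  sum_eq_one := by
    rw [← map_sum, Equiv.sum_comp (outcomeEquiv ι)
      (fun o => tensorMat fun j => (P j).proj (o j)), sum_tensorMat]
    simp only [MatPVM.sum_eq_one, tensorMat_one, map_one]

theorem tensorPVM_apply (P : ι → MatPVM X) (φ : ι → X → ℂ) (o : ι → SignType) :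
    (tensorPVM Θ P).proj ((outcomeEquiv ι).symm o) (Θ.symm (WithLp.toLp 2 (tensorVec φ))) =
      Θ.symm (WithLp.toLp 2 (tensorVec fun j => ((P j).proj (o j)).mulVec (φ j))) := by
  rw [← tensorMat_mulVec, ← matOp_apply]
  simp [tensorPVM]

variable [Fintype C] (enc : (ι → C) → List Bool)

/-- One instruction executed by all copies at once. -/
def parallelAction : CopyInstr C X → (ι → C) → HybridAction Q
  | .classical f, c => .classical ((PMF.piFintype fun j => f (c j)).map enc)
  | .unitary U, c => .unitary (tensorUnitary Θ fun j => U (c j))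
  | .measure P upd, c => .measure _ (tensorPVM Θ fun j => P (c j))
      fun i => enc fun j => upd (c j) (outcomeEquiv ι i j)

open scoped Classical in
/-- The instruction that executes `I` on all copies when the bit string encodes the classical
memories of the copies and the register has the right size, and that does nothing otherwise. -/
def parallelInstr (I : CopyInstr C X) : HybridInstruction := fun q b =>
  if h : Q = q ∧ ∃ c, enc c = b then h.1 ▸ parallelAction Θ enc I h.2.choose
  else .classical (PMF.pure b)

variable {enc} (henc : Function.Injective enc)
include henc

theorem parallelInstr_enc (I : CopyInstr C X) (c : ι → C) :
    parallelInstr Θ enc I Q (enc c) = parallelAction Θ enc I c := by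
  have h : Q = Q ∧ ∃ c', enc c' = enc c := ⟨rfl, c, rfl⟩
  have hc : h.2.choose = c := henc h.2.choose_spec
  rw [parallelInstr, dif_pos h]
  simp only [hc]

omit henc [DecidableEq X] in
theorem norm_symm_toLp_sq (v : (ι → X) → ℂ) :
    ‖Θ.symm (WithLp.toLp 2 v)‖ ^ 2 = normSqVec v := by
  rw [LinearIsometryEquiv.norm_map, EuclideanSpace.norm_sq_eq]
  rfl

omit [DecidableEq X] [DecidableEq ι] [Fintype X] henc in
theorem ofReal_toReal_mul {C : Type*} (p : PMF C) (c : C) {x : ℝ} :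
    ENNReal.ofReal ((p c).toReal * x) = p c * ENNReal.ofReal x := by
  rw [ENNReal.ofReal_mul ENNReal.toReal_nonneg, ENNReal.ofReal_toReal (p.apply_ne_top c)]

/-- Copies that run in parallel are independent: the joint law of their classical memories is the
product of the laws of the copies. -/
theorem branchExp_parallel [DecidableEq C] (g : List Bool → ℝ≥0∞) (Is : List (CopyInstr C X))
    (c : ι → C) (φ : ι → X → ℂ) (s : ℕ) :
    branchExp Q (fun b _ => g b) (Is.map (parallelInstr Θ enc)) (enc c)
        (Θ.symm (WithLp.toLp 2 (tensorVec φ))) s =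
      ∑ c' : ι → C, (∏ j, ENNReal.ofReal (copyLaw Is (c j) (φ j) (c' j))) * g (enc c') := by
  induction Is generalizing c φ s with
  | nil =>
    simp only [List.map_nil, branchExp, copyLaw, copyExp, norm_symm_toLp_sq, normSqVec_tensorVec]
    rw [Finset.sum_eq_single c]
    · simp only [if_true, mul_one]
      rw [ENNReal.ofReal_prod_of_nonneg]
      exact fun j _ => Finset.sum_nonneg fun _ _ => by positivity
    · intro c' _ hc'
      obtain ⟨j, hj⟩ := Function.ne_iff.1 hc'
      rw [Finset.prod_eq_zero (Finset.mem_univ j), zero_mul]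
      simp [Ne.symm hj]
    · simp
  | cons I Is ih =>
    simp only [List.map_cons, branchExp, parallelInstr_enc Θ henc]
    cases I with
    | classical f =>
      simp only [parallelAction, PMF.lexp_map, Function.comp_def, ih, PMF.lexp_fintype,
        Finset.mul_sum]
      rw [Finset.sum_comm]
      refine Finset.sum_congr rfl fun c' _ => ?_
      simp only [← mul_assoc, ← Finset.sum_mul]
      congr 1
      simp only [PMF.piFintype, PMF.ofFintype_apply, ← Finset.prod_mul_distrib]
      have : ∀ j, ENNReal.ofReal (copyLaw (.classical f :: Is) (c j) (φ j) (c' j)) =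
          ∑ d, f (c j) d * ENNReal.ofReal (copyLaw Is d (φ j) (c' j)) := fun j => by
        rw [copyLaw, copyExp, ENNReal.ofReal_sum_of_nonneg]
        · simp only [ofReal_toReal_mul]; rfl
        · exact fun d _ => mul_nonneg ENNReal.toReal_nonneg (copyLaw_nonneg _ _ _ _)
      simp only [this]
      rw [Finset.prod_univ_sum]
      simp
    | unitary U =>
      simp only [parallelAction, tensorUnitary_apply, ih]
      rfl
    | measure P upd =>
      simp only [parallelAction]
      rw [← Equiv.sum_comp (outcomeEquiv ι).symm]
      simp only [tensorPVM_apply, ih, Equiv.apply_symm_apply]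
      rw [Finset.sum_comm]
      refine Finset.sum_congr rfl fun c' _ => ?_
      rw [← Finset.sum_mul]
      congr 1
      have : ∀ j, ENNReal.ofReal (copyLaw (.measure P upd :: Is) (c j) (φ j) (c' j)) =
          ∑ o, ENNReal.ofReal (copyLaw Is (upd (c j) o) (((P (c j)).proj o).mulVec (φ j))
            (c' j)) := fun j => by
        rw [copyLaw, copyExp, ENNReal.ofReal_sum_of_nonneg]
        · rfl
        · exact fun d _ => copyLaw_nonneg _ _ _ _
      simp only [this]
      rw [Finset.prod_univ_sum]
      simp

omit henc in
/-- An instruction that never shortens the encoding of the classical memory. -/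
def CopyInstr.Grows (sz : C → ℕ) : CopyInstr C X → Prop
  | .classical f => ∀ c, ∀ c' ∈ (f c).support, sz c ≤ sz c'
  | .unitary _ => True
  | .measure _ upd => ∀ c o, sz c ≤ sz (upd c o)

/-- If no instruction shortens the memory, the peak memory usage is attained at the end. -/
theorem branchExp_parallel_peak (sz : C → ℕ) (hmono : ∀ c c' : ι → C, (∀ j, sz (c j) ≤ sz (c' j)) →
      (enc c).length ≤ (enc c').length) (F : ℕ → ℝ≥0∞)
    (Is : List (CopyInstr C X)) (hIs : ∀ I ∈ Is, I.Grows sz) (c : ι → C) (Φ : QubitSpace Q)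
    (s t : ℕ) (hs : s = (enc c).length + Q) :
    branchExp Q (fun _ s => F s) (Is.map (parallelInstr Θ enc)) (enc c) Φ s =
      branchExp Q (fun b _ => F (b.length + Q)) (Is.map (parallelInstr Θ enc)) (enc c) Φ t := by
  induction Is generalizing c Φ s t with
  | nil => simp [branchExp, hs]
  | cons I Is ih =>
    have hI := hIs I (by simp)
    have ih' := ih fun J hJ => hIs J (by simp [hJ])
    simp only [List.map_cons, branchExp, parallelInstr_enc Θ henc]
    cases I with
    | classical f =>
      simp only [parallelAction, PMF.lexp_map, Function.comp_def]
      refine PMF.lexp_congr _ fun c' hc' => ih' _ _ _ _ ?_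
      have : (enc c).length ≤ (enc c').length := hmono _ _ fun j => hI _ _ <| by
        rw [PMF.mem_support_iff] at hc' ⊢
        exact (Finset.prod_ne_zero_iff.1 hc') j (Finset.mem_univ j)
      omega
    | unitary U => exact ih' _ _ _ _ (by omega)
    | measure P upd =>
      simp only [parallelAction]
      refine Finset.sum_congr rfl fun i _ => ih' _ _ _ _ ?_
      have : (enc c).length ≤ _ := hmono c (fun j => upd (c j) (outcomeEquiv ι i j))
        fun j => hI _ _
      omega

omit henc in
/-- Without a register, the instructions of the copies do nothing. -/
theorem branchExp_parallel_nil (hQ : ∀ c, enc c ≠ []) (g : List Bool → ℕ → ℝ≥0∞)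
    (Is : List (CopyInstr C X)) (φ : QubitSpace 0) :
    branchExp 0 g (Is.map (parallelInstr Θ enc)) [] φ 0 =
      ENNReal.ofReal (‖φ‖ ^ 2) * g [] 0 := by
  induction Is with
  | nil => rfl
  | cons I Is ih =>
    have h : parallelInstr Θ enc I 0 [] = .classical (PMF.pure []) :=
      dif_neg fun h => h.2.elim hQ
    simp only [List.map_cons, branchExp, h, PMF.lexp_pure]
    exact ih

end Parallel

/-- Any two unit vectors in spaces of the same finite dimension correspond under some isometry. -/
theorem exists_linearIsometryEquiv_map_eq {E F : Type} [NormedAddCommGroup E]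
    [InnerProductSpace ℂ E] [FiniteDimensional ℂ E] [NormedAddCommGroup F] [InnerProductSpace ℂ F]
    [FiniteDimensional ℂ F] (h : Module.finrank ℂ E = Module.finrank ℂ F) {a : E} {b : F}
    (ha : ‖a‖ = 1) (hb : ‖b‖ = 1) : ∃ Θ : E ≃ₗᵢ[ℂ] F, Θ a = b := by
  have key : ∀ {G : Type} [NormedAddCommGroup G] [InnerProductSpace ℂ G]
      [FiniteDimensional ℂ G] {n : ℕ} (_ : Module.finrank ℂ G = n) {x : G} (_ : ‖x‖ = 1)
      (i : Fin n), ∃ B : OrthonormalBasis (Fin n) ℂ G, B i = x := by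
    intro G _ _ _ n hn x hx i
    have ho : Orthonormal ℂ (Set.domRestrict {i} fun _ : Fin n => x) := by
      rw [orthonormal_iff_ite]
      rintro ⟨j, rfl⟩ ⟨k, hk⟩
      have : k = j := hk
      subst this
      simpa [inner_self_eq_norm_sq_to_K] using Or.inl hx
    obtain ⟨B, hB⟩ := ho.exists_orthonormalBasis_extension_of_card_eq (by simpa using hn)
    exact ⟨B, hB i rfl⟩
  have hpos : 0 < Module.finrank ℂ F := by
    have : Nontrivial F := ⟨b, 0, fun h0 => by simp [h0] at hb⟩
    exact Module.finrank_pos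
  obtain ⟨B₁, h₁⟩ := key h ha ⟨0, hpos⟩
  obtain ⟨B₂, h₂⟩ := key rfl hb ⟨0, hpos⟩
  exact ⟨B₁.equiv B₂ (Equiv.refl _), by rw [← h₁, OrthonormalBasis.equiv_apply_basis]; exact h₂⟩

/-! ### Independent samples from a finite distribution -/

section IID

variable {C ι κ : Type*} [Fintype C] [Fintype ι] [DecidableEq ι] [Fintype κ] [DecidableEq κ]

/-- The expectation of `F` over independent samples, one for every `j : ι`, from the distribution
with weights `p`. -/
def iidExp (p : C → ℝ) (F : (ι → C) → ℝ) : ℝ := ∑ c : ι → C, (∏ j, p (c j)) * F c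

theorem iidExp_prod (p : C → ℝ) (g : ι → C → ℝ) :
    iidExp p (fun c => ∏ j, g j (c j)) = ∏ j, ∑ x, p x * g j x := by
  simp only [iidExp, ← Finset.prod_mul_distrib]
  rw [Finset.prod_univ_sum]
  simp

theorem iidExp_sum {α : Type*} (p : C → ℝ) (s : Finset α) (F : α → (ι → C) → ℝ) :
    iidExp p (fun c => ∑ a ∈ s, F a c) = ∑ a ∈ s, iidExp p (F a) := by
  simp only [iidExp, Finset.mul_sum]
  rw [Finset.sum_comm]

theorem iidExp_add (p : C → ℝ) (F G : (ι → C) → ℝ) :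
    iidExp p (fun c => F c + G c) = iidExp p F + iidExp p G := by
  simp only [iidExp, mul_add, Finset.sum_add_distrib]

theorem iidExp_mul_left (p : C → ℝ) (a : ℝ) (F : (ι → C) → ℝ) :
    iidExp p (fun c => a * F c) = a * iidExp p F := by
  simp only [iidExp, Finset.mul_sum]
  exact Finset.sum_congr rfl fun c _ => by ring

variable {p : C → ℝ}

theorem iidExp_mono (hp : ∀ x, 0 ≤ p x) {F G : (ι → C) → ℝ} (h : ∀ c, F c ≤ G c) :
    iidExp p F ≤ iidExp p G :=
  Finset.sum_le_sum fun c _ => mul_le_mul_of_nonneg_left (h c) (Finset.prod_nonneg fun _ _ => hp _)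

theorem iidExp_nonneg (hp : ∀ x, 0 ≤ p x) {F : (ι → C) → ℝ} (h : ∀ c, 0 ≤ F c) :
    0 ≤ iidExp p F :=
  Finset.sum_nonneg fun c _ => mul_nonneg (Finset.prod_nonneg fun _ _ => hp _) (h c)

theorem iidExp_const (hp1 : ∑ x, p x = 1) (a : ℝ) : iidExp p (fun _ : ι → C => a) = a := by
  have h := iidExp_prod p fun (_ : ι) (_ : C) => (1 : ℝ)
  have h2 := iidExp_mul_left p a fun _ : ι → C => (1 : ℝ)
  simp only [Finset.prod_const_one, mul_one, hp1] at h h2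
  rw [h2, h, mul_one]

theorem iidExp_single (hp1 : ∑ x, p x = 1) (f : C → ℝ) (j : ι) :
    iidExp p (fun c => f (c j)) = ∑ x, p x * f x := by
  have h := iidExp_prod p fun (i : ι) (x : C) => if i = j then f x else 1
  simp only [Finset.prod_ite_eq', Finset.mem_univ, if_true] at h
  rw [h, Finset.prod_eq_single j]
  · simp
  · intro i _ hi
    simp [hi, hp1]
  · simp

theorem iidExp_pair (hp1 : ∑ x, p x = 1) (f g : C → ℝ) {j k : ι} (hjk : j ≠ k) :
    iidExp p (fun c => f (c j) * g (c k)) = (∑ x, p x * f x) * ∑ x, p x * g x := by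
  have h := iidExp_prod p fun (i : ι) (x : C) =>
    (if i = j then f x else 1) * if i = k then g x else 1
  simp only [Finset.prod_mul_distrib, Finset.prod_ite_eq', Finset.mem_univ, if_true] at h
  rw [h, ← Finset.prod_subset (Finset.subset_univ {j, k}), Finset.prod_pair hjk]
  · simp [hjk, hjk.symm]
  · intro i _ hi
    simp only [Finset.mem_insert, Finset.mem_singleton, not_or] at hi
    simp [hi.1, hi.2, hp1]

theorem iidExp_sq_sum (hp1 : ∑ x, p x = 1) (f : C → ℝ) (hf : ∑ x, p x * f x = 0) :
    iidExp p (fun c : ι → C => (∑ j, f (c j)) ^ 2) =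
      Fintype.card ι * ∑ x, p x * f x ^ 2 := by
  have h : ∀ j k : ι, iidExp p (fun c => f (c j) * f (c k)) =
      if j = k then ∑ x, p x * f x ^ 2 else 0 := by
    intro j k
    split_ifs with hjk
    · subst hjk
      simp only [← sq]
      exact iidExp_single hp1 (fun x => f x ^ 2) j
    · rw [iidExp_pair hp1 f f hjk, hf, zero_mul]
  simp only [sq, Finset.sum_mul_sum, iidExp_sum, h]
  simp

open scoped Classical in
/-- Chebyshev's inequality for the mean of independent samples. -/
theorem iidExp_mean_far_le (hp : ∀ x, 0 ≤ p x) (hp1 : ∑ x, p x = 1) {Y : C → ℝ} {μ V η : ℝ}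
    (hμ : ∑ x, p x * Y x = μ) (hV : ∑ x, p x * Y x ^ 2 ≤ V) (hη : 0 < η) [Nonempty ι] :
    iidExp p (fun c : ι → C =>
      if η < |(∑ j, Y (c j)) / Fintype.card ι - μ| then 1 else 0) ≤
      V / (Fintype.card ι * η ^ 2) := by
  have hK : (0 : ℝ) < Fintype.card ι := by exact_mod_cast Fintype.card_pos
  set K : ℝ := (Fintype.card ι : ℝ)
  have hvar : ∑ x, p x * (Y x - μ) ^ 2 ≤ V := by
    have : ∑ x, p x * (Y x - μ) ^ 2 = ∑ x, p x * Y x ^ 2 - μ ^ 2 := by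
      have e : ∀ x, p x * (Y x - μ) ^ 2 =
          p x * Y x ^ 2 - 2 * μ * (p x * Y x) + μ ^ 2 * p x := fun x => by ring
      simp only [e, Finset.sum_add_distrib, Finset.sum_sub_distrib, ← Finset.mul_sum, hμ, hp1]
      ring
    nlinarith [sq_nonneg μ]
  have h0 : ∑ x, p x * (Y x - μ) = 0 := by
    simp only [mul_sub, Finset.sum_sub_distrib, ← Finset.sum_mul, hμ, hp1]
    ring
  have hsq := iidExp_sq_sum (ι := ι) hp1 (fun x => Y x - μ) h0
  calc iidExp p (fun c : ι → C =>
        if η < |(∑ j, Y (c j)) / Fintype.card ι - μ| then 1 else 0)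
      ≤ iidExp p (fun c : ι → C => (1 / (K * η) ^ 2) * (∑ j, (Y (c j) - μ)) ^ 2) := by
        refine iidExp_mono hp fun c => ?_
        split_ifs with h
        · rw [one_div, inv_mul_eq_div, le_div_iff₀ (by positivity), one_mul]
          have e : ∑ j, (Y (c j) - μ) = K * ((∑ j, Y (c j)) / K - μ) := by
            rw [Finset.sum_sub_distrib, Finset.sum_const, Finset.card_univ, nsmul_eq_mul]
            field_simp
            ring
          rw [e, mul_pow, mul_pow, ← sq_abs ((∑ j, Y (c j)) / K - μ)]
          gcongr
        · positivity
    _ = K * (∑ x, p x * (Y x - μ) ^ 2) / (K * η) ^ 2 := by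
        rw [iidExp_mul_left, hsq]
        ring
    _ ≤ K * V / (K * η) ^ 2 := by gcongr
    _ = V / (K * η ^ 2) := by field_simp

theorem sum_prod_weight (hp1 : ∑ x, p x = 1) : ∑ d : κ → C, ∏ k, p (d k) = 1 := by
  have := iidExp_const (ι := κ) hp1 1
  simpa [iidExp] using this

/-- Independent samples can be drawn in independent groups. -/
theorem iidExp_curry (p : C → ℝ) (F : (ι → κ → C) → ℝ) :
    iidExp p (fun c : ι × κ → C => F fun i k => c (i, k)) =
      iidExp (fun d : κ → C => ∏ k, p (d k)) F := by
  unfold iidExp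
  refine Fintype.sum_equiv (Equiv.curry ι κ C) _ _ fun c => ?_
  rw [Fintype.prod_prod_type]
  rfl

open scoped Classical in
/-- Amplification: if a group is bad with probability at most `1/16`, at least half of `r`
independent groups are bad with probability at most `2⁻ʳ`. -/
theorem iidExp_half_bad_le {r : ℕ} (hp : ∀ x, 0 ≤ p x) (hp1 : ∑ x, p x = 1) (bad : C → Prop)
    (hbad : ∑ x, p x * (if bad x then 1 else 0) ≤ 1 / 16) :
    iidExp p (fun c : Fin r → C =>
      if r ≤ 2 * (Finset.univ.filter fun i => bad (c i)).card then 1 else 0) ≤ (1 / 2) ^ r := by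
  calc _ ≤ iidExp p (fun c : Fin r → C =>
          ∑ A ∈ (Finset.univ : Finset (Finset (Fin r))).filter (fun A => r ≤ 2 * A.card),
            ∏ i, if i ∈ A then (if bad (c i) then (1 : ℝ) else 0) else 1) := by
        refine iidExp_mono hp fun c => ?_
        have hnn : ∀ A : Finset (Fin r),
            (0 : ℝ) ≤ ∏ i, if i ∈ A then (if bad (c i) then (1 : ℝ) else 0) else 1 :=
          fun A => Finset.prod_nonneg fun i _ => by split_ifs <;> norm_num
        split_ifs with h
        · refine le_trans ?_ (Finset.single_le_sum (fun A _ => hnn A)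
            (Finset.mem_filter.2 ⟨Finset.mem_univ _, h⟩))
          refine le_of_eq (Finset.prod_eq_one fun i _ => ?_).symm
          by_cases hi : bad (c i) <;> simp [hi]
        · exact Finset.sum_nonneg fun A _ => hnn A
    _ = ∑ A ∈ (Finset.univ : Finset (Finset (Fin r))).filter (fun A => r ≤ 2 * A.card),
          (∑ x, p x * if bad x then 1 else 0) ^ A.card := by
        rw [iidExp_sum]
        refine Finset.sum_congr rfl fun A _ => ?_
        rw [iidExp_prod p fun (i : Fin r) x =>
          if i ∈ A then (if bad x then (1 : ℝ) else 0) else 1]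
        have : ∀ i, (∑ x, p x * if i ∈ A then (if bad x then (1 : ℝ) else 0) else 1) =
            if i ∈ A then ∑ x, p x * (if bad x then 1 else 0) else 1 := fun i => by
          split_ifs <;> simp [hp1]
        simp only [this]
        rw [Finset.prod_ite_mem, Finset.univ_inter, Finset.prod_const]
    _ ≤ ∑ A ∈ (Finset.univ : Finset (Finset (Fin r))).filter (fun A => r ≤ 2 * A.card),
          ((1 : ℝ) / 4) ^ r := by
        refine Finset.sum_le_sum fun A hA => ?_
        have hA' := (Finset.mem_filter.1 hA).2
        have h0 : 0 ≤ ∑ x, p x * (if bad x then (1 : ℝ) else 0) :=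
          Finset.sum_nonneg fun x _ => mul_nonneg (hp x) (by split_ifs <;> norm_num)
        calc (∑ x, p x * if bad x then (1 : ℝ) else 0) ^ A.card ≤ (1 / 16) ^ A.card := by gcongr
          _ = (1 / 4) ^ (2 * A.card) := by rw [pow_mul]; norm_num
          _ ≤ (1 / 4) ^ r := pow_le_pow_of_le_one (by norm_num) (by norm_num) hA'
    _ ≤ (2 : ℝ) ^ r * (1 / 4) ^ r := by
        rw [Finset.sum_const, nsmul_eq_mul]
        gcongr
        have := Finset.card_filter_le (Finset.univ : Finset (Finset (Fin r)))
          (fun A => r ≤ 2 * A.card)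
        rw [Finset.card_univ, Fintype.card_finset, Fintype.card_fin] at this
        exact_mod_cast this
    _ = (1 / 2) ^ r := by rw [← mul_pow]; norm_num

end IID

/-! ### Independent coins -/

section Coins

variable {ι : Type*} [Fintype ι] [DecidableEq ι]

/-- The weights of a coin that shows `true` with probability `ρ`. -/
def coinWeight (ρ : ℝ) (b : Bool) : ℝ := if b then ρ else 1 - ρ

theorem sum_coinWeight (ρ : ℝ) : ∑ b, coinWeight ρ b = 1 := by simp [coinWeight]

theorem coinWeight_nonneg {ρ : ℝ} (h0 : 0 ≤ ρ) (h1 : ρ ≤ 1) (b : Bool) : 0 ≤ coinWeight ρ b := by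
  unfold coinWeight
  split_ifs <;> linarith

open scoped Classical in
theorem iidExp_coin_all (ρ : ℝ) (J : Finset ι) :
    iidExp (coinWeight ρ) (fun c => if ∀ j ∈ J, c j = true then 1 else 0) = ρ ^ J.card := by
  have h := iidExp_prod (coinWeight ρ)
    fun (i : ι) (b : Bool) => if i ∈ J then (if b = true then (1 : ℝ) else 0) else 1
  have e : ∀ c : ι → Bool, (∏ i, if i ∈ J then (if c i = true then (1 : ℝ) else 0) else 1) =
      if ∀ j ∈ J, c j = true then 1 else 0 := fun c => by
    rw [Finset.prod_ite_mem, Finset.univ_inter, Finset.prod_ite_zero]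
    simp
  simp only [e] at h
  rw [h]
  have : ∀ i, (∑ b, coinWeight ρ b * if i ∈ J then (if b = true then (1 : ℝ) else 0) else 1) =
      if i ∈ J then ρ else 1 := fun i => by
    split_ifs <;> simp [coinWeight]
  simp only [this]
  rw [Finset.prod_ite_mem, Finset.univ_inter, Finset.prod_const]

open scoped Classical in
/-- A coin outside `J` is independent of the event that all coins in `J` show `false`. -/
theorem iidExp_coin_mul_none (ρ : ℝ) (J : Finset ι) {l : ι} (hl : l ∉ J) :
    iidExp (coinWeight ρ) (fun c =>
      (if c l = true then 1 else 0) * if ∀ j ∈ J, c j = false then 1 else 0) =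
    ρ * iidExp (coinWeight ρ) (fun c => if ∀ j ∈ J, c j = false then 1 else 0) := by
  have e : ∀ c : ι → Bool, (∏ i, if i ∈ J then (if c i = false then (1 : ℝ) else 0) else 1) =
      if ∀ j ∈ J, c j = false then 1 else 0 := fun c => by
    rw [Finset.prod_ite_mem, Finset.univ_inter, Finset.prod_ite_zero]
    simp
  have h1 := iidExp_prod (coinWeight ρ)
    fun (i : ι) (b : Bool) => if i ∈ J then (if b = false then (1 : ℝ) else 0) else 1
  have h2 := iidExp_prod (coinWeight ρ)
    fun (i : ι) (b : Bool) => (if i = l then (if b = true then (1 : ℝ) else 0) else 1) *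
      if i ∈ J then (if b = false then (1 : ℝ) else 0) else 1
  simp only [Finset.prod_mul_distrib, Finset.prod_ite_eq', Finset.mem_univ, if_true, e] at h1 h2
  rw [h1, h2, ← Finset.mul_prod_erase Finset.univ _ (Finset.mem_univ l),
    ← Finset.mul_prod_erase Finset.univ
      (fun i => ∑ x, coinWeight ρ x * if i ∈ J then if x = false then (1 : ℝ) else 0 else 1)
      (Finset.mem_univ l)]
  have h3 : ∏ x ∈ Finset.univ.erase l, (∑ b, coinWeight ρ b *
      ((if x = l then if b = true then (1 : ℝ) else 0 else 1) *
        if x ∈ J then if b = false then (1 : ℝ) else 0 else 1)) =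
      ∏ x ∈ Finset.univ.erase l, ∑ b, coinWeight ρ b *
        if x ∈ J then if b = false then (1 : ℝ) else 0 else 1 :=
    Finset.prod_congr rfl fun x hx => by simp [Finset.ne_of_mem_erase hx]
  rw [h3]
  simp [hl, coinWeight]

open scoped Classical in
/-- The union bound. -/
theorem iidExp_coin_exists_le {ρ : ℝ} (h0 : 0 ≤ ρ) (h1 : ρ ≤ 1) (J : Finset ι) :
    iidExp (coinWeight ρ) (fun c => if ∃ j ∈ J, c j = true then 1 else 0) ≤ ρ * J.card := by
  calc _ ≤ iidExp (coinWeight ρ) (fun c => ∑ j ∈ J, if c j = true then (1 : ℝ) else 0) := by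
        refine iidExp_mono (coinWeight_nonneg h0 h1) fun c => ?_
        split_ifs with h
        · obtain ⟨j, hj, hc⟩ := h
          refine le_trans (by simp [hc])
            (Finset.single_le_sum (f := fun j => if c j = true then (1 : ℝ) else 0)
              (fun i _ => by split_ifs <;> norm_num) hj)
        · exact Finset.sum_nonneg fun i _ => by split_ifs <;> norm_num
    _ = ρ * J.card := by
        rw [iidExp_sum]
        have : ∀ j : ι, iidExp (coinWeight ρ) (fun c => if c j = true then (1 : ℝ) else 0) = ρ :=
          fun j => by
            rw [iidExp_single (sum_coinWeight ρ) (fun b => if b = true then (1 : ℝ) else 0) j]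
            simp [coinWeight]
        simp only [this]
        rw [Finset.sum_const, nsmul_eq_mul, mul_comm]

end Coins

/-! ### Elementary facts about copy programs -/

section CopyFacts

variable {C X : Type} [Fintype X] [DecidableEq X]

theorem sum_map_toReal_mul {A : Type*} [Fintype A] [Fintype C] (p : PMF A) (f : A → C)
    (F : C → ℝ) : ∑ c, ((p.map f) c).toReal * F c = ∑ a, (p a).toReal * F (f a) := by
  classical
  have h : ∀ c, ((p.map f) c).toReal = ∑ a, if c = f a then (p a).toReal else 0 := fun c => by
    rw [PMF.map_apply, tsum_fintype, ENNReal.toReal_sum]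
    · exact Finset.sum_congr rfl fun a _ => by split_ifs <;> rfl
    · intro a _
      split_ifs
      · exact p.apply_ne_top a
      · simp
  simp only [h, Finset.sum_mul]
  rw [Finset.sum_comm]
  exact Finset.sum_congr rfl fun a _ => by simp

omit [DecidableEq X] in
theorem ofReal_normSqVec_mulVec (A : Matrix X X ℂ) (φ : X → ℂ) :
    ((normSqVec (A.mulVec φ) : ℝ) : ℂ) =
      dotProduct (star φ) ((A.conjTranspose * A).mulVec φ) := by
  have h : ∀ v : X → ℂ, ((normSqVec v : ℝ) : ℂ) = dotProduct (star v) v := fun v => by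
    simp only [normSqVec, dotProduct, Complex.ofReal_sum, Pi.star_apply]
    refine Finset.sum_congr rfl fun x _ => ?_
    rw [Complex.ofReal_pow, Complex.star_def, Complex.conj_mul']
  rw [h, Matrix.star_mulVec, ← Matrix.mulVec_mulVec, ← Matrix.dotProduct_mulVec]

theorem normSqVec_unitary (U : Matrix.unitaryGroup X ℂ) (φ : X → ℂ) :
    normSqVec (U.1.mulVec φ) = normSqVec φ := by
  have h1 := ofReal_normSqVec_mulVec U.1 φ
  have h2 := ofReal_normSqVec_mulVec (1 : Matrix X X ℂ) φ
  have h3 : U.1.conjTranspose * U.1 = 1 := (Unitary.mem_iff.1 U.2).1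
  rw [h3] at h1
  simp only [Matrix.conjTranspose_one, mul_one, Matrix.one_mulVec] at h1 h2
  exact_mod_cast h1.trans h2.symm

theorem MatPVM.sum_normSqVec (P : MatPVM X) (φ : X → ℂ) :
    ∑ o, normSqVec ((P.proj o).mulVec φ) = normSqVec φ := by
  have h2 := ofReal_normSqVec_mulVec (1 : Matrix X X ℂ) φ
  simp only [Matrix.conjTranspose_one, mul_one, Matrix.one_mulVec] at h2
  have h : ((∑ o, normSqVec ((P.proj o).mulVec φ) : ℝ) : ℂ) = (normSqVec φ : ℝ) := by
    have e : ∀ o, (P.proj o).conjTranspose * P.proj o = P.proj o := fun o => by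
      have h3 : (P.proj o).conjTranspose = P.proj o := (P.isStarProjection o).isSelfAdjoint
      rw [h3]
      exact (P.isStarProjection o).isIdempotentElem
    rw [Complex.ofReal_sum]
    simp only [ofReal_normSqVec_mulVec, e, h2]
    rw [← dotProduct_sum, ← Matrix.sum_mulVec, P.sum_eq_one, Matrix.one_mulVec]
  exact_mod_cast h

theorem sum_signType {A : Type*} [AddCommMonoid A] (f : SignType → A) :
    ∑ o, f o = f 0 + f (-1) + f 1 := by
  have : (Finset.univ : Finset SignType) = {0, -1, 1} := by decide
  rw [this]
  rw [Finset.sum_insert (by decide), Finset.sum_insert (by decide), Finset.sum_singleton, add_assoc]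

/-- The measurement that always has outcome `0`. -/
def MatPVM.trivial : MatPVM X where
  proj o := if o = 0 then 1 else 0
  isStarProjection o := by
    split_ifs
    · exact IsStarProjection.one _
    · exact IsStarProjection.zero _
  sum_eq_one := by simp

/-- The unitary that permutes the basis vectors. -/
def permUnitary (σ : Equiv.Perm X) : Matrix.unitaryGroup X ℂ :=
  ⟨σ.permMatrix ℂ, by
    rw [Matrix.mem_unitaryGroup_iff']
    change (σ.permMatrix ℂ).conjTranspose * _ = 1
    rw [Matrix.conjTranspose_permMatrix, ← Matrix.permMatrix_mul]
    simp⟩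

theorem permUnitary_mulVec (σ : Equiv.Perm X) (φ : X → ℂ) :
    (permUnitary σ).1.mulVec φ = φ ∘ σ := Matrix.permMatrix_mulVec σ

/-- For an involution `π` that preserves the set `H`: the measurement whose outcomes `1` and `-1`
project onto the vectors supported on `H` that are invariant, respectively anti-invariant, under
`π`, and whose outcome `0` projects onto the vectors supported off `H`. -/
def pairingPVM (H : X → Prop) [DecidablePred H] (π : X → X) (hπ : ∀ x, π (π x) = x)
    (hH : ∀ x, H (π x) ↔ H x) : MatPVM X where
  proj o := Matrix.of fun x y =>
    if o = 0 then (if H x then 0 else if y = x then 1 else 0)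
    else if H x then ((if y = x then 1 else 0) + (o : ℂ) * if y = π x then 1 else 0) / 2 else 0
  isStarProjection o := by
    have hs : (o : ℂ) = 0 ∨ (o : ℂ) = 1 ∨ (o : ℂ) = -1 := by
      cases o <;> simp
    constructor
    · ext x y
      by_cases ho : o = 0
      · by_cases hx : H x
        · simp [Matrix.mul_apply, ho, hx]
        · simp only [Matrix.mul_apply, ho, hx, if_false, if_true, Matrix.of_apply, ite_mul, one_mul,
            zero_mul, Finset.sum_ite_eq', Finset.mem_univ]
      · by_cases hx : H x
        · have hs' : (o : ℂ) = 1 ∨ (o : ℂ) = -1 := by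
            revert ho; cases o <;> simp
          have hq : (o : ℂ) * o = 1 := by rcases hs' with h | h <;> rw [h] <;> norm_num
          simp only [Matrix.mul_apply, ho, hx, if_false, if_true, Matrix.of_apply]
          have e : ∀ z, ((if z = x then (1 : ℂ) else 0) + (o : ℂ) * if z = π x then 1 else 0) / 2 *
              (if H z then ((if y = z then 1 else 0) + (o : ℂ) * if y = π z then 1 else 0) / 2
                else 0) =
              (if z = x then (if H z then ((if y = z then 1 else 0) +
                (o : ℂ) * if y = π z then 1 else 0) / 4 else 0) else 0) +
              (if z = π x then (o : ℂ) * (if H z then ((if y = z then 1 else 0) +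
                (o : ℂ) * if y = π z then 1 else 0) / 4 else 0) else 0) := fun z => by
            split_ifs <;> ring
          simp only [e, Finset.sum_add_distrib, Finset.sum_ite_eq', Finset.mem_univ, if_true, hH,
            hx, hπ]
          linear_combination (if y = x then (1 : ℂ) else 0) / 4 * hq
        · simp [Matrix.mul_apply, ho, hx]
    · refine Matrix.IsHermitian.ext fun x y => ?_
      simp only [Matrix.of_apply]
      by_cases hxy : x = y
      · subst hxy
        rcases hs with h | h | h <;> rw [h] <;> split_ifs <;> simp
      · by_cases hp : y = π x
        · have hp' : x = π y := by rw [hp, hπ]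
          have hHy : H y ↔ H x := by rw [hp, hH]
          simp only [hHy, hxy, Ne.symm hxy, if_false, if_pos hp, if_pos hp', zero_add]
          rcases hs with h | h | h <;> rw [h] <;> split_ifs <;> simp
        · have hp' : ¬ x = π y := fun h => hp (by rw [h, hπ])
          simp only [hxy, Ne.symm hxy, if_false, if_neg hp, if_neg hp']
          split_ifs <;> simp
  sum_eq_one := by
    ext x y
    rw [Matrix.sum_apply, sum_signType]
    by_cases hx : H x
    · simp only [Matrix.of_apply, hx, Matrix.one_apply]
      by_cases hxy : x = y
      · subst hxy
        by_cases hp : x = π x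
        · simp [← hp]
        · simp [hp]
          norm_num
      · by_cases hp : y = π x
        · simp [hxy, Ne.symm hxy, hp.symm]
          norm_num
        · simp [hxy, Ne.symm hxy, hp]
    · by_cases hxy : x = y
      · subst hxy; simp [hx]
      · simp [hx, hxy, Ne.symm hxy]

theorem pairingPVM_zero_mulVec (H : X → Prop) [DecidablePred H] (π : X → X)
    (hπ : ∀ x, π (π x) = x) (hH : ∀ x, H (π x) ↔ H x) (φ : X → ℂ) (x : X) :
    ((pairingPVM H π hπ hH).proj 0).mulVec φ x = if H x then 0 else φ x := by
  by_cases hx : H x <;> simp [pairingPVM, Matrix.mulVec, dotProduct, hx]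

theorem pairingPVM_mulVec (H : X → Prop) [DecidablePred H] (π : X → X)
    (hπ : ∀ x, π (π x) = x) (hH : ∀ x, H (π x) ↔ H x) (φ : X → ℂ) (x : X) {o : SignType}
    (ho : o ≠ 0) :
    ((pairingPVM H π hπ hH).proj o).mulVec φ x =
      if H x then (φ x + (o : ℂ) * φ (π x)) / 2 else 0 := by
  by_cases hx : H x
  · simp only [pairingPVM, Matrix.mulVec, dotProduct, Matrix.of_apply, ho, hx, if_false, if_true]
    have e : ∀ y, ((if y = x then (1 : ℂ) else 0) + (o : ℂ) * if y = π x then 1 else 0) / 2 * φ y =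
        (if y = x then φ y / 2 else 0) + (if y = π x then (o : ℂ) * φ y / 2 else 0) := fun y => by
      split_ifs <;> ring
    simp only [e, Finset.sum_add_distrib, Finset.sum_ite_eq', Finset.mem_univ, if_true]
    ring
  · simp [pairingPVM, Matrix.mulVec, dotProduct, ho, hx]

/-- The bias of the pairing measurement counts the pairs `{x, π x}` on which a real vector does not
vanish. -/
theorem pairingPVM_bias (H : X → Prop) [DecidablePred H] (π : X → X)
    (hπ : ∀ x, π (π x) = x) (hH : ∀ x, H (π x) ↔ H x) (f : X → ℝ) :
    normSqVec (((pairingPVM H π hπ hH).proj 1).mulVec fun x => (f x : ℂ)) -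
      normSqVec (((pairingPVM H π hπ hH).proj (-1)).mulVec fun x => (f x : ℂ)) =
    ∑ x, if H x then f x * f (π x) else 0 := by
  simp only [normSqVec]
  rw [← Finset.sum_sub_distrib]
  refine Finset.sum_congr rfl fun x _ => ?_
  rw [pairingPVM_mulVec _ _ _ _ _ _ (by decide), pairingPVM_mulVec _ _ _ _ _ _ (by decide)]
  split_ifs
  · have h1 : ((f x : ℂ) + ((1 : SignType) : ℂ) * (f (π x) : ℂ)) / 2 =
        (((f x + f (π x)) / 2 : ℝ) : ℂ) := by push_cast; simp
    have h2 : ((f x : ℂ) + ((-1 : SignType) : ℂ) * (f (π x) : ℂ)) / 2 =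
        (((f x - f (π x)) / 2 : ℝ) : ℂ) := by push_cast; simp [sub_eq_add_neg]
    rw [h1, h2, Complex.norm_real, Complex.norm_real, Real.norm_eq_abs, Real.norm_eq_abs, sq_abs,
      sq_abs]
    ring
  · simp

end CopyFacts

/-! ### The estimator of one copy -/

/-- A stream element: an edge with its sign. -/
abbrev Token (n : ℕ) : Type := Sym2 (Fin n) × ℤˣ

/-- A directed signed edge `(x, w, σ)`: the edge `{x, w}` of sign `σ`, filed under its end `x`; the
other end `w` is called its centre. -/
abbrev Entry (n : ℕ) : Type := Fin n × Fin n × ℤˣ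

/-- The two ends of the edge of a token, in an order fixed once and for all. -/
def Token.endpoint {n : ℕ} (tok : Token n) (b : Bool) : Fin n :=
  if b then (Quot.out tok.1).2 else (Quot.out tok.1).1

/-- The two directed edges of a token. -/
def Token.entry {n : ℕ} (tok : Token n) (b : Bool) : Entry n :=
  (tok.endpoint b, tok.endpoint (!b), tok.2)

/-- A token hits the entries that are filed under one of its ends and can be part of a triangle
with exactly one positive edge that contains the token's edge. -/
def Token.Hits {n : ℕ} (tok : Token n) (x : Entry n) : Prop :=
  (x.1 = tok.endpoint false ∨ x.1 = tok.endpoint true) ∧ ¬(tok.2 = 1 ∧ x.2.2 = 1)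

instance {n : ℕ} (tok : Token n) : DecidablePred tok.Hits := fun _ => instDecidableAnd

/-- The entry that completes `x` to a triangle with exactly one positive edge together with the
edge of the token, if the token hits `x`. -/
def Token.partner {n : ℕ} (tok : Token n) (x : Entry n) : Entry n :=
  (Equiv.swap (tok.endpoint false) (tok.endpoint true) x.1, x.2.1, tok.2 * x.2.2)

section Token

variable {n : ℕ} (tok : Token n)

theorem Token.mk_endpoint : s(tok.endpoint false, tok.endpoint true) = tok.1 := by
  simp only [Token.endpoint]
  exact Quot.out_eq tok.1

theorem Token.partner_partner (x : Entry n) : tok.partner (tok.partner x) = x := by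
  simp [Token.partner, ← mul_assoc, Int.units_mul_self]

theorem Token.hits_partner (x : Entry n) : tok.Hits (tok.partner x) ↔ tok.Hits x := by
  have h1 : ∀ y, (Equiv.swap (tok.endpoint false) (tok.endpoint true) y = tok.endpoint false ∨
      Equiv.swap (tok.endpoint false) (tok.endpoint true) y = tok.endpoint true) ↔
      (y = tok.endpoint false ∨ y = tok.endpoint true) := fun y => by
    rw [Equiv.swap_apply_eq_iff, Equiv.swap_apply_eq_iff, Equiv.swap_apply_left,
      Equiv.swap_apply_right, or_comm]
  have h2 : (tok.2 = 1 ∧ tok.2 * x.2.2 = 1) ↔ (tok.2 = 1 ∧ x.2.2 = 1) := by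
    constructor <;> rintro ⟨a, b⟩ <;> simp_all
  simp only [Token.Hits, Token.partner, h1, h2]

end Token

/-- The labels of the basis states of one quantum register: dummies (numbered by the time steps,
two for each), entries, and labels that are never used. -/
abbrev QLabel (n M J : ℕ) : Type := ((ZMod (M + 1) × Bool) ⊕ Entry n) ⊕ Fin J

section Quantum

variable {n M J : ℕ}

/-- The labels hit by a token. -/
def Token.HitsLabel (tok : Token n) : QLabel n M J → Prop
  | .inl (.inr x) => tok.Hits x
  | _ => False

instance (tok : Token n) : DecidablePred (tok.HitsLabel (M := M) (J := J))
  | .inl (.inr x) => inferInstanceAs (Decidable (tok.Hits x))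
  | .inl (.inl _) => isFalse id
  | .inr _ => isFalse id

/-- The pairing of labels given by `Token.partner`. -/
def Token.partnerLabel (tok : Token n) : QLabel n M J → QLabel n M J
  | .inl (.inr x) => .inl (.inr (tok.partner x))
  | y => y

/-- The measurement made on the arrival of a token. -/
def Token.pvm (tok : Token n) : MatPVM (QLabel n M J) :=
  pairingPVM tok.HitsLabel tok.partnerLabel
    (by rintro ((y | x) | y) <;> simp [Token.partnerLabel, Token.partner_partner])
    (by rintro ((y | x) | y) <;> simp [Token.partnerLabel, Token.HitsLabel, Token.hits_partner])

/-- The permutation that files the two entries of a token at time `t`: it exchanges them with the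
dummies of that time. -/
def Token.filing (tok : Token n) (t : ZMod (M + 1)) : Equiv.Perm (QLabel n M J) :=
  Equiv.swap (.inl (.inl (t, false))) (.inl (.inr (tok.entry false))) *
    Equiv.swap (.inl (.inl (t, true))) (.inl (.inr (tok.entry true)))

end Quantum

/-- The classical memory of one copy: the seed of the sample of vertices, the last coin, the outcome
of the quantum estimator (`0` as long as there is none), the time, the number of triangles found
classically, and the stored entries, each with a flag that says whether it is
missing from the quantum register. `ZMod` serves as a type of counters of bounded size: neither the
time nor the number of triangles ever reaches the modulus. -/
@[ext]
structure CopyMem (n M : ℕ) (Seed : Type) where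
  seed : Seed
  coin : Bool
  status : SignType
  time : ZMod (M + 1)
  count : ZMod (n ^ 3 + 1)
  items : Finset (Entry n × Bool)

section CopyMem

variable {n M J : ℕ} {Seed : Type}

/-- `CopyMem` as a product. -/
def CopyMem.toProd (m : CopyMem n M Seed) :
    (Seed × Bool × SignType × ZMod (M + 1) × ZMod (n ^ 3 + 1)) × Finset (Entry n × Bool) :=
  ((m.seed, m.coin, m.status, m.time, m.count), m.items)

theorem CopyMem.toProd_injective : Function.Injective (CopyMem.toProd (n := n) (M := M)
    (Seed := Seed)) := by
  rintro ⟨a, b, c, d, e, f⟩ ⟨a', b', c', d', e', f'⟩ h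
  simp only [CopyMem.toProd, Prod.mk.injEq] at h
  simp [h]

instance [Fintype Seed] : Fintype (CopyMem n M Seed) :=
  Fintype.ofInjective _ CopyMem.toProd_injective

instance : DecidableEq (CopyMem n M Seed) := Classical.decEq _

/-- Two stored entries that form a triangle with exactly one positive edge together with the edge of
the token, in the order of the token's ends. -/
def Token.Closes (tok : Token n) (x y : Entry n) : Prop :=
  x.1 = tok.endpoint false ∧ y.1 = tok.endpoint true ∧ x.2.1 = y.2.1 ∧ y.2.2 = tok.2 * x.2.2 ∧
    ¬(tok.2 = 1 ∧ x.2.2 = 1)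

instance (tok : Token n) (x y : Entry n) : Decidable (tok.Closes x y) := instDecidableAnd

/-- The coins tossed on one token: whether to measure, and whether to store each of the two
entries. -/
abbrev Coins : Type := Bool × (Bool → Bool)

/-- The probability of the coins: `κ` is the rate of measurements, `q` the rate at which entries are
stored. -/
def coinsWeight (κ q : ℝ) (a : Coins) : ℝ :=
  coinWeight κ a.1 * (coinWeight q (a.2 false) * coinWeight q (a.2 true))

theorem coinsWeight_nonneg {κ q : ℝ} (hκ : 0 ≤ κ ∧ κ ≤ 1) (hq : 0 ≤ q ∧ q ≤ 1) (a : Coins) :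
    0 ≤ coinsWeight κ q a :=
  mul_nonneg (coinWeight_nonneg hκ.1 hκ.2 _)
    (mul_nonneg (coinWeight_nonneg hq.1 hq.2 _) (coinWeight_nonneg hq.1 hq.2 _))

theorem sum_bool_fun {A : Type*} [AddCommMonoid A] (F : (Bool → Bool) → A) :
    ∑ b, F b = ∑ x, ∑ y, F (fun β => if β then y else x) := by
  rw [← Fintype.sum_prod_type']
  refine Fintype.sum_equiv (Equiv.boolArrowEquivProd Bool) _ _ fun b => ?_
  refine congrArg F (funext fun β => ?_)
  cases β <;> rfl

theorem sum_coinsWeight (κ q : ℝ) : ∑ a, coinsWeight κ q a = 1 := by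
  simp only [coinsWeight, Fintype.sum_prod_type, ← Finset.mul_sum]
  rw [← Finset.sum_mul, sum_coinWeight, sum_bool_fun]
  simp only [Bool.false_eq_true, if_false, if_true, ← Finset.mul_sum, sum_coinWeight, mul_one]

/-- The law of the coins. -/
def coinsPMF {κ q : ℝ} (hκ : 0 ≤ κ ∧ κ ≤ 1) (hq : 0 ≤ q ∧ q ≤ 1) : PMF Coins :=
  PMF.ofFintype (fun a => ENNReal.ofReal (coinsWeight κ q a)) (by
    rw [← ENNReal.ofReal_sum_of_nonneg fun a _ => coinsWeight_nonneg hκ hq a, sum_coinsWeight,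
      ENNReal.ofReal_one])

variable (smp : Seed → Fin n → Bool)

/-- The entries of a token that are stored: their centre has to be sampled, and the coin has to
allow it. They are flagged if the token does not file its entries in the quantum register. -/
def newItems (tok : Token n) (seed : Seed) (a : Coins) : Finset (Entry n × Bool) :=
  ((Finset.univ : Finset Bool).filter fun β =>
    smp seed (tok.entry β).2.1 = true ∧ a.2 β = true).image fun β => (tok.entry β, a.1)

/-- The number of pairs of stored entries that a token closes and of which at least one is missing
from the quantum register. -/
def closedPairs (tok : Token n) (items : Finset (Entry n × Bool)) : ℕ :=
  ((items ×ˢ items).filter fun z => tok.Closes z.1.1 z.2.1 ∧ (z.1.2 = true ∨ z.2.2 = true)).card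

/-- The classical step on a token. -/
def memStep (tok : Token n) (a : Coins) (m : CopyMem n M Seed) : CopyMem n M Seed where
  seed := m.seed
  coin := a.1
  status := m.status
  time := m.time + 1
  count := m.count + closedPairs tok m.items
  items := m.items.image (fun y => (y.1, y.2 || (a.1 && decide (tok.Hits y.1)))) ∪
    newItems smp tok m.seed a

variable {κ q : ℝ} (hκ : 0 ≤ κ ∧ κ ≤ 1) (hq : 0 ≤ q ∧ q ≤ 1)

/-- The program of one copy for one token: toss the coins and update the classical memory; if the
first coin shows `true` and the quantum estimator has no outcome yet, measure; otherwise, if it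
shows `false`, file the entries of the token in the quantum register. -/
def tokenProg (tok : Token n) : List (CopyInstr (CopyMem n M Seed) (QLabel n M J)) :=
  [.classical fun m => (coinsPMF hκ hq).map fun a => memStep smp tok a m,
   .measure (fun m => if m.coin = true ∧ m.status = 0 then tok.pvm else MatPVM.trivial)
     fun m o => if m.coin = true ∧ m.status = 0 then { m with status := o } else m,
   .unitary fun m => if m.coin = true then 1 else permUnitary (tok.filing m.time)]

/-- The classical memory after a list of tokens, for given coins, without the outcome of the quantum
estimator. -/
def finalMem : (L : List (Token n)) → (Fin L.length → Coins) → CopyMem n M Seed → CopyMem n M Seed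
  | [], _, m => m
  | tok :: L, r, m => finalMem L (fun i => r i.succ) (memStep smp tok (r 0) m)

/-- The bias of the quantum estimator on a list of tokens, for given coins: the difference of the
probabilities of the outcomes `1` and `-1`. -/
def quantumBias : (L : List (Token n)) → (Fin L.length → Coins) → ZMod (M + 1) →
    (QLabel n M J → ℂ) → ℝ
  | [], _, _, _ => 0
  | tok :: L, r, t, φ =>
    if (r 0).1 = true then
      normSqVec ((tok.pvm.proj 1).mulVec φ) - normSqVec ((tok.pvm.proj (-1)).mulVec φ) +
        quantumBias L (fun i => r i.succ) (t + 1) ((tok.pvm.proj 0).mulVec φ)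
    else quantumBias L (fun i => r i.succ) (t + 1) (φ ∘ tok.filing (t + 1))

omit smp in
theorem iidExp_cons {C : Type*} [Fintype C] {k : ℕ} (p : C → ℝ) (F : (Fin (k + 1) → C) → ℝ) :
    iidExp p F = ∑ a, p a * iidExp p fun r => F (Fin.cons a r) := by
  simp only [iidExp, Finset.mul_sum]
  rw [← Fintype.sum_prod_type']
  refine (Fintype.sum_equiv (Fin.consEquiv fun _ => C) _ _ fun x => ?_).symm
  rw [Fin.prod_univ_succ]
  simp [Fin.consEquiv, mul_assoc]

theorem finalMem_status (L : List (Token n)) (r : Fin L.length → Coins) (m : CopyMem n M Seed)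
    (o : SignType) :
    finalMem smp L r { m with status := o } = { finalMem smp L r m with status := o } := by
  induction L generalizing m with
  | nil => rfl
  | cons tok L ih => exact ih (fun i => r i.succ) (memStep smp tok (r 0) m)

omit smp in
theorem quantumBias_zero (L : List (Token n)) (r : Fin L.length → Coins) (t : ZMod (M + 1)) :
    quantumBias L r t (0 : QLabel n M J → ℂ) = 0 := by
  induction L generalizing t with
  | nil => rfl
  | cons tok L ih =>
    have h0 : (0 : QLabel n M J → ℂ) ∘ tok.filing (t + 1) = 0 := rfl
    simp [quantumBias, ih, h0, Matrix.mulVec_zero]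

omit smp in
theorem iidExp_const_add {C ι : Type*} [Fintype C] [Fintype ι] [DecidableEq ι] {p : C → ℝ}
    (hp : ∑ x, p x = 1) (a : ℝ) (F : (ι → C) → ℝ) :
    iidExp p (fun c => a + F c) = a + iidExp p F := by
  rw [iidExp_add, iidExp_const hp]

variable [Fintype Seed]

/-- The law of the part of the classical memory that does not depend on the quantum estimator. -/
theorem copyExp_tokenProg_classical (g : CopyMem n M Seed → ℝ)
    (hg : ∀ m o, g { m with status := o } = g m) (L : List (Token n)) (m : CopyMem n M Seed)
    (φ : QLabel n M J → ℂ) :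
    copyExp g (L.flatMap (tokenProg smp hκ hq)) m φ =
      normSqVec φ * iidExp (coinsWeight κ q) fun r => g (finalMem smp L r m) := by
  induction L generalizing m φ with
  | nil =>
    simp only [List.flatMap_nil, copyExp, finalMem]
    rw [iidExp_const (sum_coinsWeight κ q)]
  | cons tok L ih =>
    have hlen : iidExp (coinsWeight κ q) (fun r => g (finalMem smp (tok :: L) r m)) =
        ∑ a, coinsWeight κ q a *
          iidExp (coinsWeight κ q) fun r => g (finalMem smp L r (memStep smp tok a m)) := by
      refine (iidExp_cons (k := L.length) _ _).trans ?_
      rfl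
    rw [hlen]
    simp only [List.flatMap_cons, tokenProg, List.cons_append, List.nil_append, copyExp]
    rw [sum_map_toReal_mul, Finset.mul_sum]
    refine Finset.sum_congr rfl fun a _ => ?_
    have hw : (coinsPMF hκ hq a).toReal = coinsWeight κ q a :=
      ENNReal.toReal_ofReal (coinsWeight_nonneg hκ hq a)
    rw [hw]
    simp only [ih, normSqVec_unitary]
    have hst : ∀ o r, g (finalMem smp L r (if (memStep smp tok a m).coin = true ∧
        (memStep smp tok a m).status = 0 then { memStep smp tok a m with status := o }
        else memStep smp tok a m)) = g (finalMem smp L r (memStep smp tok a m)) := by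
      intro o r
      split_ifs
      · rw [finalMem_status, hg]
      · rfl
    simp only [hst]
    rw [← Finset.sum_mul, MatPVM.sum_normSqVec]
    ring

/-- The expectation of the outcome of the quantum estimator. -/
theorem copyExp_tokenProg_status (L : List (Token n)) (m : CopyMem n M Seed)
    (φ : QLabel n M J → ℂ) :
    copyExp (fun m => (m.status : ℝ)) (L.flatMap (tokenProg smp hκ hq)) m φ =
      if m.status = 0 then iidExp (coinsWeight κ q) fun r => quantumBias L r m.time φ
      else normSqVec φ * (m.status : ℝ) := by
  induction L generalizing m φ with
  | nil =>
    simp only [List.flatMap_nil, copyExp, quantumBias]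
    rw [iidExp_const (sum_coinsWeight κ q)]
    split_ifs with h
    · simp [h]
    · rfl
  | cons tok L ih =>
    simp only [List.flatMap_cons, tokenProg, List.cons_append, List.nil_append, copyExp]
    rw [sum_map_toReal_mul]
    have hw : ∀ a, (coinsPMF hκ hq a).toReal = coinsWeight κ q a := fun a =>
      ENNReal.toReal_ofReal (coinsWeight_nonneg hκ hq a)
    simp only [hw, ih]
    by_cases h0 : m.status = 0
    · rw [if_pos h0]
      refine Eq.trans ?_ (iidExp_cons (k := L.length) _ _).symm
      refine Finset.sum_congr rfl fun a _ => ?_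
      congr 1
      obtain ⟨c, b⟩ := a
      cases c with
      | false =>
        have : ∀ o : SignType, (MatPVM.trivial (X := QLabel n M J)).proj o =
            if o = 0 then 1 else 0 := fun _ => rfl
        rw [sum_signType]
        simp only [memStep, h0, Bool.false_eq_true, false_and, if_false, if_true, this]
        rw [if_neg (by decide), if_neg (by decide)]
        simp only [Matrix.one_mulVec, Matrix.zero_mulVec, Matrix.mulVec_zero, quantumBias_zero]
        rw [iidExp_const (sum_coinsWeight κ q), add_zero, add_zero, permUnitary_mulVec]
        rfl
      | true =>
        simp only [memStep, h0, and_self, if_true]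
        rw [sum_signType, if_pos rfl, if_neg (by decide), if_neg (by decide)]
        have e : (iidExp (coinsWeight κ q) fun r : Fin L.length → Coins =>
            quantumBias (tok :: L) (Fin.cons (true, b) r) m.time φ) =
            iidExp (coinsWeight κ q) fun r : Fin L.length → Coins =>
              (normSqVec ((tok.pvm.proj 1).mulVec φ) - normSqVec ((tok.pvm.proj (-1)).mulVec φ)) +
                quantumBias L r (m.time + 1) ((tok.pvm.proj 0).mulVec φ) := rfl
        rw [e, iidExp_const_add (sum_coinsWeight κ q)]
        simp only [OneMemClass.coe_one, Matrix.one_mulVec, SignType.coe_neg_one, SignType.coe_one]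
        ring
    · rw [if_neg h0]
      have hs : ∀ a, (memStep smp tok a m).status = m.status := fun a => rfl
      simp only [hs, h0, and_false, if_false, normSqVec_unitary]
      simp only [← Finset.sum_mul, MatPVM.sum_normSqVec, sum_coinsWeight, one_mul]

end CopyMem

/-! ### The estimator on a stream, for given coins -/

section Stream

variable {n : ℕ} (L : List (Token n))

/-- Positions of directed edges in a stream: the index of a token and one of its two directions. -/
abbrev Pos : Type := Fin L.length × Bool

/-- The entry at a position. -/
def Pos.entry {L : List (Token n)} (p : Pos L) : Entry n := L[p.1].entry p.2

/-- The conditions on the edges of a stream: no edge is repeated, and none is a loop. -/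
def SimpleStream : Prop := (L.map Prod.fst).Nodup ∧ ∀ tok ∈ L, ¬tok.1.IsDiag

/-- The tokens before time `l` whose coin, if it shows `true`, removes the entry at position `p`
from the quantum register: the one that brings the entry, and the later ones that hit it. -/
def blockers (l : ℕ) (p : Pos L) : Finset (Fin L.length) :=
  Finset.univ.filter fun j => j = p.1 ∨ (p.1 < j ∧ j.1 < l ∧ L[j].Hits p.entry)

/-- The entry at position `p` is in the quantum register at time `l`, for the coins `c`. -/
def Alive (c : Fin L.length → Bool) (l : ℕ) (p : Pos L) : Prop :=
  ∀ j ∈ blockers L l p, c j = false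

open scoped Classical in
/-- The triangles of a stream with exactly one positive edge, each given by the position of its last
edge and by the positions of the other two, filed under the ends of the last edge. -/
def wedges : Finset (Fin L.length × Pos L × Pos L) :=
  Finset.univ.filter fun w => w.2.1.1 < w.1 ∧ w.2.2.1 < w.1 ∧
    L[w.1].Closes w.2.1.entry w.2.2.entry

variable {L}

theorem Token.endpoint_ne {tok : Token n} (h : ¬tok.1.IsDiag) :
    tok.endpoint false ≠ tok.endpoint true := by
  rw [← tok.mk_endpoint, Sym2.mk_isDiag_iff] at h
  exact h

theorem Pos.mk_entry (p : Pos L) : s(p.entry.1, p.entry.2.1) = L[p.1].1 := by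
  rw [← Token.mk_endpoint]
  rcases p with ⟨i, _ | _⟩
  · rfl
  · exact Sym2.eq_swap

theorem SimpleStream.index_eq (hL : SimpleStream L) {i j : Fin L.length}
    (h : L[i].1 = L[j].1) : i = j := by
  have h1 := List.nodup_iff_injective_get.1 hL.1
  have h2 : (⟨i.1, by simp⟩ : Fin (L.map Prod.fst).length) = ⟨j.1, by simp⟩ :=
    h1 (by simpa using h)
  exact Fin.ext (Fin.mk.inj_iff.1 h2)

theorem SimpleStream.endpoint_ne (hL : SimpleStream L) (i : Fin L.length) :
    L[i].endpoint false ≠ L[i].endpoint true :=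
  Token.endpoint_ne (hL.2 _ (List.getElem_mem _))

theorem SimpleStream.entry_injective (hL : SimpleStream L) :
    Function.Injective (Pos.entry (L := L)) := by
  intro p p' h
  have h1 : p.1 = p'.1 := hL.index_eq (by rw [← Pos.mk_entry, ← Pos.mk_entry, h])
  obtain ⟨i, b⟩ := p
  obtain ⟨i', b'⟩ := p'
  obtain rfl : i = i' := h1
  have h2 : L[i].endpoint b = L[i].endpoint b' := congrArg Prod.fst h
  have h3 := hL.endpoint_ne i
  cases b <;> cases b' <;> first | rfl | exact absurd h2 h3 | exact absurd h2.symm h3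

theorem alive_succ_of_lt (c : Fin L.length → Bool) {i : Fin L.length} {p : Pos L} (h : p.1 < i) :
    Alive L c (i + 1) p ↔ Alive L c i p ∧ ¬(c i = true ∧ L[i].Hits p.entry) := by
  simp only [Alive, blockers, Finset.mem_filter, Finset.mem_univ, true_and]
  constructor
  · intro ha
    refine ⟨fun j hj => ha j ?_, fun hc => ?_⟩
    · rcases hj with hj | hj
      · exact Or.inl hj
      · exact Or.inr ⟨hj.1, by omega, hj.2.2⟩
    · have := ha i (Or.inr ⟨h, by omega, hc.2⟩)
      rw [hc.1] at this
      exact absurd this (by decide)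
  · rintro ⟨ha, hc⟩ j hj
    rcases hj with hj | ⟨hj1, hj2, hj3⟩
    · exact ha j (Or.inl hj)
    · by_cases hji : j = i
      · subst hji
        by_contra hcj
        exact hc ⟨by simpa using hcj, hj3⟩
      · exact ha j (Or.inr ⟨hj1, by
          have : j.1 ≠ i.1 := fun h => hji (Fin.ext h)
          omega, hj3⟩)

theorem alive_succ_self (c : Fin L.length → Bool) (p : Pos L) :
    Alive L c (p.1 + 1) p ↔ c p.1 = false := by
  simp only [Alive, blockers, Finset.mem_filter, Finset.mem_univ, true_and]
  constructor
  · exact fun ha => ha _ (Or.inl rfl)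
  · rintro h j (rfl | ⟨h1, h2, -⟩)
    · exact h
    · have : p.1.1 < j.1 := h1
      omega

/-- A pair of entries that a token closes is a pair of partners that the token hits. -/
theorem closes_iff_partner {tok : Token n} {x y : Entry n} :
    tok.Closes x y ↔ x.1 = tok.endpoint false ∧ tok.Hits x ∧ y = tok.partner x := by
  obtain ⟨a, b, c⟩ := x
  obtain ⟨a', b', c'⟩ := y
  simp only [Token.Closes, Token.Hits, Token.partner, Prod.mk.injEq]
  constructor
  · rintro ⟨rfl, rfl, rfl, rfl, h5⟩
    exact ⟨rfl, ⟨Or.inl rfl, h5⟩, by simp⟩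
  · rintro ⟨rfl, ⟨-, h5⟩, rfl, rfl, rfl⟩
    exact ⟨rfl, by simp, rfl, rfl, h5⟩

theorem Token.partner_fst_eq_iff {tok : Token n} (h : ¬tok.1.IsDiag) {x : Entry n}
    (hx : tok.Hits x) :
    (tok.partner x).1 = tok.endpoint false ↔ ¬x.1 = tok.endpoint false := by
  have hne := Token.endpoint_ne h
  rcases hx.1 with h | h <;> simp [Token.partner, h, hne.symm]

variable {M J : ℕ} {Seed : Type} (smp : Seed → Fin n → Bool)

/-- The entry at position `p` is stored. -/
def Stored (seed : Seed) (r : Fin L.length → Coins) (p : Pos L) : Prop :=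
  smp seed p.entry.2.1 = true ∧ (r p.1).2 p.2 = true

theorem finalMem_induction (L : List (Token n)) (r : Fin L.length → Coins)
    (Inv : ℕ → CopyMem n M Seed → Prop) (m : CopyMem n M Seed) (h0 : Inv 0 m)
    (hs : ∀ (i : Fin L.length) m, Inv i m → Inv (i + 1) (memStep smp L[i] (r i) m)) :
    Inv L.length (finalMem smp L r m) := by
  induction L generalizing Inv m with
  | nil => exact h0
  | cons tok L ih =>
    refine ih (fun i => r i.succ) (fun i => Inv (i + 1)) _ (hs ⟨0, by simp⟩ m h0) fun i m hm => ?_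
    exact hs i.succ m hm

theorem quantumBias_induction (L : List (Token n)) (r : Fin L.length → Coins)
    (Inv : ℕ → ZMod (M + 1) → (QLabel n M J → ℂ) → Prop) (β : Fin L.length → ℝ)
    (t : ZMod (M + 1)) (φ : QLabel n M J → ℂ) (h0 : Inv 0 t φ)
    (hβ : ∀ (i : Fin L.length) t φ, Inv i t φ →
      normSqVec ((L[i].pvm.proj 1).mulVec φ) - normSqVec ((L[i].pvm.proj (-1)).mulVec φ) = β i)
    (h1 : ∀ (i : Fin L.length) t φ, Inv i t φ → (r i).1 = true →
      Inv (i + 1) (t + 1) ((L[i].pvm.proj 0).mulVec φ))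
    (h2 : ∀ (i : Fin L.length) t φ, Inv i t φ → (r i).1 = false →
      Inv (i + 1) (t + 1) (φ ∘ L[i].filing (t + 1))) :
    quantumBias L r t φ = ∑ i, if (r i).1 = true then β i else 0 := by
  induction L generalizing Inv t φ with
  | nil => simp [quantumBias]
  | cons tok L ih =>
    have e := Fin.sum_univ_succ fun i : Fin (L.length + 1) =>
      if (r i).1 = true then β i else 0
    refine Eq.trans ?_ e.symm
    have ih' := fun t φ h => ih (fun i => r i.succ) (fun i => Inv (i + 1)) (fun i => β i.succ) t φ h
      (fun i => hβ i.succ) (fun i => h1 i.succ) (fun i => h2 i.succ)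
    cases hc : (r 0).1 with
    | true =>
      simp only [quantumBias, hc, if_true]
      exact congrArg₂ (· + ·) (hβ ⟨0, by simp⟩ t φ h0) (ih' _ _ (h1 ⟨0, by simp⟩ t φ h0 hc))
    | false =>
      simp only [quantumBias, hc, Bool.false_eq_true, if_false, zero_add]
      exact ih' _ _ (h2 ⟨0, by simp⟩ t φ h0 hc)

open scoped Classical in
/-- The stored entries at time `l`, flagged if they are not in the quantum register. -/
def itemsAt (seed : Seed) (r : Fin L.length → Coins) (l : ℕ) : Finset (Entry n × Bool) :=
  ((Finset.univ : Finset (Pos L)).filter fun p => p.1.1 < l ∧ Stored smp seed r p).image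
    fun p => (p.entry, !decide (Alive L (fun i => (r i).1) l p))

theorem itemsAt_succ (seed : Seed) (r : Fin L.length → Coins)
    (i : Fin L.length) :
    (itemsAt smp seed r i).image (fun y => (y.1, y.2 || ((r i).1 && decide (L[i].Hits y.1)))) ∪
      newItems smp L[i] seed (r i) = itemsAt smp seed r (i + 1) := by
  classical
  ext ⟨x, b⟩
  simp only [itemsAt, newItems, Finset.mem_union, Finset.mem_image, Finset.mem_filter,
    Finset.mem_univ, true_and, Prod.mk.injEq]
  constructor
  · rintro (⟨y, ⟨p, ⟨h1, h2⟩, rfl⟩, rfl, rfl⟩ | ⟨β, ⟨h1, h2⟩, rfl, rfl⟩)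
    · refine ⟨p, ⟨by omega, h2⟩, rfl, ?_⟩
      have := alive_succ_of_lt (fun i => (r i).1) (p := p) (i := i) h1
      simp only [this]
      by_cases ha : Alive L (fun i => (r i).1) i p <;> by_cases hh : L[i].Hits p.entry <;>
        cases (r i).1 <;> simp [ha]
    · refine ⟨(i, β), ⟨by simp, h1, h2⟩, rfl, ?_⟩
      have := alive_succ_self (fun i => (r i).1) ((i, β) : Pos L)
      simp only [this]
      cases (r i).1 <;> simp
  · rintro ⟨p, ⟨h1, h2⟩, rfl, rfl⟩
    by_cases hp : p.1 = i
    · right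
      obtain ⟨j, β⟩ := p
      obtain rfl : j = i := hp
      refine ⟨β, h2, rfl, ?_⟩
      have := alive_succ_self (fun i => (r i).1) ((j, β) : Pos L)
      simp only [this]
      cases (r j).1 <;> simp
    · left
      have hlt : p.1 < i := by
        have : p.1.1 ≠ i.1 := fun h => hp (Fin.ext h)
        exact Fin.lt_def.2 (by omega)
      refine ⟨_, ⟨p, ⟨hlt, h2⟩, rfl⟩, rfl, ?_⟩
      have := alive_succ_of_lt (fun i => (r i).1) (p := p) (i := i) hlt
      simp only [this]
      by_cases ha : Alive L (fun i => (r i).1) i p <;> by_cases hh : L[i].Hits p.entry <;>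
        cases (r i).1 <;> simp [ha]

open scoped Classical in
theorem closedPairs_itemsAt (hL : SimpleStream L) (seed : Seed) (r : Fin L.length → Coins)
    (i : Fin L.length) :
    closedPairs L[i] (itemsAt smp seed r i) =
      ((wedges L).filter fun w => w.1 = i ∧ Stored smp seed r w.2.1 ∧ Stored smp seed r w.2.2 ∧
        ¬(Alive L (fun i => (r i).1) w.1 w.2.1 ∧ Alive L (fun i => (r i).1) w.1 w.2.2)).card := by
  symm
  refine Finset.card_bij (fun w _ =>
    ((w.2.1.entry, !decide (Alive L (fun i => (r i).1) i w.2.1)),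
      (w.2.2.entry, !decide (Alive L (fun i => (r i).1) i w.2.2)))) ?_ ?_ ?_
  · rintro ⟨l, p1, p2⟩ hw
    simp only [wedges, Finset.mem_filter, Finset.mem_univ, true_and] at hw
    obtain ⟨⟨h1, h2, h3⟩, rfl, h4, h5, h6⟩ := hw
    simp only [Finset.mem_filter, Finset.mem_product, itemsAt, Finset.mem_image, Finset.mem_univ,
      true_and]
    refine ⟨⟨⟨p1, ⟨h1, h4⟩, rfl⟩, ⟨p2, ⟨h2, h5⟩, rfl⟩⟩, h3, ?_⟩
    simp only [Bool.not_eq_true', decide_eq_false_iff_not]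
    tauto
  · rintro ⟨l, p1, p2⟩ hw ⟨l', p1', p2'⟩ hw' h
    simp only [Finset.mem_filter] at hw hw'
    simp only [Prod.mk.injEq] at h
    simp only [Prod.mk.injEq]
    exact ⟨hw.2.1.trans hw'.2.1.symm, hL.entry_injective h.1.1, hL.entry_injective h.2.1⟩
  · rintro ⟨⟨x, b⟩, ⟨y, b'⟩⟩ hz
    simp only [Finset.mem_filter, Finset.mem_product, itemsAt, Finset.mem_image, Finset.mem_univ,
      true_and, Prod.mk.injEq] at hz
    obtain ⟨⟨⟨p1, ⟨h1, h4⟩, rfl, rfl⟩, ⟨p2, ⟨h2, h5⟩, rfl, rfl⟩⟩, h3, h6⟩ := hz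
    simp only [Bool.not_eq_true', decide_eq_false_iff_not] at h6
    refine ⟨(i, p1, p2), ?_, rfl⟩
    simp only [wedges, Finset.mem_filter, Finset.mem_univ, true_and]
    refine ⟨⟨h1, h2, h3⟩, h4, h5, ?_⟩
    tauto

open scoped Classical in
/-- The triangles that are found classically: both entries are stored, and at least one of them has
been removed from the quantum register when the last edge arrives. -/
def foundWedges (seed : Seed) (r : Fin L.length → Coins) : Finset (Fin L.length × Pos L × Pos L) :=
  (wedges L).filter fun w => Stored smp seed r w.2.1 ∧ Stored smp seed r w.2.2 ∧
    ¬(Alive L (fun i => (r i).1) w.1 w.2.1 ∧ Alive L (fun i => (r i).1) w.1 w.2.2)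

/-- The counter counts the found triangles, and the list of items holds the stored entries. -/
theorem finalMem_eq (hL : SimpleStream L) (r : Fin L.length → Coins) (m : CopyMem n M Seed)
    (hc : m.count = 0) (hi : m.items = ∅) :
    (finalMem smp L r m).count = ((foundWedges smp m.seed r).card : ℕ) ∧
      (finalMem smp L r m).items = itemsAt smp m.seed r L.length := by
  classical
  have key := finalMem_induction smp L r (fun l m' => m'.seed = m.seed ∧
    m'.items = itemsAt smp m.seed r l ∧
    m'.count = (((foundWedges smp m.seed r).filter fun w => w.1.1 < l).card : ℕ)) m
    ⟨rfl, by simp [hi, itemsAt], by simp [hc]⟩ (by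
      rintro i m' ⟨h1, h2, h3⟩
      refine ⟨h1, ?_, ?_⟩
      · simp only [memStep, h1, h2, itemsAt_succ smp]
      · simp only [memStep, h2, h3, closedPairs_itemsAt smp hL]
        rw [← Nat.cast_add, ← Finset.card_union_of_disjoint]
        · congr 2
          ext w
          simp only [foundWedges, Finset.mem_union, Finset.mem_filter]
          have : w.1.1 < i.1 + 1 ↔ w.1.1 < i.1 ∨ w.1 = i := by
            rw [Fin.ext_iff]; omega
          rw [this]
          tauto
        · rw [Finset.disjoint_left]
          intro w hw hw'
          simp only [Finset.mem_filter] at hw hw'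
          rw [hw'.2.1] at hw
          exact lt_irrefl _ hw.2)
  refine ⟨?_, key.2.1⟩
  rw [key.2.2, Finset.filter_true_of_mem]
  exact fun w _ => w.1.2

open scoped Classical in
/-- The number of triangles that are closed by the token at `i` while both their other entries are
in the quantum register. -/
def aliveWedges (c : Fin L.length → Bool) (i : Fin L.length) : ℕ :=
  ((wedges L).filter fun w => w.1 = i ∧ Alive L c w.1 w.2.1 ∧ Alive L c w.1 w.2.2).card

/-- The entry `x` is in the quantum register at time `l`. -/
def Present (c : Fin L.length → Bool) (l : ℕ) (x : Entry n) : Prop :=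
  ∃ p : Pos L, p.1.1 < l ∧ p.entry = x ∧ Alive L c l p

open scoped Classical in
/-- Every triangle appears twice, once for each of the two entries. -/
theorem card_present_pairs (hL : SimpleStream L) (c : Fin L.length → Bool) (i : Fin L.length) :
    ((Finset.univ : Finset (Entry n)).filter fun x => L[i].Hits x ∧ Present c i x ∧
      Present c i (L[i].partner x)).card = 2 * aliveWedges c i := by
  have hd : ¬L[i].1.IsDiag := hL.2 _ (List.getElem_mem _)
  have hne := hL.endpoint_ne i
  set P := (Finset.univ : Finset (Entry n)).filter fun x => L[i].Hits x ∧ Present c i x ∧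
      Present c i (L[i].partner x) with hP
  have hmem : ∀ x, x ∈ P ↔ L[i].Hits x ∧ Present c i x ∧ Present c i (L[i].partner x) := by
    simp [hP]
  have hfalse : (P.filter fun x => x.1 = L[i].endpoint false).card = aliveWedges c i := by
    symm
    refine Finset.card_bij (fun w _ => w.2.1.entry) ?_ ?_ ?_
    · rintro ⟨l, p1, p2⟩ hw
      simp only [wedges, Finset.mem_filter, Finset.mem_univ, true_and] at hw
      obtain ⟨⟨h1, h2, h3⟩, rfl, h4, h5⟩ := hw
      rw [closes_iff_partner] at h3
      rw [Finset.mem_filter, hmem]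
      exact ⟨⟨h3.2.1, ⟨p1, h1, rfl, h4⟩, ⟨p2, h2, h3.2.2, h5⟩⟩, h3.1⟩
    · rintro ⟨l, p1, p2⟩ hw ⟨l', p1', p2'⟩ hw' h
      simp only [wedges, Finset.mem_filter, Finset.mem_univ, true_and] at hw hw'
      obtain ⟨⟨-, -, h3⟩, rfl, -⟩ := hw
      obtain ⟨⟨-, -, h3'⟩, rfl, -⟩ := hw'
      rw [closes_iff_partner] at h3 h3'
      have e1 : p1 = p1' := hL.entry_injective h
      subst e1
      have e2 : p2 = p2' := hL.entry_injective (h3.2.2.trans h3'.2.2.symm)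
      rw [e2]
    · intro x hx
      rw [Finset.mem_filter, hmem] at hx
      obtain ⟨⟨h1, ⟨p1, h2, rfl, h3⟩, ⟨p2, h4, h5, h6⟩⟩, h7⟩ := hx
      refine ⟨(i, p1, p2), ?_, rfl⟩
      simp only [wedges, Finset.mem_filter, Finset.mem_univ, true_and]
      refine ⟨⟨h2, h4, ?_⟩, h3, h6⟩
      rw [closes_iff_partner]
      exact ⟨h7, h1, h5⟩
  have hinv : ∀ x ∈ P, L[i].partner x ∈ P := fun x hx => by
    rw [hmem] at hx ⊢
    rw [Token.hits_partner, Token.partner_partner]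
    exact ⟨hx.1, hx.2.2, hx.2.1⟩
  have hends : ∀ x ∈ P, ((L[i].partner x).1 = L[i].endpoint false ↔
      ¬x.1 = L[i].endpoint false) := fun x hx => by
    rw [hmem] at hx
    exact Token.partner_fst_eq_iff hd hx.1
  have htrue : (P.filter fun x => ¬x.1 = L[i].endpoint false).card = aliveWedges c i := by
    rw [← hfalse]
    refine Finset.card_bij' (fun x _ => L[i].partner x) (fun x _ => L[i].partner x) ?_ ?_ ?_ ?_
    · intro x hx
      rw [Finset.mem_filter] at hx ⊢
      exact ⟨hinv x hx.1, (hends x hx.1).2 hx.2⟩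
    · intro x hx
      rw [Finset.mem_filter] at hx ⊢
      exact ⟨hinv x hx.1, fun h => (hends x hx.1).1 h hx.2⟩
    · exact fun x _ => L[i].partner_partner x
    · exact fun x _ => L[i].partner_partner x
  rw [← Finset.card_filter_add_card_filter_not (s := P) (fun x => x.1 = L[i].endpoint false),
    hfalse, htrue, two_mul]

/-- The initial quantum state: all dummies with the same amplitude `α`. -/
def dummyState (α : ℝ) : QLabel n M J → ℂ
  | .inl (.inl _) => (α : ℂ)
  | _ => 0

/-- The bias of the quantum estimator counts the triangles whose last token has coin `true` and
whose other two entries are in the register when it arrives. -/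
theorem quantumBias_eq (hL : SimpleStream L) (hM : L.length ≤ M) (r : Fin L.length → Coins)
    (α : ℝ) :
    quantumBias L r 0 (dummyState α : QLabel n M J → ℂ) =
      ∑ i, if (r i).1 = true then 2 * α ^ 2 * aliveWedges (fun i => (r i).1) i else 0 := by
  classical
  set c : Fin L.length → Bool := fun i => (r i).1 with hcdef
  -- entries that are present and dummies that have not been used yet all have the amplitude `α`
  refine quantumBias_induction L r (fun l t φ => t = (l : ZMod (M + 1)) ∧ ∃ f : QLabel n M J → ℝ,
    (φ = fun x => (f x : ℂ)) ∧
    (∀ x, f (.inl (.inr x)) = if Present c l x then α else 0) ∧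
    ∀ k b, l < k → k ≤ M → f (.inl (.inl ((k : ZMod (M + 1)), b))) = α) _ 0 _ ?_ ?_ ?_ ?_
  · refine ⟨by simp, fun x => match x with | .inl (.inl _) => α | _ => 0, ?_, ?_, ?_⟩
    · ext ((y | x) | y) <;> simp [dummyState]
    · intro x
      simp [Present]
    · intro k b _ _
      rfl
  · rintro i t φ ⟨-, f, rfl, hf, -⟩
    have h : ((2 * aliveWedges c i : ℕ) : ℝ) = _ :=
      congrArg _ (card_present_pairs hL c i).symm
    have e : ∀ x : Entry n, (if L[i].HitsLabel (.inl (.inr x) : QLabel n M J) then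
        f (.inl (.inr x)) * f (L[i].partnerLabel (.inl (.inr x))) else 0) =
        α ^ 2 * if L[i].Hits x ∧ Present c i x ∧ Present c i (L[i].partner x) then 1 else 0 := by
      intro x
      have e1 : L[i].HitsLabel (.inl (.inr x) : QLabel n M J) ↔ L[i].Hits x := Iff.rfl
      have e2 : L[i].partnerLabel (.inl (.inr x) : QLabel n M J) =
        .inl (.inr (L[i].partner x)) := rfl
      simp only [e1, e2, hf]
      by_cases a1 : L[i].Hits x <;> by_cases a2 : Present c i x <;>
        by_cases a3 : Present c i (L[i].partner x) <;> simp [-Fin.getElem_fin, a1, a2, a3, sq]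
    have e0 : ∀ y, ¬L[i].HitsLabel (.inl (.inl y) : QLabel n M J) := fun y => id
    have e0' : ∀ y, ¬L[i].HitsLabel (.inr y : QLabel n M J) := fun y => id
    rw [Token.pvm, pairingPVM_bias, Fintype.sum_sum_type, Fintype.sum_sum_type]
    simp only [e0, e0', if_false, Finset.sum_const_zero, zero_add, add_zero]
    rw [Finset.sum_congr rfl fun x _ => e x, ← Finset.mul_sum, Finset.sum_boole, ← h]
    push_cast
    ring
  · rintro i t φ ⟨ht, f, rfl, hf, hd⟩ hc
    refine ⟨by simp [ht], fun x => if L[i].HitsLabel x then 0 else f x, ?_, ?_, ?_⟩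
    · ext x
      rw [Token.pvm, pairingPVM_zero_mulVec]
      split_ifs with hx <;> simp [-Fin.getElem_fin, hx]
    · intro x
      have e : L[i].HitsLabel (.inl (.inr x) : QLabel n M J) ↔ L[i].Hits x := Iff.rfl
      have hp : Present c (i + 1) x ↔ Present c i x ∧ ¬L[i].Hits x := by
        constructor
        · rintro ⟨p, h1, rfl, h2⟩
          rcases Nat.lt_succ_iff_lt_or_eq.1 h1 with h | h
          · have h3 := (alive_succ_of_lt c (p := p) (i := i) h).1 h2
            exact ⟨⟨p, h, rfl, h3.1⟩, fun hh => h3.2 ⟨hc, hh⟩⟩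
          · have h3 : p.1 = i := Fin.ext h
            rw [← h3, alive_succ_self, h3] at h2
            exact absurd (hc.symm.trans h2) (by decide)
        · rintro ⟨⟨p, h1, rfl, h2⟩, h3⟩
          exact ⟨p, by omega, rfl,
            (alive_succ_of_lt c (p := p) (i := i) h1).2 ⟨h2, fun h => h3 h.2⟩⟩
      simp only [e, hp, hf]
      by_cases h1 : L[i].Hits x <;> simp [-Fin.getElem_fin, h1]
    · intro k b hk hkM
      exact hd k b (by omega) hkM
  · rintro i t φ ⟨ht, f, rfl, hf, hd⟩ hc
    have ht1 : t + 1 = ((i.1 + 1 : ℕ) : ZMod (M + 1)) := by rw [ht]; push_cast; rfl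
    refine ⟨ht1, fun x => f (L[i].filing (t + 1) x), rfl, ?_, ?_⟩
    · intro x
      show f (L[i].filing (t + 1) (.inl (.inr x))) = if Present c (i + 1) x then α else 0
      have hnew : ∀ b, Present c (i + 1) (L[i].entry b) := fun b =>
        ⟨(i, b), by simp, rfl, (alive_succ_self c ((i, b) : Pos L)).2 hc⟩
      have hiM : i.1 + 1 ≤ M := le_trans i.2 hM
      by_cases hx1 : x = L[i].entry true
      · subst hx1
        rw [if_pos (hnew true), Token.filing, Equiv.Perm.mul_apply, Equiv.swap_apply_right,
          Equiv.swap_apply_of_ne_of_ne (by simp) (by simp), ht1]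
        exact hd _ _ (by omega) hiM
      · have hs : Equiv.swap (.inl (.inl (t + 1, true)) : QLabel n M J)
            (.inl (.inr (L[i].entry true))) (.inl (.inr x)) = .inl (.inr x) :=
          Equiv.swap_apply_of_ne_of_ne (by simp) (by simpa using hx1)
        by_cases hx0 : x = L[i].entry false
        · subst hx0
          rw [if_pos (hnew false), Token.filing, Equiv.Perm.mul_apply,
            hs, Equiv.swap_apply_right, ht1]
          exact hd _ _ (by omega) hiM
        · rw [Token.filing, Equiv.Perm.mul_apply, hs,
            Equiv.swap_apply_of_ne_of_ne (by simp) (by simpa using hx0), hf]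
          have hp : Present c (i + 1) x ↔ Present c i x := by
            constructor
            · rintro ⟨p, h1, rfl, h2⟩
              rcases Nat.lt_succ_iff_lt_or_eq.1 h1 with h | h
              · exact ⟨p, h, rfl, ((alive_succ_of_lt c (p := p) (i := i) h).1 h2).1⟩
              · obtain ⟨j, b⟩ := p
                obtain rfl : j = i := Fin.ext h
                cases b
                · exact absurd rfl hx0
                · exact absurd rfl hx1
            · rintro ⟨p, h1, rfl, h2⟩
              refine ⟨p, by omega, rfl,
                (alive_succ_of_lt c (p := p) (i := i) h1).2 ⟨h2, fun h => ?_⟩⟩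
              exact absurd (hc.symm.trans h.1) (by decide)
          simp only [hp]
    · intro k b hk hkM
      have hk' : ((k : ZMod (M + 1))) ≠ t + 1 := by
        rw [ht1]
        intro h
        rw [ZMod.natCast_eq_natCast_iff', Nat.mod_eq_of_lt (by omega),
          Nat.mod_eq_of_lt (by have := i.2; omega)] at h
        omega
      show f (L[i].filing (t + 1) _) = α
      have hs : Equiv.swap (.inl (.inl (t + 1, true)) : QLabel n M J)
          (.inl (.inr (L[i].entry true))) (.inl (.inl ((k : ZMod (M + 1)), b))) =
            .inl (.inl ((k : ZMod (M + 1)), b)) :=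
        Equiv.swap_apply_of_ne_of_ne (by simp [hk']) (by simp)
      rw [Token.filing, Equiv.Perm.mul_apply, hs,
        Equiv.swap_apply_of_ne_of_ne (by simp [hk']) (by simp)]
      exact hd k b (by omega) hkM

end Stream

/-! ### Triangles of a signed graph and wedges of its streams -/

section Triangles

variable {n : ℕ} {G : SignedGraph (Fin n)} {S : List (Token n)}

theorem SignedGraph.IsStream.simpleStream (hS : G.IsStream S) : SimpleStream S := by
  refine ⟨hS.1, fun tok h => ?_⟩
  exact G.graph.not_isDiag_of_mem_edgeSet ((hS.2 tok.1 tok.2).1 h).1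

theorem SignedGraph.IsStream.length_eq (hS : G.IsStream S) : S.length = G.numEdges := by
  classical
  have h : G.edges = (S.map Prod.fst).toFinset := by
    ext e
    simp only [SignedGraph.edges, Finset.mem_filter, Finset.mem_univ, true_and, List.mem_toFinset,
      List.mem_map, Prod.exists, exists_and_right, exists_eq_right]
    exact ⟨fun he => ⟨G.sign e, (hS.2 _ _).2 ⟨he, rfl⟩⟩, fun ⟨s, hs⟩ => ((hS.2 _ _).1 hs).1⟩
  rw [SignedGraph.numEdges, h, List.toFinset_card_of_nodup hS.1, List.length_map]

theorem SignedGraph.IsStream.token_mem (hS : G.IsStream S) (i : Fin S.length) :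
    S[i].1 ∈ G.graph.edgeSet ∧ G.sign S[i].1 = S[i].2 :=
  (hS.2 S[i].1 S[i].2).1 (List.getElem_mem _)

theorem SignedGraph.IsStream.adj_entry (hS : G.IsStream S) (p : Pos S) :
    G.graph.Adj p.entry.1 p.entry.2.1 := by
  rw [← SimpleGraph.mem_edgeSet, Pos.mk_entry]
  exact (hS.token_mem p.1).1

theorem SignedGraph.IsStream.sign_entry (hS : G.IsStream S) (p : Pos S) :
    G.sign s(p.entry.1, p.entry.2.1) = p.entry.2.2 := by
  rw [Pos.mk_entry]
  exact (hS.token_mem p.1).2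

theorem SignedGraph.IsStream.exists_entry (hS : G.IsStream S) {x w : Fin n}
    (h : G.graph.Adj x w) : ∃ p : Pos S, p.entry = (x, w, G.sign s(x, w)) := by
  have hm : (s(x, w), G.sign s(x, w)) ∈ S := (hS.2 _ _).2 ⟨h, rfl⟩
  obtain ⟨i, hi, he⟩ := List.mem_iff_getElem.1 hm
  have he1 : s((S[i].endpoint false), (S[i].endpoint true)) = s(x, w) := by
    rw [Token.mk_endpoint, he]
  have he2 : S[i].2 = G.sign s(x, w) := by rw [he]
  rw [Sym2.eq_iff] at he1
  rcases he1 with ⟨h1, h2⟩ | ⟨h1, h2⟩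
  · exact ⟨(⟨i, hi⟩, false), by
      show (S[i].endpoint false, S[i].endpoint true, S[i].2) = _
      rw [h1, h2, he2]⟩
  · exact ⟨(⟨i, hi⟩, true), by
      show (S[i].endpoint true, S[i].endpoint false, S[i].2) = _
      rw [h1, h2, he2]⟩

theorem SignedGraph.edgesIn_triple {a b c : Fin n} (hab : G.graph.Adj a b)
    (hac : G.graph.Adj a c) (hbc : G.graph.Adj b c) :
    G.edgesIn {a, b, c} = {s(a, b), s(a, c), s(b, c)} := by
  classical
  ext e
  simp only [SignedGraph.edgesIn, SignedGraph.edges, Finset.mem_filter, Finset.mem_univ, true_and,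
    Finset.mem_insert, Finset.mem_singleton]
  induction e with
  | _ x y =>
    simp only [SimpleGraph.mem_edgeSet, Sym2.mem_iff, forall_eq_or_imp, forall_eq, Sym2.eq_iff]
    constructor
    · rintro ⟨h, h1, h2⟩
      have := h.ne
      rcases h1 with rfl | rfl | rfl <;> rcases h2 with rfl | rfl | rfl <;> simp_all
    · rintro ((⟨rfl, rfl⟩ | ⟨rfl, rfl⟩) | (⟨rfl, rfl⟩ | ⟨rfl, rfl⟩) | (⟨rfl, rfl⟩ | ⟨rfl, rfl⟩)) <;>
        simp [hab, hac, hbc, hab.symm, hac.symm, hbc.symm]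

theorem SignedGraph.card_positive_triple {a b c : Fin n} (hab : G.graph.Adj a b)
    (hac : G.graph.Adj a c) (hbc : G.graph.Adj b c) :
    ((G.edgesIn {a, b, c}).filter fun e => G.sign e = 1).card = 1 ↔
      G.sign s(b, c) = G.sign s(a, b) * G.sign s(a, c) ∧
        ¬(G.sign s(a, b) = 1 ∧ G.sign s(a, c) = 1) := by
  have h1 : s(a, b) ≠ s(a, c) := by simp [hbc.ne, hab.ne.symm]
  have h2 : s(a, b) ≠ s(b, c) := by simp [hab.ne, hac.ne]
  have h3 : s(a, c) ≠ s(b, c) := by simp [hab.ne, hac.ne]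
  rw [SignedGraph.edgesIn_triple hab hac hbc]
  rcases Int.units_eq_one_or (G.sign s(a, b)) with e1 | e1 <;>
  rcases Int.units_eq_one_or (G.sign s(a, c)) with e2 | e2 <;>
  rcases Int.units_eq_one_or (G.sign s(b, c)) with e3 | e3 <;>
  simp [Finset.filter_insert, Finset.filter_singleton, e1, e2, e3, h1, h2, h3]

/-- The vertices of the triangle of a wedge. -/
def wedgeTriangle (w : Fin S.length × Pos S × Pos S) : Finset (Fin n) :=
  {S[w.1].endpoint false, S[w.1].endpoint true, w.2.1.entry.2.1}

theorem mem_wedges_iff (w : Fin S.length × Pos S × Pos S) :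
    w ∈ wedges S ↔ w.2.1.1 < w.1 ∧ w.2.2.1 < w.1 ∧ S[w.1].Closes w.2.1.entry w.2.2.entry := by
  simp [wedges]

theorem wedge_adj (hS : G.IsStream S) {w : Fin S.length × Pos S × Pos S} (hw : w ∈ wedges S) :
    G.graph.Adj (S[w.1].endpoint false) (S[w.1].endpoint true) ∧
      G.graph.Adj (S[w.1].endpoint false) w.2.1.entry.2.1 ∧
      G.graph.Adj (S[w.1].endpoint true) w.2.1.entry.2.1 := by
  obtain ⟨-, -, h1, h2, h3, -⟩ := (mem_wedges_iff w).1 hw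
  refine ⟨?_, ?_, ?_⟩
  · rw [← SimpleGraph.mem_edgeSet, Token.mk_endpoint]
    exact (hS.token_mem w.1).1
  · rw [← h1]
    exact hS.adj_entry _
  · rw [← h2, h3]
    exact hS.adj_entry _

theorem edgesIn_wedgeTriangle (hS : G.IsStream S) {w : Fin S.length × Pos S × Pos S}
    (hw : w ∈ wedges S) :
    G.edgesIn (wedgeTriangle w) = {S[w.1].1, S[w.2.1.1].1, S[w.2.2.1].1} := by
  obtain ⟨h1, h2, h3⟩ := wedge_adj hS hw
  rw [wedgeTriangle, SignedGraph.edgesIn_triple h1 h2 h3]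
  obtain ⟨-, -, e1, e2, e3, -⟩ := (mem_wedges_iff w).1 hw
  rw [Token.mk_endpoint, ← e1, Pos.mk_entry, ← e2, e3, Pos.mk_entry]

theorem wedgeTriangle_injOn (hS : G.IsStream S) :
    Set.InjOn (wedgeTriangle (S := S)) (wedges S) := by
  have hle : ∀ w ∈ wedges S, ∀ i : Fin S.length, S[i].1 ∈ G.edgesIn (wedgeTriangle w) →
      i ≤ w.1 := by
    intro w hw i hi
    obtain ⟨h1, h2, -⟩ := (mem_wedges_iff w).1 hw
    rw [edgesIn_wedgeTriangle hS hw] at hi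
    simp only [Finset.mem_insert, Finset.mem_singleton] at hi
    rcases hi with h | h | h
    · exact (hS.simpleStream.index_eq h).le
    · exact (hS.simpleStream.index_eq h).le.trans h1.le
    · exact (hS.simpleStream.index_eq h).le.trans h2.le
  have hself : ∀ w ∈ wedges S, S[w.1].1 ∈ G.edgesIn (wedgeTriangle w) := fun w hw => by
    rw [edgesIn_wedgeTriangle hS hw]
    simp
  rintro w hw w' hw' h
  have hl : w.1 = w'.1 :=
    le_antisymm (hle w' hw' _ (h ▸ hself w hw)) (hle w hw _ (h ▸ hself w' hw'))
  obtain ⟨-, a2, a3⟩ := wedge_adj hS hw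
  obtain ⟨-, -, e1, e2, e3, -⟩ := (mem_wedges_iff w).1 hw
  obtain ⟨-, -, e1', e2', e3', -⟩ := (mem_wedges_iff w').1 hw'
  have hend : ∀ b, S[w.1].endpoint b = S[w'.1].endpoint b := fun b =>
    congrArg (fun i : Fin S.length => S[i].endpoint b) hl
  have hc : w.2.1.entry.2.1 = w'.2.1.entry.2.1 := by
    have hm : w.2.1.entry.2.1 ∈ wedgeTriangle w' := by
      rw [← h, wedgeTriangle]
      simp
    rw [wedgeTriangle, ← hend, ← hend] at hm
    simp only [Finset.mem_insert, Finset.mem_singleton] at hm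
    rcases hm with hm | hm | hm
    · exact absurd hm.symm a2.ne
    · exact absurd hm.symm a3.ne
    · exact hm
  have hentry : ∀ p p' : Pos S, p.entry.1 = p'.entry.1 → p.entry.2.1 = p'.entry.2.1 → p = p' := by
    intro p p' h1 h2
    refine hS.simpleStream.entry_injective (Prod.ext h1 (Prod.ext h2 ?_))
    rw [← hS.sign_entry, ← hS.sign_entry, h1, h2]
  refine Prod.ext hl (Prod.ext (hentry _ _ ?_ hc) (hentry _ _ ?_ ?_))
  · rw [e1, e1', hend]
  · rw [e2, e2', hend]
  · rw [← e3, ← e3', hc]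

theorem wedgeTriangle_mem (hS : G.IsStream S) {w : Fin S.length × Pos S × Pos S}
    (hw : w ∈ wedges S) : wedgeTriangle w ∈ G.triangles := by
  obtain ⟨h1, h2, h3⟩ := wedge_adj hS hw
  simp only [SignedGraph.triangles, Finset.mem_filter, Finset.mem_univ, true_and, wedgeTriangle]
  rw [SimpleGraph.is3Clique_triple_iff]
  exact ⟨h1, h2, h3⟩

/-- Every triangle with exactly one positive edge is found once, when its last edge arrives. -/
theorem card_wedges (hS : G.IsStream S) : (wedges S).card = G.T 1 := by
  classical
  unfold SignedGraph.T
  refine Finset.card_bij (fun w _ => wedgeTriangle w) ?_ (fun w hw w' hw' h =>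
    wedgeTriangle_injOn hS hw hw' h) ?_
  · intro w hw
    rw [Finset.mem_filter]
    refine ⟨wedgeTriangle_mem hS hw, ?_⟩
    obtain ⟨h1, h2, h3⟩ := wedge_adj hS hw
    obtain ⟨-, -, e1, e2, e3, e4, e5⟩ := (mem_wedges_iff w).1 hw
    rw [wedgeTriangle, SignedGraph.card_positive_triple h1 h2 h3]
    have s1 := (hS.token_mem w.1).2
    have s2 := hS.sign_entry w.2.1
    have s3 := hS.sign_entry w.2.2
    rw [← Token.mk_endpoint] at s1
    rw [e1] at s2
    rw [e2, ← e3] at s3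
    rw [s1, s2, s3]
    exact ⟨e4, e5⟩
  · intro t ht
    simp only [Finset.mem_filter, SignedGraph.triangles, Finset.mem_univ, true_and] at ht
    obtain ⟨htc, hpos⟩ := ht
    set P := (Finset.univ : Finset (Fin S.length)).filter fun i => S[i].1 ∈ G.edgesIn t with hP
    have hmemP : ∀ i, i ∈ P ↔ S[i].1 ∈ G.edgesIn t := by simp [hP]
    have hadjP : ∀ p : Pos S, p.entry.1 ∈ t → p.entry.2.1 ∈ t → p.1 ∈ P := by
      intro p h1 h2
      rw [hmemP]
      simp only [SignedGraph.edgesIn, SignedGraph.edges, Finset.mem_filter, Finset.mem_univ,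
        true_and]
      refine ⟨(hS.token_mem p.1).1, ?_⟩
      rw [← Pos.mk_entry]
      simp [h1, h2]
    have hne : P.Nonempty := by
      obtain ⟨a, b, c, hab, -, -, rfl⟩ := SimpleGraph.is3Clique_iff.1 htc
      obtain ⟨p, hp⟩ := hS.exists_entry hab
      exact ⟨p.1, hadjP p (by simp [hp]) (by simp [hp])⟩
    set l := P.max' hne
    have hl : S[l].1 ∈ G.edgesIn t := (hmemP l).1 (P.max'_mem hne)
    set u := S[l].endpoint false with hu
    set v := S[l].endpoint true with hv
    have huv : s(u, v) = S[l].1 := Token.mk_endpoint _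
    have huvne : u ≠ v := hS.simpleStream.endpoint_ne l
    have hin : u ∈ t ∧ v ∈ t := by
      simp only [SignedGraph.edgesIn, Finset.mem_filter, ← huv, Sym2.mem_iff, forall_eq_or_imp,
        forall_eq] at hl
      exact hl.2
    obtain ⟨w, hw⟩ : ∃ w, (t.erase u).erase v = {w} := by
      rw [← Finset.card_eq_one, Finset.card_erase_of_mem, Finset.card_erase_of_mem hin.1,
        htc.card_eq]
      exact Finset.mem_erase.2 ⟨huvne.symm, hin.2⟩
    have ht : t = {u, v, w} := by
      rw [← hw, Finset.insert_erase (Finset.mem_erase.2 ⟨huvne.symm, hin.2⟩),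
        Finset.insert_erase hin.1]
    rw [ht, SimpleGraph.is3Clique_triple_iff] at htc
    obtain ⟨a1, a2, a3⟩ := htc
    rw [ht, SignedGraph.card_positive_triple a1 a2 a3] at hpos
    obtain ⟨p1, hp1⟩ := hS.exists_entry a2
    obtain ⟨p2, hp2⟩ := hS.exists_entry a3
    have hlt : ∀ p : Pos S, p.entry.1 ∈ t → p.entry.2.1 ∈ t → p.entry.2.1 ≠ u → p.entry.2.1 ≠ v →
        p.1 < l := by
      intro p h1 h2 h3 h4
      refine lt_of_le_of_ne (P.le_max' _ (hadjP p h1 h2)) fun h => ?_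
      have := p.mk_entry.trans ((congrArg (fun i : Fin S.length => S[i].1) h).trans huv.symm)
      rw [Sym2.eq_iff] at this
      rcases this with ⟨-, h5⟩ | ⟨-, h5⟩
      · exact h4 h5
      · exact h3 h5
    have hwu : w ≠ u := a2.ne.symm
    have hwv : w ≠ v := a3.ne.symm
    have hwt : w ∈ t := by rw [ht]; simp
    refine ⟨(l, p1, p2), ?_, ?_⟩
    · rw [mem_wedges_iff]
      refine ⟨hlt p1 (by rw [hp1]; exact hin.1) (by rw [hp1]; exact hwt) (by rw [hp1]; exact hwu)
        (by rw [hp1]; exact hwv), hlt p2 (by rw [hp2]; exact hin.2) (by rw [hp2]; exact hwt)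
        (by rw [hp2]; exact hwu) (by rw [hp2]; exact hwv), ?_⟩
      have hs : G.sign s(u, v) = S[l].2 := by rw [huv]; exact (hS.token_mem l).2
      simp only [Token.Closes, hp1, hp2, ← hs]
      exact ⟨hu, hv, trivial, hpos.1, hpos.2⟩
    · simp only [wedgeTriangle, hp1]
      exact ht.symm

open scoped Classical in
/-- All wedges with centre `w` and an end `x` of the last edge contain the edge `{x, w}`. -/
theorem card_wedges_edge_le (hS : G.IsStream S) (w x : Fin n) :
    ((wedges S).filter fun τ => τ.2.1.entry.2.1 = w ∧
      (x = S[τ.1].endpoint false ∨ x = S[τ.1].endpoint true)).card ≤ G.maxEdgeTriangles := by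
  set F := (wedges S).filter fun τ => τ.2.1.entry.2.1 = w ∧
      (x = S[τ.1].endpoint false ∨ x = S[τ.1].endpoint true) with hF
  have hedge : ∀ τ ∈ F, s(x, w) ∈ G.edgesIn (wedgeTriangle τ) := by
    intro τ hτ
    obtain ⟨h1, rfl, h2⟩ := Finset.mem_filter.1 hτ
    obtain ⟨a1, a2, a3⟩ := wedge_adj hS h1
    rw [wedgeTriangle, SignedGraph.edgesIn_triple a1 a2 a3]
    rcases h2 with rfl | rfl <;> simp
  rcases F.eq_empty_or_nonempty with h | ⟨τ₀, h₀⟩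
  · simp [h]
  have he : s(x, w) ∈ G.edges := by
    have := hedge τ₀ h₀
    simp only [SignedGraph.edgesIn, Finset.mem_filter] at this
    exact this.1
  rw [SignedGraph.maxEdgeTriangles]
  refine le_trans ?_ (Finset.le_sup he)
  refine Finset.card_le_card_of_injOn wedgeTriangle ?_ ?_
  · intro τ hτ
    simp only [Finset.mem_coe, Finset.mem_filter]
    exact ⟨wedgeTriangle_mem hS (Finset.mem_filter.1 hτ).1, hedge τ hτ⟩
  · exact (wedgeTriangle_injOn hS).mono fun τ hτ => (Finset.mem_filter.1 hτ).1

end Triangles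

/-! ### Moments of the estimator -/

/-- The coins of the tokens, split into the coins that decide about measurements and those that
decide about storing entries. -/
theorem iidExp_coinsWeight {ι : Type*} [Fintype ι] [DecidableEq ι] (κ q : ℝ)
    (F : (ι → Coins) → ℝ) :
    iidExp (coinsWeight κ q) F = iidExp (coinWeight κ) fun c =>
      iidExp (coinWeight q) fun b : ι × Bool → Bool => F fun i => (c i, fun β => b (i, β)) := by
  have h1 : ∀ c : ι → Bool, iidExp (coinWeight q) (fun b : ι × Bool → Bool =>
      F fun i => (c i, fun β => b (i, β))) =
      iidExp (fun d : Bool → Bool => ∏ k, coinWeight q (d k)) fun b => F fun i => (c i, b i) :=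
    fun c => iidExp_curry (coinWeight q) fun b => F fun i => (c i, b i)
  simp only [h1]
  unfold iidExp
  simp only [Finset.mul_sum]
  rw [← Fintype.sum_prod_type']
  refine Fintype.sum_equiv
    (Equiv.arrowProdEquivProdArrow ι (fun _ => Bool) fun _ => Bool → Bool) _ _ fun r => ?_
  have h2 : ∀ x : ι, coinsWeight κ q (r x) =
      coinWeight κ (r x).1 * ∏ k, coinWeight q ((r x).2 k) := fun x => by
    simp [coinsWeight, mul_comm (coinWeight q ((r x).2 true))]
  simp only [h2, Finset.prod_mul_distrib, mul_assoc]
  rfl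

section Moments

variable {n : ℕ} {G : SignedGraph (Fin n)} {S : List (Token n)}

/-- The number of edges of the stream at a vertex. -/
def streamDegree (S : List (Token n)) (x : Fin n) : ℕ :=
  (Finset.univ.filter fun j : Fin S.length =>
    x = S[j].endpoint false ∨ x = S[j].endpoint true).card

theorem sum_streamDegree_le (S : List (Token n)) : ∑ x, streamDegree S x ≤ 2 * S.length := by
  classical
  have h : ∀ j : Fin S.length, (Finset.univ.filter fun x : Fin n =>
      x = S[j].endpoint false ∨ x = S[j].endpoint true).card ≤ 2 := fun j => by
    refine le_trans (Finset.card_le_card fun x hx => ?_)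
      (Finset.card_le_two (a := S[j].endpoint false) (b := S[j].endpoint true))
    simpa using hx
  calc ∑ x, streamDegree S x = ∑ j : Fin S.length, (Finset.univ.filter fun x : Fin n =>
        x = S[j].endpoint false ∨ x = S[j].endpoint true).card := by
        simp only [streamDegree, Finset.card_filter]
        exact Finset.sum_comm
    _ ≤ ∑ _j : Fin S.length, 2 := Finset.sum_le_sum fun j _ => h j
    _ = 2 * S.length := by simp [mul_comm]

theorem card_blockers_le (l : ℕ) (p : Pos S) :
    (blockers S l p).card ≤ streamDegree S p.entry.1 := by
  refine Finset.card_le_card fun j hj => ?_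
  simp only [blockers, Finset.mem_filter, Finset.mem_univ, true_and] at hj ⊢
  rcases hj with rfl | ⟨-, -, h⟩
  · rcases p with ⟨i, _ | _⟩
    · exact Or.inl rfl
    · exact Or.inr rfl
  · exact h.1

/-- The coins whose showing `true` removes one of the two entries of a wedge from the quantum
register before the wedge is closed. -/
def wedgeBlockers (w : Fin S.length × Pos S × Pos S) : Finset (Fin S.length) :=
  blockers S w.1 w.2.1 ∪ blockers S w.1 w.2.2

theorem forall_wedgeBlockers (c : Fin S.length → Bool) (w : Fin S.length × Pos S × Pos S) :
    (∀ j ∈ wedgeBlockers w, c j = false) ↔ Alive S c w.1 w.2.1 ∧ Alive S c w.1 w.2.2 := by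
  simp only [wedgeBlockers, Finset.mem_union, or_imp, forall_and]
  rfl

theorem not_mem_wedgeBlockers {w : Fin S.length × Pos S × Pos S} (hw : w ∈ wedges S) :
    w.1 ∉ wedgeBlockers w := by
  obtain ⟨h1, h2, -⟩ := (mem_wedges_iff w).1 hw
  simp only [wedgeBlockers, blockers, Finset.mem_union, Finset.mem_filter, Finset.mem_univ,
    true_and, not_or, lt_irrefl, false_and, and_false, not_false_eq_true, and_true]
  exact ⟨h1.ne', h2.ne'⟩

open scoped Classical in
/-- The probability that both entries of a wedge are still in the quantum register when the wedge is
closed, if every coin shows `true` with probability `κ`. -/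
def aliveProb (κ : ℝ) (w : Fin S.length × Pos S × Pos S) : ℝ :=
  iidExp (coinWeight κ) fun c => if ∀ j ∈ wedgeBlockers w, c j = false then 1 else 0

/-- Entries filed under a vertex of small degree are rarely removed from the quantum register. -/
theorem one_sub_aliveProb_le {κ : ℝ} (hκ : 0 ≤ κ ∧ κ ≤ 1) (w : Fin S.length × Pos S × Pos S) :
    1 - aliveProb κ w ≤
      κ * (streamDegree S w.2.1.entry.1 + streamDegree S w.2.2.entry.1) := by
  classical
  have h : 1 - aliveProb κ w = iidExp (coinWeight κ) fun c =>
      if ∃ j ∈ wedgeBlockers w, c j = true then 1 else 0 := by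
    rw [sub_eq_iff_eq_add, aliveProb, ← iidExp_add]
    refine (iidExp_const (ι := Fin S.length) (sum_coinWeight κ) 1).symm.trans ?_
    refine congrArg _ (funext fun c => ?_)
    by_cases hc : ∃ j ∈ wedgeBlockers w, c j = true
    · rw [if_pos hc, if_neg, add_zero]
      obtain ⟨j, hj, hj'⟩ := hc
      exact fun h => by simp [h j hj] at hj'
    · rw [if_neg hc, if_pos, zero_add]
      exact fun j hj => by simpa using fun h => hc ⟨j, hj, h⟩
  have h0 := iidExp_coin_exists_le hκ.1 hκ.2 (wedgeBlockers w)
  refine (h.trans_le (le_trans (le_of_eq ?_) h0)).trans (mul_le_mul_of_nonneg_left ?_ hκ.1)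
  · refine congrArg _ (funext fun c => ?_)
    congr
  have h1 := Finset.card_union_le (blockers S w.1 w.2.1) (blockers S w.1 w.2.2)
  have h2 := card_blockers_le (w.1 : ℕ) w.2.1
  have h3 := card_blockers_le (w.1 : ℕ) w.2.2
  have h4 : (wedgeBlockers w).card ≤
      streamDegree S w.2.1.entry.1 + streamDegree S w.2.2.entry.1 := by
    unfold wedgeBlockers
    omega
  exact_mod_cast h4

/-- The bias of the quantum estimator. -/
theorem iidExp_quantumBias {M J : ℕ} {κ q : ℝ}
    (hS : G.IsStream S) (hM : S.length ≤ M) (α : ℝ) :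
    iidExp (coinsWeight κ q)
      (fun r => quantumBias S r 0 (dummyState (n := n) (M := M) (J := J) α)) =
      2 * α ^ 2 * κ * ∑ w ∈ wedges S, aliveProb κ w := by
  classical
  have h1 : ∀ r : Fin S.length → Coins,
      quantumBias S r 0 (dummyState (n := n) (M := M) (J := J) α) =
      ∑ w ∈ wedges S, 2 * α ^ 2 * ((if (r w.1).1 = true then 1 else 0) *
        if ∀ j ∈ wedgeBlockers w, (r j).1 = false then 1 else 0) := fun r => by
    rw [quantumBias_eq hS.simpleStream hM]
    have h2 : ∀ i, (aliveWedges (fun i => (r i).1) i : ℝ) = ∑ w ∈ wedges S,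
        if w.1 = i then (if ∀ j ∈ wedgeBlockers w, (r j).1 = false then 1 else 0) else 0 :=
      fun i => by
        simp only [aliveWedges, Finset.card_filter, forall_wedgeBlockers (fun i => (r i).1)]
        push_cast
        refine Finset.sum_congr rfl fun w _ => ?_
        rw [ite_and]
    simp only [h2, Finset.mul_sum]
    calc _ = ∑ i, ∑ w ∈ wedges S, if w.1 = i then 2 * α ^ 2 *
        ((if (r w.1).1 = true then 1 else 0) *
        if ∀ j ∈ wedgeBlockers w, (r j).1 = false then 1 else 0) else 0 := by
          refine Finset.sum_congr rfl fun i _ => ?_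
          by_cases hi : (r i).1 = true
          · rw [if_pos hi]
            refine Finset.sum_congr rfl fun w _ => ?_
            by_cases hw : w.1 = i
            · simp [hw, hi]
            · simp [hw]
          · rw [if_neg hi, Finset.sum_eq_zero fun w _ => ?_]
            by_cases hw : w.1 = i
            · simp [hw, hi]
            · simp [hw]
      _ = _ := by
        rw [Finset.sum_comm]
        simp
  simp only [h1, iidExp_sum, iidExp_mul_left]
  rw [Finset.mul_sum]
  refine Finset.sum_congr rfl fun w hw => ?_
  rw [iidExp_coinsWeight]
  have h4 : ∀ x : ℝ, iidExp (coinWeight q) (fun _ : Fin S.length × Bool → Bool => x) = x :=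
    iidExp_const (sum_coinWeight q)
  rw [show (fun c : Fin S.length → Bool => iidExp (coinWeight q)
      fun _ : Fin S.length × Bool → Bool => (if c w.1 = true then (1 : ℝ) else 0) *
        if ∀ j ∈ wedgeBlockers w, c j = false then 1 else 0) = fun c =>
      (if c w.1 = true then (1 : ℝ) else 0) *
        if ∀ j ∈ wedgeBlockers w, c j = false then 1 else 0 from funext fun c => h4 _]
  have h3 := iidExp_coin_mul_none κ (wedgeBlockers w) (not_mem_wedgeBlockers hw)
  rw [mul_assoc _ κ]
  refine congrArg _ (Eq.trans ?_ (h3.trans ?_))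
  · congr!
  · unfold aliveProb
    congr!

open scoped Classical in
/-- The coins allow both entries of a wedge to be stored. -/
def storeInd (b : Pos S → Bool) (w : Fin S.length × Pos S × Pos S) : ℝ :=
  if ∀ p ∈ ({w.2.1, w.2.2} : Finset (Pos S)), b p = true then 1 else 0

open scoped Classical in
/-- One of the entries of a wedge is missing from the quantum register when the wedge is closed. -/
def hitInd (c : Fin S.length → Bool) (w : Fin S.length × Pos S × Pos S) : ℝ :=
  1 - if ∀ j ∈ wedgeBlockers w, c j = false then 1 else 0

theorem hitInd_nonneg (c : Fin S.length → Bool) (w : Fin S.length × Pos S × Pos S) :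
    0 ≤ hitInd c w := by
  unfold hitInd
  split_ifs <;> norm_num

theorem hitInd_le_one (c : Fin S.length → Bool) (w : Fin S.length × Pos S × Pos S) :
    hitInd c w ≤ 1 := by
  unfold hitInd
  split_ifs <;> norm_num

theorem iidExp_hitInd (κ : ℝ) (w : Fin S.length × Pos S × Pos S) :
    iidExp (coinWeight κ) (fun c => hitInd c w) = 1 - aliveProb κ w := by
  rw [eq_sub_iff_add_eq, aliveProb, ← iidExp_add]
  refine Eq.trans (congrArg _ (funext fun c => ?_))
    (iidExp_const (ι := Fin S.length) (sum_coinWeight κ) 1)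
  simp [hitInd]

theorem storeInd_mul (b : Pos S → Bool) (w w' : Fin S.length × Pos S × Pos S) :
    storeInd b w * storeInd b w' =
      if ∀ p ∈ ({w.2.1, w.2.2} ∪ {w'.2.1, w'.2.2} : Finset (Pos S)), b p = true then 1 else 0 := by
  simp only [storeInd, ite_zero_mul_ite_zero, mul_one, Finset.mem_union, or_imp, forall_and]

theorem wedge_entry {w : Fin S.length × Pos S × Pos S} (hw : w ∈ wedges S) :
    w.2.1.entry.1 = S[w.1].endpoint false ∧ w.2.2.entry.1 = S[w.1].endpoint true ∧
      w.2.1.entry.2.1 = w.2.2.entry.2.1 := by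
  obtain ⟨-, -, h1, h2, h3, -⟩ := (mem_wedges_iff w).1 hw
  exact ⟨h1, h2, h3⟩

theorem wedge_pos_ne (hS : G.IsStream S) {w : Fin S.length × Pos S × Pos S} (hw : w ∈ wedges S) :
    w.2.1 ≠ w.2.2 := fun h => by
  obtain ⟨h1, h2, -⟩ := wedge_entry hw
  exact hS.simpleStream.endpoint_ne w.1 (by rw [← h1, ← h2, h])

variable {Seed : Type} (smp : Seed → Fin n → Bool)

/-- The centre of a wedge is sampled. -/
def sampleInd (s : Seed) (w : Fin S.length × Pos S × Pos S) : ℝ :=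
  if smp s w.2.1.entry.2.1 = true then 1 else 0

theorem card_foundWedges (s : Seed) (c : Fin S.length → Bool) (b : Pos S → Bool) :
    ((foundWedges smp s fun i => (c i, fun β => b (i, β))).card : ℝ) =
      ∑ w ∈ wedges S, sampleInd smp s w * (storeInd b w * hitInd c w) := by
  classical
  rw [foundWedges, Finset.card_filter]
  push_cast
  refine Finset.sum_congr rfl fun w hw => ?_
  have h3 := (wedge_entry hw).2.2
  have h4 : (∀ p ∈ ({w.2.1, w.2.2} : Finset (Pos S)), b p = true) ↔
      b w.2.1 = true ∧ b w.2.2 = true := by simp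
  have h5 := forall_wedgeBlockers c w
  simp only [Stored, sampleInd, storeInd, hitInd, ← h3, h4, h5]
  by_cases e1 : smp s w.2.1.entry.2.1 = true <;> by_cases e2 : b w.2.1 = true <;>
    by_cases e3 : b w.2.2 = true <;>
    by_cases e4 : Alive S c w.1 w.2.1 ∧ Alive S c w.1 w.2.2 <;> simp [e1, e2, e3, e4]

variable {a κ q : ℝ} [Fintype Seed]

/-- The expected number of triangles found classically. -/
theorem sum_iidExp_card_foundWedges (hS : G.IsStream S)
    (h1 : ∀ x, ∑ s, (if smp s x = true then (1 : ℝ) else 0) = a * Fintype.card Seed) :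
    ∑ s, iidExp (coinsWeight κ q) (fun r => ((foundWedges (L := S) smp s r).card : ℝ)) =
      Fintype.card Seed * (a * q ^ 2 * ∑ w ∈ wedges S, (1 - aliveProb κ w)) := by
  classical
  have hB : ∀ w ∈ wedges S, iidExp (coinWeight q) (fun b => storeInd b w) = q ^ 2 := fun w hw => by
    rw [← Finset.card_pair (wedge_pos_ne hS hw), ← iidExp_coin_all]
    refine congrArg _ (funext fun b => ?_)
    unfold storeInd
    congr
  have h : ∀ s, iidExp (coinsWeight κ q) (fun r => ((foundWedges (L := S) smp s r).card : ℝ)) =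
      ∑ w ∈ wedges S, sampleInd smp s w * (q ^ 2 * (1 - aliveProb κ w)) := fun s => by
    rw [iidExp_coinsWeight]
    simp only [card_foundWedges, iidExp_sum, iidExp_mul_left]
    refine Finset.sum_congr rfl fun w hw => ?_
    rw [← iidExp_hitInd, ← hB w hw]
    have e : ∀ c : Fin S.length → Bool,
        iidExp (coinWeight q) (fun b => storeInd b w * hitInd c w) =
        iidExp (coinWeight q) (fun b => storeInd b w) * hitInd c w := fun c => by
      rw [mul_comm, ← iidExp_mul_left]
      simp only [mul_comm]
    simp only [e, iidExp_mul_left]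
  simp only [h]
  rw [Finset.sum_comm, Finset.mul_sum, Finset.mul_sum]
  refine Finset.sum_congr rfl fun w _ => ?_
  rw [← Finset.sum_mul]
  simp only [sampleInd, h1]
  ring

/-- The wedge `w'` has centre `y`, and `x` is an end of its last edge. -/
def WedgeAt (x y : Fin n) (w' : Fin S.length × Pos S × Pos S) : Prop :=
  w'.2.1.entry.2.1 = y ∧ (x = S[w'.1].endpoint false ∨ x = S[w'.1].endpoint true)

open scoped Classical in
/-- The correlation of two wedges: they are uncorrelated unless they have the same centre. The
second summand comes from a wedge with itself, the third one from pairs of wedges that may share a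
stored entry; for the other pairs with the same centre, the bound uses the small probability that
an entry of the second wedge is missing from the quantum register. -/
theorem wedge_correlation_le (hS : G.IsStream S) (hκ : 0 ≤ κ ∧ κ ≤ 1) (hq : 0 ≤ q ∧ q ≤ 1)
    (ha : 0 ≤ a)
    (h1 : ∀ x, ∑ s, (if smp s x = true then (1 : ℝ) else 0) = a * Fintype.card Seed)
    (h2 : ∀ x y, x ≠ y → ∑ s, (if smp s x = true then (1 : ℝ) else 0) *
      (if smp s y = true then 1 else 0) = a ^ 2 * Fintype.card Seed)
    {w w' : Fin S.length × Pos S × Pos S} (hw : w ∈ wedges S) (hw' : w' ∈ wedges S) :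
    (∑ s, sampleInd smp s w * sampleInd smp s w') *
      (iidExp (coinWeight q) (fun b => storeInd b w * storeInd b w') *
        iidExp (coinWeight κ) (fun c => hitInd c w * hitInd c w')) ≤
    Fintype.card Seed * (a ^ 2 * q ^ 4 + (if w' = w then a * q ^ 2 else 0) +
      ((if WedgeAt w.2.1.entry.1 w.2.1.entry.2.1 w' then a * q ^ 3 else 0) +
        (if WedgeAt w.2.2.entry.1 w.2.1.entry.2.1 w' then a * q ^ 3 else 0)) +
      if w'.2.1.entry.2.1 = w.2.1.entry.2.1 then a * q ^ 4 *
        (κ * (streamDegree S w'.2.1.entry.1 + streamDegree S w'.2.2.entry.1)) else 0) := by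
  set U : Finset (Pos S) := {w.2.1, w.2.2} ∪ {w'.2.1, w'.2.2} with hU
  have hB : iidExp (coinWeight q) (fun b => storeInd b w * storeInd b w') = q ^ U.card := by
    rw [← iidExp_coin_all]
    exact congrArg _ (funext fun b => storeInd_mul b w w')
  have hBk : ∀ k, k ≤ U.card → q ^ U.card ≤ q ^ k := fun k hk =>
    pow_le_pow_of_le_one hq.1 hq.2 hk
  rw [hB]
  have hH0 : 0 ≤ iidExp (coinWeight κ) (fun c => hitInd c w * hitInd c w') :=
    iidExp_nonneg (coinWeight_nonneg hκ.1 hκ.2) fun c =>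
      mul_nonneg (hitInd_nonneg c w) (hitInd_nonneg c w')
  have hHd : iidExp (coinWeight κ) (fun c => hitInd c w * hitInd c w') ≤
      κ * (streamDegree S w'.2.1.entry.1 + streamDegree S w'.2.2.entry.1) := by
    refine le_trans ?_ (one_sub_aliveProb_le hκ w')
    rw [← iidExp_hitInd]
    exact iidExp_mono (coinWeight_nonneg hκ.1 hκ.2) fun c =>
      mul_le_of_le_one_left (hitInd_nonneg c w') (hitInd_le_one c w)
  have hH1 : iidExp (coinWeight κ) (fun c => hitInd c w * hitInd c w') ≤ 1 := by
    rw [← iidExp_const (ι := Fin S.length) (sum_coinWeight κ) 1]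
    exact iidExp_mono (coinWeight_nonneg hκ.1 hκ.2) fun c =>
      mul_le_one₀ (hitInd_le_one c w) (hitInd_nonneg c w') (hitInd_le_one c w')
  have hd0 : (0 : ℝ) ≤
      κ * (streamDegree S w'.2.1.entry.1 + streamDegree S w'.2.2.entry.1) :=
    mul_nonneg hκ.1 (by positivity)
  obtain ⟨e1, e2, e3⟩ := wedge_entry hw
  obtain ⟨e1', e2', e3'⟩ := wedge_entry hw'
  have hcard : Disjoint ({w.2.1, w.2.2} : Finset (Pos S)) {w'.2.1, w'.2.2} → U.card = 4 :=
    fun h => by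
      rw [hU, Finset.card_union_of_disjoint h, Finset.card_pair (wedge_pos_ne hS hw),
        Finset.card_pair (wedge_pos_ne hS hw')]
  have hN : (0 : ℝ) ≤ Fintype.card Seed := Nat.cast_nonneg _
  set H := iidExp (coinWeight κ) (fun c => hitInd c w * hitInd c w')
  have hq0 := hq.1
  by_cases hctr : w'.2.1.entry.2.1 = w.2.1.entry.2.1
  · have hSS : ∑ s, sampleInd smp s w * sampleInd smp s w' = a * Fintype.card Seed := by
      rw [← h1 w.2.1.entry.2.1]
      refine Finset.sum_congr rfl fun s _ => ?_
      simp only [sampleInd, hctr]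
      split_ifs <;> norm_num
    rw [hSS, mul_comm a, mul_assoc, if_pos hctr]
    refine mul_le_mul_of_nonneg_left ?_ hN
    have hP : ∀ x, 0 ≤ if WedgeAt x w.2.1.entry.2.1 w' then a * q ^ 3 else 0 := fun x => by
      split_ifs <;> positivity
    by_cases hww : w' = w
    · rw [if_pos hww]
      have hc : 2 ≤ U.card := by
        rw [← Finset.card_pair (wedge_pos_ne hS hw)]
        exact Finset.card_le_card Finset.subset_union_left
      have : a * (q ^ U.card * H) ≤ a * q ^ 2 := by
        refine mul_le_mul_of_nonneg_left ?_ ha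
        exact (mul_le_of_le_one_right (by positivity) hH1).trans (hBk 2 hc)
      have := hP w.2.1.entry.1
      have := hP w.2.2.entry.1
      have : 0 ≤ a ^ 2 * q ^ 4 := by positivity
      have : 0 ≤ a * q ^ 4 *
          (κ * (streamDegree S w'.2.1.entry.1 + streamDegree S w'.2.2.entry.1)) := by positivity
      linarith
    · by_cases hR : Disjoint ({w.2.1, w.2.2} : Finset (Pos S)) {w'.2.1, w'.2.2}
      · have : a * (q ^ U.card * H) ≤ a * q ^ 4 *
            (κ * (streamDegree S w'.2.1.entry.1 + streamDegree S w'.2.2.entry.1)) := by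
          rw [hcard hR, ← mul_assoc]
          exact mul_le_mul_of_nonneg_left hHd (by positivity)
        have := hP w.2.1.entry.1
        have := hP w.2.2.entry.1
        have : 0 ≤ a ^ 2 * q ^ 4 := by positivity
        rw [if_neg hww]
        linarith
      · have hc : 3 ≤ U.card := by
          by_contra hlt
          have hU1 : ({w.2.1, w.2.2} : Finset (Pos S)) = U :=
            Finset.eq_of_subset_of_card_le Finset.subset_union_left
              (by rw [Finset.card_pair (wedge_pos_ne hS hw)]; omega)
          have hU2 : ({w'.2.1, w'.2.2} : Finset (Pos S)) = U :=
            Finset.eq_of_subset_of_card_le Finset.subset_union_right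
              (by rw [Finset.card_pair (wedge_pos_ne hS hw')]; omega)
          have himg := congrArg (Finset.image fun p : Pos S => p.entry.1) (hU1.trans hU2.symm)
          simp only [Finset.image_insert, Finset.image_singleton, e1, e2, e1', e2'] at himg
          refine hww (wedgeTriangle_injOn hS hw' hw ?_)
          ext x
          have hx := Finset.ext_iff.1 himg x
          simp only [Finset.mem_insert, Finset.mem_singleton] at hx
          simp only [wedgeTriangle, Finset.mem_insert, Finset.mem_singleton, hctr, ← or_assoc, hx]
        have h3 : a * (q ^ U.card * H) ≤ a * q ^ 3 := by
          refine mul_le_mul_of_nonneg_left ?_ ha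
          exact (mul_le_of_le_one_right (by positivity) hH1).trans (hBk 3 hc)
        have hor : (w.2.1.entry.1 = S[w'.1].endpoint false ∨
            w.2.1.entry.1 = S[w'.1].endpoint true) ∨ (w.2.2.entry.1 = S[w'.1].endpoint false ∨
            w.2.2.entry.1 = S[w'.1].endpoint true) := by
          rw [Finset.disjoint_left] at hR
          push Not at hR
          obtain ⟨p, hp, hp'⟩ := hR
          rw [Finset.mem_insert, Finset.mem_singleton] at hp hp'
          rcases hp with rfl | rfl <;> rcases hp' with hp' | hp' <;> rw [hp'] <;> simp [e1', e2']
        have : 0 ≤ a ^ 2 * q ^ 4 := by positivity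
        have : 0 ≤ a * q ^ 4 *
          (κ * (streamDegree S w'.2.1.entry.1 + streamDegree S w'.2.2.entry.1)) := by positivity
        rw [if_neg hww]
        rcases hor with hor | hor
        · rw [if_pos (show WedgeAt w.2.1.entry.1 w.2.1.entry.2.1 w' from ⟨hctr, hor⟩)]
          have := hP w.2.2.entry.1
          linarith
        · rw [if_pos (show WedgeAt w.2.2.entry.1 w.2.1.entry.2.1 w' from ⟨hctr, hor⟩)]
          have := hP w.2.1.entry.1
          linarith
  · have hww : w' ≠ w := fun h => hctr (by rw [h])
    rw [if_neg hctr, if_neg hww, if_neg (fun h => hctr h.1), if_neg (fun h => hctr h.1)]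
    have hSS : ∑ s, sampleInd smp s w * sampleInd smp s w' = a ^ 2 * Fintype.card Seed := by
      rw [← h2 _ _ fun h => hctr h.symm]
      rfl
    have hR : Disjoint ({w.2.1, w.2.2} : Finset (Pos S)) {w'.2.1, w'.2.2} := by
      rw [Finset.disjoint_left]
      intro p hp hp'
      rw [Finset.mem_insert, Finset.mem_singleton] at hp hp'
      apply hctr
      rcases hp with rfl | rfl <;> rcases hp' with hp' | hp' <;> simp only [hp', e3, e3']
    rw [hSS, hcard hR, mul_comm (a ^ 2), mul_assoc]
    refine mul_le_mul_of_nonneg_left ?_ hN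
    rw [← mul_assoc]
    have := mul_le_of_le_one_right (show 0 ≤ a ^ 2 * q ^ 4 by positivity) hH1
    linarith

open scoped Classical in
theorem card_wedgeAt_le (hS : G.IsStream S) (x y : Fin n) :
    ((wedges S).filter (WedgeAt x y)).card ≤ G.maxEdgeTriangles := by
  refine le_trans (le_of_eq ?_) (card_wedges_edge_le hS y x)
  congr!

/-- The second moment of the number of triangles found classically. In the last summand, summing the
degrees of the ends of the last edge over the wedges with a given centre counts every edge of the
stream at most `2 D` times. -/
theorem sum_iidExp_card_foundWedges_sq_le (hS : G.IsStream S) (hκ : 0 ≤ κ ∧ κ ≤ 1)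
    (hq : 0 ≤ q ∧ q ≤ 1) (ha : 0 ≤ a)
    (h1 : ∀ x, ∑ s, (if smp s x = true then (1 : ℝ) else 0) = a * Fintype.card Seed)
    (h2 : ∀ x y, x ≠ y → ∑ s, (if smp s x = true then (1 : ℝ) else 0) *
      (if smp s y = true then 1 else 0) = a ^ 2 * Fintype.card Seed)
    {D : ℝ} (hD : (G.maxEdgeTriangles : ℝ) ≤ D) :
    ∑ s, iidExp (coinsWeight κ q) (fun r => ((foundWedges (L := S) smp s r).card : ℝ) ^ 2) ≤
      Fintype.card Seed * (a ^ 2 * q ^ 4 * (G.T 1 : ℝ) ^ 2 + a * q ^ 2 * G.T 1 +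
        2 * a * q ^ 3 * G.T 1 * D + 2 * a * q ^ 4 * κ * G.T 1 * D * S.length) := by
  classical
  have h : ∀ s, iidExp (coinsWeight κ q)
      (fun r => ((foundWedges (L := S) smp s r).card : ℝ) ^ 2) =
      ∑ w ∈ wedges S, ∑ w' ∈ wedges S, (sampleInd smp s w * sampleInd smp s w') *
        (iidExp (coinWeight q) (fun b => storeInd b w * storeInd b w') *
          iidExp (coinWeight κ) (fun c => hitInd c w * hitInd c w')) := fun s => by
    rw [iidExp_coinsWeight]
    simp only [card_foundWedges, sq, Finset.sum_mul_sum, iidExp_sum]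
    refine Finset.sum_congr rfl fun w hw => Finset.sum_congr rfl fun w' hw' => ?_
    have e : ∀ c : Fin S.length → Bool, iidExp (coinWeight q) (fun b =>
        sampleInd smp s w * (storeInd b w * hitInd c w) *
          (sampleInd smp s w' * (storeInd b w' * hitInd c w'))) =
        (sampleInd smp s w * sampleInd smp s w') *
        iidExp (coinWeight q) (fun b => storeInd b w * storeInd b w') *
        (hitInd c w * hitInd c w') := fun c => by
      rw [mul_right_comm, ← iidExp_mul_left]
      refine congrArg _ (funext fun b => ?_)
      ring
    simp only [e, iidExp_mul_left]
    ring
  simp only [h]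
  rw [Finset.sum_comm]
  have hT : ((wedges S).card : ℝ) = G.T 1 := by exact_mod_cast card_wedges hS
  have hN : (0 : ℝ) ≤ Fintype.card Seed := Nat.cast_nonneg _
  have hq0 := hq.1
  have hκ0 := hκ.1
  have hD0 : 0 ≤ D := (Nat.cast_nonneg _).trans hD
  have hcol : ∀ w ∈ wedges S, ∑ s, ∑ w' ∈ wedges S,
      (sampleInd smp s w * sampleInd smp s w') *
        (iidExp (coinWeight q) (fun b => storeInd b w * storeInd b w') *
          iidExp (coinWeight κ) (fun c => hitInd c w * hitInd c w')) ≤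
      Fintype.card Seed * (a ^ 2 * q ^ 4 * G.T 1 + a * q ^ 2 + (a * q ^ 3 * D + a * q ^ 3 * D) +
        a * q ^ 4 * (κ * (D * (2 * S.length)))) := fun w hw => by
    rw [Finset.sum_comm]
    simp only [← Finset.sum_mul]
    refine (Finset.sum_le_sum fun w' hw' =>
      wedge_correlation_le smp hS hκ hq ha h1 h2 hw hw').trans ?_
    rw [← Finset.mul_sum]
    refine mul_le_mul_of_nonneg_left ?_ hN
    simp only [Finset.sum_add_distrib]
    have hW : ∀ x y, ∑ w' ∈ wedges S, (if WedgeAt x y w' then a * q ^ 3 else 0) ≤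
        a * q ^ 3 * D := fun x y => by
      rw [← Finset.sum_filter, Finset.sum_const, nsmul_eq_mul, mul_comm]
      refine mul_le_mul_of_nonneg_left (le_trans ?_ hD) (by positivity)
      exact_mod_cast card_wedgeAt_le hS x y
    have hdeg : ∑ w' ∈ wedges S, (if w'.2.1.entry.2.1 = w.2.1.entry.2.1 then a * q ^ 4 *
        (κ * (streamDegree S w'.2.1.entry.1 + streamDegree S w'.2.2.entry.1 : ℝ)) else 0) ≤
        a * q ^ 4 * (κ * (D * (2 * S.length))) := by
      have e : ∀ w' ∈ wedges S, (if w'.2.1.entry.2.1 = w.2.1.entry.2.1 then a * q ^ 4 *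
          (κ * (streamDegree S w'.2.1.entry.1 + streamDegree S w'.2.2.entry.1 : ℝ)) else 0) =
          a * q ^ 4 * (κ * ∑ x, (streamDegree S x : ℝ) *
            if WedgeAt x w.2.1.entry.2.1 w' then 1 else 0) := fun w' hw' => by
        obtain ⟨e1, e2, e3⟩ := wedge_entry hw'
        have hne := hS.simpleStream.endpoint_ne w'.1
        by_cases hc : w'.2.1.entry.2.1 = w.2.1.entry.2.1
        · rw [if_pos hc, e1, e2]
          congr 2
          have : ∀ x, WedgeAt x w.2.1.entry.2.1 w' ↔
              x ∈ ({S[w'.1].endpoint false, S[w'.1].endpoint true} : Finset (Fin n)) := fun x => by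
            simp [WedgeAt, hc]
          simp only [this, mul_ite, mul_one, mul_zero, Finset.sum_ite_mem, Finset.univ_inter]
          rw [Finset.sum_pair hne]
        · rw [if_neg hc, Finset.sum_eq_zero, mul_zero, mul_zero]
          intro x _
          rw [if_neg fun h => hc h.1, mul_zero]
      rw [Finset.sum_congr rfl e, ← Finset.mul_sum, ← Finset.mul_sum, Finset.sum_comm]
      refine mul_le_mul_of_nonneg_left (mul_le_mul_of_nonneg_left ?_ hκ0) (by positivity)
      calc _ ≤ ∑ x, (streamDegree S x : ℝ) * D := by
            refine Finset.sum_le_sum fun x _ => ?_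
            rw [← Finset.mul_sum]
            refine mul_le_mul_of_nonneg_left (le_trans ?_ hD) (Nat.cast_nonneg _)
            rw [Finset.sum_boole]
            exact_mod_cast card_wedgeAt_le hS x _
        _ = D * ∑ x, (streamDegree S x : ℝ) := by rw [← Finset.sum_mul, mul_comm]
        _ ≤ D * (2 * S.length) := by
            refine mul_le_mul_of_nonneg_left ?_ hD0
            exact_mod_cast sum_streamDegree_le S
    have hone : ∑ w' ∈ wedges S, (if w' = w then a * q ^ 2 else 0) = a * q ^ 2 := by
      simp [hw]
    have hconst : ∑ w' ∈ wedges S, a ^ 2 * q ^ 4 = a ^ 2 * q ^ 4 * G.T 1 := by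
      rw [Finset.sum_const, nsmul_eq_mul, hT, mul_comm]
    rw [hone, hconst]
    have := hW w.2.1.entry.1 w.2.1.entry.2.1
    have := hW w.2.2.entry.1 w.2.1.entry.2.1
    linarith
  refine (Finset.sum_le_sum hcol).trans (le_of_eq ?_)
  rw [Finset.sum_const, nsmul_eq_mul, hT]
  ring

end Moments

/-! ### The stored entries, and bounds on the parameters of a graph -/

section Bounds

variable {n : ℕ} {G : SignedGraph (Fin n)} {S : List (Token n)}

theorem sum_iidExp_card_itemsAt_le {Seed : Type} [Fintype Seed] (smp : Seed → Fin n → Bool)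
    {a κ q : ℝ} (hκ : 0 ≤ κ ∧ κ ≤ 1) (hq : 0 ≤ q ∧ q ≤ 1)
    (h1 : ∀ x, ∑ s, (if smp s x = true then (1 : ℝ) else 0) = a * Fintype.card Seed) (l : ℕ) :
    ∑ s, iidExp (coinsWeight κ q) (fun r => ((itemsAt (L := S) smp s r l).card : ℝ)) ≤
      Fintype.card Seed * (2 * S.length * a * q) := by
  classical
  have h : ∀ s, iidExp (coinsWeight κ q) (fun r => ((itemsAt (L := S) smp s r l).card : ℝ)) ≤
      ∑ p : Pos S, (if smp s p.entry.2.1 = true then (1 : ℝ) else 0) * q := fun s => by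
    have e : ∀ p : Pos S, (if smp s p.entry.2.1 = true then (1 : ℝ) else 0) * q =
        iidExp (coinsWeight κ q) fun r => (if smp s p.entry.2.1 = true then (1 : ℝ) else 0) *
          if (r p.1).2 p.2 = true then 1 else 0 := fun p => by
      rw [iidExp_mul_left, iidExp_coinsWeight]
      have : iidExp (coinWeight q) (fun b : Fin S.length × Bool → Bool =>
          if b p = true then (1 : ℝ) else 0) = q := by
        rw [iidExp_single (sum_coinWeight q) (fun b => if b = true then (1 : ℝ) else 0) p]
        simp [coinWeight]
      simp only [this]
      rw [iidExp_const (sum_coinWeight κ)]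
    simp only [e]
    rw [← iidExp_sum]
    refine iidExp_mono (coinsWeight_nonneg hκ hq) fun r => ?_
    rw [itemsAt]
    refine (Nat.cast_le.2 Finset.card_image_le).trans ?_
    rw [Finset.card_filter]
    push_cast
    refine Finset.sum_le_sum fun p _ => ?_
    rw [ite_zero_mul_ite_zero, mul_one]
    split_ifs with h h'
    · exact le_rfl
    · exact absurd h.2 h'
    · exact zero_le_one
    · exact le_rfl
  refine (Finset.sum_le_sum fun s _ => h s).trans (le_of_eq ?_)
  rw [Finset.sum_comm]
  simp only [← Finset.sum_mul, h1]
  rw [Finset.sum_const, nsmul_eq_mul, Finset.card_univ, Fintype.card_prod, Fintype.card_fin,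
    Fintype.card_bool]
  push_cast
  ring

theorem SignedGraph.T_le_cube (G : SignedGraph (Fin n)) (j : ℕ) : G.T j ≤ n ^ 3 := by
  classical
  calc G.T j ≤ G.triangles.card := Finset.card_filter_le _ _
    _ ≤ (Finset.univ.powersetCard 3 : Finset (Finset (Fin n))).card := by
        refine Finset.card_le_card fun t ht => ?_
        simp only [SignedGraph.triangles, Finset.mem_filter, Finset.mem_univ, true_and] at ht
        exact Finset.mem_powersetCard.2 ⟨Finset.subset_univ _, ht.card_eq⟩
    _ = n.choose 3 := by simp
    _ ≤ n ^ 3 := Nat.choose_le_pow _ _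

theorem SignedGraph.three_le_of_T_pos (h : 0 < G.T 1) : 3 ≤ n := by
  classical
  obtain ⟨t, ht⟩ := Finset.card_pos.1 h
  have h1 := (Finset.mem_filter.1 ht).1
  simp only [SignedGraph.triangles, Finset.mem_filter, Finset.mem_univ, true_and] at h1
  have := Finset.card_le_univ t
  rw [h1.card_eq, Fintype.card_fin] at this
  exact this

theorem SignedGraph.numEdges_le_sq (G : SignedGraph (Fin n)) : G.numEdges ≤ n ^ 2 := by
  classical
  refine (Finset.card_le_univ _).trans ?_
  have := Fintype.card_le_of_surjective (fun p : Fin n × Fin n => s(p.1, p.2)) fun e => by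
    induction e with | _ a b => exact ⟨(a, b), rfl⟩
  simpa [sq] using this

/-- Every edge completes at most `Δ_E` triangles. -/
theorem SignedGraph.IsStream.T_le (hS : G.IsStream S) : G.T 1 ≤ S.length * G.maxEdgeTriangles := by
  classical
  rw [← card_wedges hS]
  have hfib : ∀ i ∈ (wedges S).image fun w => w.1,
      ((wedges S).filter fun w => w.1 = i).card ≤ G.maxEdgeTriangles := by
    intro i _
    have he : S[i].1 ∈ G.edges := by
      simp only [SignedGraph.edges, Finset.mem_filter, Finset.mem_univ, true_and]
      exact (hS.token_mem i).1
    rw [SignedGraph.maxEdgeTriangles]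
    refine le_trans ?_ (Finset.le_sup he)
    refine Finset.card_le_card_of_injOn wedgeTriangle (fun w hw => ?_) fun w hw w' hw' h => ?_
    · obtain ⟨hw1, rfl⟩ := Finset.mem_filter.1 hw
      simp only [Finset.mem_coe, Finset.mem_filter]
      refine ⟨wedgeTriangle_mem hS hw1, ?_⟩
      rw [edgesIn_wedgeTriangle hS hw1]
      exact Finset.mem_insert_self _ _
    · exact wedgeTriangle_injOn hS (Finset.mem_filter.1 hw).1 (Finset.mem_filter.1 hw').1 h
  refine (Finset.card_le_mul_card_image (wedges S) G.maxEdgeTriangles hfib).trans ?_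
  rw [mul_comm]
  refine Nat.mul_le_mul_right _ ?_
  have := Finset.card_le_univ ((wedges S).image fun w => w.1)
  rwa [Fintype.card_fin] at this

theorem SignedGraph.maxEdgeTriangles_le_numEdges (G : SignedGraph (Fin n)) :
    G.maxEdgeTriangles ≤ G.numEdges := by
  classical
  refine Finset.sup_le fun e he => ?_
  induction e with | _ u v => ?_
  have hmem : ∀ t, t ∈ G.triangles ∧ s(u, v) ∈ G.edgesIn t →
      ∃ w, G.graph.Adj u w ∧ t = {u, v, w} := by
    rintro t ⟨ht, hin⟩
    simp only [SignedGraph.triangles, SignedGraph.edgesIn, SignedGraph.edges, Finset.mem_filter,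
      Finset.mem_univ, true_and, SimpleGraph.mem_edgeSet, Sym2.mem_iff, forall_eq_or_imp,
      forall_eq] at ht hin
    obtain ⟨hadj, hu, hv⟩ := hin
    have hcard : ((t.erase u).erase v).card = 1 := by
      rw [Finset.card_erase_of_mem (Finset.mem_erase.2 ⟨hadj.ne.symm, hv⟩),
        Finset.card_erase_of_mem hu, ht.card_eq]
    obtain ⟨w, hw⟩ := Finset.card_eq_one.1 hcard
    have hwm : w ∈ (t.erase u).erase v := by rw [hw]; exact Finset.mem_singleton_self _
    simp only [Finset.mem_erase] at hwm
    refine ⟨w, ht.isClique hu hwm.2.2 hwm.2.1.symm, ?_⟩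
    rw [← hw, Finset.insert_erase (Finset.mem_erase.2 ⟨hadj.ne.symm, hv⟩), Finset.insert_erase hu]
  have : Nonempty (Fin n) := ⟨u⟩
  choose! f hf using hmem
  refine Finset.card_le_card_of_injOn (fun t => s(u, f t)) (fun t ht => ?_) fun t ht t' ht' h => ?_
  · simp only [Finset.coe_filter, Set.mem_ofPred_eq] at ht
    simp only [SignedGraph.edges, Finset.coe_filter, Finset.mem_univ, true_and, Set.mem_ofPred_eq,
      SimpleGraph.mem_edgeSet]
    exact (hf t ht).1
  · simp only [Finset.coe_filter, Set.mem_ofPred_eq] at ht ht'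
    rw [(hf t ht).2, (hf t' ht').2, Sym2.congr_right.1 h]

end Bounds

/-! ### Pairwise independent samples of vertices -/

section Hash

variable {n p : ℕ} [Fact p.Prime]

/-- The vertex `x` is sampled if the value of an affine function at `x`, over the field with `p`
elements, is less than `t`. -/
def affineSample (n p t : ℕ) (s : ZMod p × ZMod p) (x : Fin n) : Bool :=
  decide ((s.1 * (x.1 : ZMod p) + s.2).val < t)

theorem card_val_lt {t : ℕ} (ht : t ≤ p) :
    ∑ z : ZMod p, (if z.val < t then (1 : ℝ) else 0) = t := by
  rw [Finset.sum_boole]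
  norm_cast
  have : (Finset.univ.filter fun z : ZMod p => z.val < t) =
      (Finset.range t).image fun k : ℕ => (k : ZMod p) := by
    ext z
    simp only [Finset.mem_filter, Finset.mem_univ, true_and, Finset.mem_image, Finset.mem_range]
    constructor
    · exact fun h => ⟨z.val, h, ZMod.natCast_zmod_val z⟩
    · rintro ⟨k, hk, rfl⟩
      rwa [ZMod.val_cast_of_lt (hk.trans_le ht)]
  rw [this, Finset.card_image_of_injOn, Finset.card_range]
  intro k hk l hl h
  simp only [Finset.coe_range, Set.mem_Iio] at hk hl
  have := congrArg ZMod.val h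
  simp only at this
  rwa [ZMod.val_cast_of_lt (hk.trans_le ht), ZMod.val_cast_of_lt (hl.trans_le ht)] at this

theorem sum_affineSample {t : ℕ} (ht : t ≤ p) (x : Fin n) :
    ∑ s, (if affineSample n p t s x = true then (1 : ℝ) else 0) =
      (t / p : ℝ) * Fintype.card (ZMod p × ZMod p) := by
  have hp : (p : ℝ) ≠ 0 := by exact_mod_cast (Fact.out : p.Prime).ne_zero
  rw [Fintype.sum_prod_type]
  have : ∀ α : ZMod p, ∑ β, (if affineSample n p t (α, β) x = true then (1 : ℝ) else 0) = t :=
    fun α => by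
      rw [← card_val_lt ht]
      exact Fintype.sum_equiv (Equiv.addLeft (α * (x.1 : ZMod p))) _ _ fun β => by
        simp only [affineSample, decide_eq_true_eq, Equiv.coe_addLeft]
        congr
  simp only [this]
  simp [ZMod.card]
  field_simp

theorem sum_affineSample_mul {t : ℕ} (hn : n ≤ p) (ht : t ≤ p) {x y : Fin n} (hxy : x ≠ y) :
    ∑ s, (if affineSample n p t s x = true then (1 : ℝ) else 0) *
      (if affineSample n p t s y = true then 1 else 0) =
      (t / p : ℝ) ^ 2 * Fintype.card (ZMod p × ZMod p) := by
  have hp : (p : ℝ) ≠ 0 := by exact_mod_cast (Fact.out : p.Prime).ne_zero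
  have hne : (x.1 : ZMod p) - y.1 ≠ 0 := by
    rw [sub_ne_zero]
    intro h
    have := congrArg ZMod.val h
    rw [ZMod.val_cast_of_lt (x.2.trans_le hn), ZMod.val_cast_of_lt (y.2.trans_le hn)] at this
    exact hxy (Fin.ext this)
  set f : ZMod p × ZMod p → ZMod p × ZMod p := fun s =>
    (s.1 * (x.1 : ZMod p) + s.2, s.1 * (y.1 : ZMod p) + s.2) with hf
  have hinj : Function.Injective f := by
    rintro ⟨α, β⟩ ⟨α', β'⟩ h
    simp only [hf, Prod.mk.injEq] at h
    have h1 : (α - α') * ((x.1 : ZMod p) - y.1) = 0 := by linear_combination h.1 - h.2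
    have h2 : α = α' := sub_eq_zero.1 ((mul_eq_zero.1 h1).resolve_right hne)
    subst h2
    simpa using h.1
  have hbij := Finite.injective_iff_bijective.1 hinj
  calc _ = ∑ z : ZMod p × ZMod p, (if z.1.val < t then (1 : ℝ) else 0) *
        (if z.2.val < t then 1 else 0) :=
        Fintype.sum_bijective f hbij _ _ fun s => by simp only [affineSample, decide_eq_true_eq, hf]
    _ = (t : ℝ) * t := by
        rw [Fintype.sum_prod_type]
        have e : ∀ z : ZMod p, ∑ z' : ZMod p, (if z.val < t then (1 : ℝ) else 0) *
            (if z'.val < t then 1 else 0) = (if z.val < t then (1 : ℝ) else 0) * t := fun z => by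
          rw [← Finset.mul_sum, card_val_lt ht]
        refine (Finset.sum_congr rfl fun z _ => e z).trans ?_
        rw [← Finset.sum_mul, card_val_lt ht]
    _ = _ := by
        simp [ZMod.card]
        field_simp

end Hash

/-! ### The law of one copy -/

section CopyDist

variable {n M J : ℕ} {Seed : Type}

/-- The initial classical memory of a copy. -/
def initMem (s : Seed) : CopyMem n M Seed where
  seed := s
  coin := false
  status := 0
  time := 0
  count := 0
  items := ∅

/-- The initial state of a quantum register: the uniform superposition of the dummies. -/
def initState (n M J : ℕ) : QLabel n M J → ℂ := dummyState (1 / Real.sqrt (2 * (M + 1)))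

theorem initState_bias : 2 * (1 / Real.sqrt (2 * ((M : ℝ) + 1))) ^ 2 = 1 / (M + 1) := by
  rw [div_pow, Real.sq_sqrt (by positivity)]
  field_simp

theorem normSqVec_initState : normSqVec (initState n M J) = 1 := by
  have h := initState_bias (M := M)
  have hM : ((M : ℝ) + 1) ≠ 0 := by positivity
  simp only [normSqVec, initState, Fintype.sum_sum_type, dummyState, norm_zero,
    Finset.sum_const_zero, add_zero, zero_pow two_ne_zero, Complex.norm_real, Real.norm_eq_abs, sq_abs,
    Finset.sum_const, Finset.card_univ, Fintype.card_prod, ZMod.card, Fintype.card_bool, nsmul_eq_mul]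
  push_cast
  rw [mul_assoc, h]
  field_simp

variable [Fintype Seed] (smp : Seed → Fin n → Bool) {κ q : ℝ} (hκ : 0 ≤ κ ∧ κ ≤ 1)
  (hq : 0 ≤ q ∧ q ≤ 1) (S : List (Token n))

/-- The law of the final classical memory of a copy whose seed is uniformly distributed. -/
def copyDist (J : ℕ) (c : CopyMem n M Seed) : ℝ :=
  (∑ s, copyLaw (S.flatMap (tokenProg (J := J) smp hκ hq)) (initMem s) (initState n M J) c) /
    Fintype.card Seed

theorem copyDist_nonneg (c : CopyMem n M Seed) : 0 ≤ copyDist smp hκ hq S J c :=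
  div_nonneg (Finset.sum_nonneg fun _ _ => copyLaw_nonneg _ _ _ _) (Nat.cast_nonneg _)

theorem sum_copyDist_mul (g : CopyMem n M Seed → ℝ) :
    ∑ c, copyDist smp hκ hq S J c * g c =
      (∑ s, copyExp g (S.flatMap (tokenProg (J := J) smp hκ hq)) (initMem s) (initState n M J)) /
        Fintype.card Seed := by
  simp only [copyExp_eq_sum_copyLaw g, copyDist]
  rw [Finset.sum_comm, Finset.sum_div]
  refine Finset.sum_congr rfl fun c _ => ?_
  rw [← Finset.mul_sum]
  ring

theorem sum_copyDist_mul_classical (g : CopyMem n M Seed → ℝ)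
    (hg : ∀ m o, g { m with status := o } = g m) :
    ∑ c, copyDist smp hκ hq S J c * g c =
      (∑ s, iidExp (coinsWeight κ q) fun r => g (finalMem smp S r (initMem s))) /
        Fintype.card Seed := by
  rw [sum_copyDist_mul]
  simp only [copyExp_tokenProg_classical smp hκ hq g hg, normSqVec_initState, one_mul]

variable [Nonempty Seed]

theorem sum_copyDist : ∑ c : CopyMem n M Seed, copyDist smp hκ hq S J c = 1 := by
  have h := sum_copyDist_mul_classical (J := J) smp hκ hq S (fun _ : CopyMem n M Seed => 1)
    fun _ _ => rfl
  simp only [mul_one, iidExp_const (sum_coinsWeight κ q)] at h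
  rw [h]
  simp

variable {S} {G : SignedGraph (Fin n)}

omit [Nonempty Seed] [Fintype Seed] in
theorem card_foundWedges_le (hS : G.IsStream S) (s : Seed) (r : Fin S.length → Coins) :
    (foundWedges smp s r).card ≤ G.T 1 := by
  classical
  rw [← card_wedges hS]
  exact Finset.card_filter_le _ _

omit [Nonempty Seed] [Fintype Seed] in
/-- The counter does not overflow, as there are at most `n ^ 3` triangles. -/
theorem val_count_finalMem (hS : G.IsStream S) (s : Seed) (r : Fin S.length → Coins) :
    (finalMem smp S r (initMem (M := M) s)).count.val = (foundWedges smp s r).card := by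
  rw [(finalMem_eq smp hS.simpleStream r (initMem s) rfl rfl).1, ZMod.val_natCast_of_lt]
  · rfl
  · have := card_foundWedges_le smp hS s r
    have := G.T_le_cube 1
    simp only [initMem]
    omega

omit [Nonempty Seed] in
theorem copyDist_count (hS : G.IsStream S) (f : ℕ → ℝ) :
    ∑ c : CopyMem n M Seed, copyDist smp hκ hq S J c * f c.count.val =
      (∑ s, iidExp (coinsWeight κ q) fun r => f (foundWedges (L := S) smp s r).card) /
        Fintype.card Seed := by
  rw [sum_copyDist_mul_classical smp hκ hq S (fun c => f c.count.val) fun _ _ => rfl]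
  simp only [val_count_finalMem smp hS]

/-- The expected number of stored entries. -/
theorem copyDist_items_le (hS : G.IsStream S) {a : ℝ}
    (h1 : ∀ x, ∑ s, (if smp s x = true then (1 : ℝ) else 0) = a * Fintype.card Seed) :
    ∑ c : CopyMem n M Seed, copyDist smp hκ hq S J c * (c.items.card : ℝ) ≤
      2 * S.length * a * q := by
  rw [sum_copyDist_mul_classical smp hκ hq S (fun c => (c.items.card : ℝ)) fun _ _ => rfl]
  simp only [(finalMem_eq smp hS.simpleStream _ (initMem _) rfl rfl).2]
  have hN : (0 : ℝ) < Fintype.card Seed := by exact_mod_cast Fintype.card_pos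
  rw [div_le_iff₀ hN, mul_comm]
  exact sum_iidExp_card_itemsAt_le smp hκ hq h1 _

/-- The estimate of one copy: the numbers of triangles found classically and by the quantum
estimator, each divided by its sampling rate. -/
def estimate (A B : ℝ) (c : CopyMem n M Seed) : ℝ := A * c.count.val + B * (c.status : ℝ)

omit [Fintype Seed] [Nonempty Seed] in
/-- If every token measures, no entry is ever filed in the quantum register. -/
theorem aliveProb_one (w : Fin S.length × Pos S × Pos S) : aliveProb 1 w = 0 := by
  refine Finset.sum_eq_zero fun c _ => ?_
  dsimp only
  split_ifs with h
  · have hc : c w.2.1.1 = false := h _ (by simp [wedgeBlockers, blockers])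
    rw [Finset.prod_eq_zero (Finset.mem_univ w.2.1.1) (by simp [hc, coinWeight]), zero_mul]
  · rw [mul_zero]

/-- One copy is unbiased. -/
theorem copyDist_estimate (hS : G.IsStream S) (hM : S.length ≤ M) {a A B : ℝ}
    (h1 : ∀ x, ∑ s, (if smp s x = true then (1 : ℝ) else 0) = a * Fintype.card Seed)
    (hA : A * (a * q ^ 2) = 1) (hB : B * κ = M + 1 ∨ κ = 1 ∧ B = 0) :
    ∑ c : CopyMem n M Seed, copyDist smp hκ hq S J c * estimate A B c = G.T 1 := by
  have hN : (Fintype.card Seed : ℝ) ≠ 0 := by exact_mod_cast Fintype.card_ne_zero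
  have hst : ∑ c : CopyMem n M Seed, copyDist smp hκ hq S J c * (c.status : ℝ) =
      1 / (M + 1) * κ * ∑ w ∈ wedges S, aliveProb κ w := by
    rw [sum_copyDist_mul]
    simp only [copyExp_tokenProg_status]
    have : ∀ s : Seed, (initMem (n := n) (M := M) s).status = 0 := fun _ => rfl
    have ht : ∀ s : Seed, (initMem (n := n) (M := M) s).time = 0 := fun _ => rfl
    simp only [this, ht, if_true, initState, iidExp_quantumBias hS hM, initState_bias]
    rw [Finset.sum_const, Finset.card_univ, nsmul_eq_mul, mul_div_cancel_left₀ _ hN]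
  have hct : ∑ c : CopyMem n M Seed, copyDist smp hκ hq S J c * (c.count.val : ℝ) =
      a * q ^ 2 * ∑ w ∈ wedges S, (1 - aliveProb κ w) := by
    rw [copyDist_count smp hκ hq hS (fun k => (k : ℝ)), sum_iidExp_card_foundWedges smp hS h1,
      mul_div_cancel_left₀ _ hN]
  have hsplit : ∀ c : CopyMem n M Seed, copyDist smp hκ hq S J c * estimate A B c =
      A * (copyDist smp hκ hq S J c * (c.count.val : ℝ)) +
      B * (copyDist smp hκ hq S J c * (c.status : ℝ)) := fun c => by
    unfold estimate
    ring
  simp only [hsplit, Finset.sum_add_distrib, ← Finset.mul_sum]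
  rw [hst, hct, ← mul_assoc, hA, one_mul, Finset.sum_sub_distrib, Finset.sum_const, nsmul_eq_mul,
    card_wedges hS, mul_one]
  rcases hB with hB | ⟨rfl, rfl⟩
  · have hM0 : ((M : ℝ) + 1) ≠ 0 := by positivity
    have : B * (1 / ((M : ℝ) + 1) * κ * ∑ w ∈ wedges S, aliveProb κ w) =
        ∑ w ∈ wedges S, aliveProb κ w := by
      calc _ = (B * κ) / ((M : ℝ) + 1) * ∑ w ∈ wedges S, aliveProb κ w := by ring
        _ = _ := by rw [hB, div_self hM0, one_mul]
    rw [this]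
    ring
  · simp [aliveProb_one]

theorem copyDist_estimate_sq_le (hS : G.IsStream S) {A B V : ℝ}
    (hV : ∑ s, iidExp (coinsWeight κ q)
      (fun r => ((foundWedges (L := S) smp s r).card : ℝ) ^ 2) ≤ Fintype.card Seed * V) :
    ∑ c : CopyMem n M Seed, copyDist smp hκ hq S J c * estimate A B c ^ 2 ≤
      2 * A ^ 2 * V + 2 * B ^ 2 := by
  have hN : (0 : ℝ) < Fintype.card Seed := by exact_mod_cast Fintype.card_pos
  have hct := copyDist_count (M := M) (J := J) smp hκ hq hS (fun k => (k : ℝ) ^ 2)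
  have hle : ∀ c : CopyMem n M Seed, copyDist smp hκ hq S J c * estimate A B c ^ 2 ≤
      2 * A ^ 2 * (copyDist smp hκ hq S J c * (c.count.val : ℝ) ^ 2) +
        2 * B ^ 2 * copyDist smp hκ hq S J c := fun c => by
    have h0 := copyDist_nonneg (J := J) smp hκ hq S c
    have hs : (c.status : ℝ) ^ 2 ≤ 1 := by
      cases c.status <;> simp
    have : estimate A B c ^ 2 ≤ 2 * A ^ 2 * (c.count.val : ℝ) ^ 2 + 2 * B ^ 2 := by
      unfold estimate
      nlinarith [sq_nonneg (A * c.count.val - B * (c.status : ℝ)),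
        mul_le_mul_of_nonneg_left hs (sq_nonneg B)]
    nlinarith [mul_le_mul_of_nonneg_left this h0]
  refine (Finset.sum_le_sum fun c _ => hle c).trans ?_
  rw [Finset.sum_add_distrib, ← Finset.mul_sum, ← Finset.mul_sum, hct, sum_copyDist, mul_one]
  have : (∑ s, iidExp (coinsWeight κ q)
      (fun r => ((foundWedges (L := S) smp s r).card : ℝ) ^ 2)) / Fintype.card Seed ≤ V := by
    rwa [div_le_iff₀ hN, mul_comm]
  nlinarith [sq_nonneg A]

end CopyDist

/-! ### Encoding the memories of all copies by a bit string -/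

section Encoding

theorem flatMap_injective_of_length {A B : Type*} {f : A → List B} (hf : Function.Injective f)
    {w : ℕ} (hw : 0 < w) (hlen : ∀ x, (f x).length = w) :
    Function.Injective fun l : List A => l.flatMap f := by
  intro l
  induction l with
  | nil =>
    rintro (_ | ⟨b, l'⟩) h
    · rfl
    · have := congrArg List.length h
      simp [hlen] at this
      omega
  | cons a l ih =>
    rintro (_ | ⟨b, l'⟩) h
    · have := congrArg List.length h
      simp [hlen] at this
      omega
    · simp only [List.flatMap_cons] at h
      obtain ⟨h1, h2⟩ := List.append_inj h (by rw [hlen, hlen])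
      rw [hf h1, ih h2]

theorem map_inr_append_inj {A B : Type*} {l l' : List B} {R R' : List (A ⊕ B)}
    (hR : ∀ x ∈ R.head?, x.isLeft = true) (hR' : ∀ x ∈ R'.head?, x.isLeft = true)
    (h : l.map Sum.inr ++ R = l'.map Sum.inr ++ R') : l = l' ∧ R = R' := by
  induction l generalizing l' with
  | nil =>
    cases l' with
    | nil => exact ⟨rfl, h⟩
    | cons b l' =>
      simp only [List.map_nil, List.nil_append, List.map_cons, List.cons_append] at h
      rw [h] at hR
      simp at hR
  | cons a l ih =>
    cases l' with
    | nil =>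
      simp only [List.map_nil, List.nil_append, List.map_cons, List.cons_append] at h
      rw [← h] at hR'
      simp at hR'
    | cons b l' =>
      simp only [List.map_cons, List.cons_append, List.cons.injEq, Sum.inr.injEq] at h
      obtain ⟨h1, h2⟩ := ih h.2
      exact ⟨by rw [h.1, h1], h2⟩

/-- Records, each a header followed by a list of items, can be recovered from their concatenation
and their number. -/
theorem flatMap_records_inj {ι A B : Type*} (hd hd' : ι → A) (it it' : ι → List B) (l : List ι)
    (h : l.flatMap (fun j => (Sum.inl (hd j) : A ⊕ B) :: (it j).map Sum.inr) =
      l.flatMap fun j => (Sum.inl (hd' j) : A ⊕ B) :: (it' j).map Sum.inr) :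
    ∀ j ∈ l, hd j = hd' j ∧ it j = it' j := by
  have hleft : ∀ (hd : ι → A) (it : ι → List B) (l : List ι),
      ∀ x ∈ (l.flatMap fun j => (Sum.inl (hd j) : A ⊕ B) :: (it j).map Sum.inr).head?,
        x.isLeft = true := by
    rintro hd it (_ | ⟨j, l⟩) <;> simp
  induction l with
  | nil => simp
  | cons i l ih =>
    simp only [List.flatMap_cons, List.cons_append, List.cons.injEq, Sum.inl.injEq] at h
    obtain ⟨h1, h2⟩ := map_inr_append_inj (hleft _ _ _) (hleft _ _ _) h.2
    intro j hj
    rcases List.mem_cons.1 hj with rfl | hj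
    · exact ⟨h.1, h1⟩
    · exact ih h2 j hj

variable {n M : ℕ} {Seed : Type}

/-- The part of the classical memory of a copy that has a fixed size. -/
abbrev CopyHeader (n M : ℕ) (Seed : Type) : Type :=
  Seed × Bool × SignType × ZMod (M + 1) × ZMod (n ^ 3 + 1)

/-- The number of entries stored by a copy. -/
def CopyMem.size (m : CopyMem n M Seed) : ℕ := (m.items.image Prod.fst).card

open scoped Classical in
/-- The stored entries, each with the set of flags it is stored with. A set of entries with flags is
listed in this way, because its size may go down when flags are raised, but the number of entries
cannot. -/
def CopyMem.itemList (m : CopyMem n M Seed) : List (Entry n × Bool × Bool) :=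
  (m.items.image Prod.fst).toList.map fun x =>
    (x, decide ((x, false) ∈ m.items), decide ((x, true) ∈ m.items))

theorem CopyMem.length_itemList (m : CopyMem n M Seed) : m.itemList.length = m.size := by
  simp [itemList, size]

theorem CopyMem.size_le (m : CopyMem n M Seed) : m.size ≤ m.items.card := Finset.card_image_le

theorem CopyMem.ext_of_list {m m' : CopyMem n M Seed} (h1 : m.toProd.1 = m'.toProd.1)
    (h2 : m.itemList = m'.itemList) : m = m' := by
  classical
  refine CopyMem.toProd_injective (Prod.ext h1 ?_)
  have key : ∀ (m : CopyMem n M Seed) (x : Entry n) (b : Bool), (x, b) ∈ m.items ↔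
      ∃ y ∈ m.itemList, y.1 = x ∧ (if b then y.2.2 else y.2.1) = true := by
    intro m x b
    constructor
    · intro h
      refine ⟨_, List.mem_map.2 ⟨x, Finset.mem_toList.2 (Finset.mem_image.2 ⟨(x, b), h, rfl⟩), rfl⟩,
        rfl, ?_⟩
      cases b <;> simpa using h
    · rintro ⟨y, hy, rfl, hb⟩
      obtain ⟨z, -, rfl⟩ := List.mem_map.1 hy
      cases b <;> simpa using hb
  refine Finset.ext fun ⟨x, b⟩ => ?_
  have h3 := key m x b
  rw [h2] at h3
  exact h3.trans (key m' x b).symm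

/-- The symbols that the memories of the copies are written in. -/
abbrev MemSymbol (n M : ℕ) (Seed : Type) : Type := CopyHeader n M Seed ⊕ (Entry n × Bool × Bool)

variable {ι : Type} [Fintype ι] {w : ℕ} (e : MemSymbol n M Seed ↪ (Fin w → Bool))

/-- The bit string for the classical memories of all copies: `e` is a code of the symbols by words
of `w` bits. -/
def encodeMems (c : ι → CopyMem n M Seed) : List Bool :=
  ((Finset.univ : Finset ι).toList.flatMap fun j =>
    (Sum.inl (c j).toProd.1 : MemSymbol n M Seed) :: (c j).itemList.map Sum.inr).flatMap
      fun x => List.ofFn (e x)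

theorem encodeMems_injective (hw : 0 < w) :
    Function.Injective (encodeMems e : (ι → CopyMem n M Seed) → List Bool) := by
  intro c c' h
  have h1 := flatMap_injective_of_length
    (f := fun x : MemSymbol n M Seed => List.ofFn (e x))
    (fun x y hxy => e.injective (List.ofFn_injective hxy)) hw (fun x => List.length_ofFn) h
  funext j
  have h2 := flatMap_records_inj _ _ _ _ _ h1 j (Finset.mem_toList.2 (Finset.mem_univ j))
  exact CopyMem.ext_of_list h2.1 h2.2

theorem length_encodeMems (c : ι → CopyMem n M Seed) :
    (encodeMems e c).length = w * ∑ j, (1 + (c j).size) := by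
  rw [encodeMems, List.length_flatMap]
  simp only [List.length_ofFn, List.map_const', List.sum_replicate, smul_eq_mul]
  rw [List.length_flatMap, mul_comm, ← Finset.sum_map_toList]
  congr 3
  funext j
  simp [CopyMem.length_itemList, add_comm]

theorem tokenProg_grows [Fintype Seed] {J : ℕ} (smp : Seed → Fin n → Bool) {κ q : ℝ}
    (hκ : 0 ≤ κ ∧ κ ≤ 1) (hq : 0 ≤ q ∧ q ≤ 1) (tok : Token n)
    (I : CopyInstr (CopyMem n M Seed) (QLabel n M J)) (hI : I ∈ tokenProg smp hκ hq tok) :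
    I.Grows CopyMem.size := by
  simp only [tokenProg, List.mem_cons, List.not_mem_nil, or_false] at hI
  rcases hI with rfl | rfl | rfl
  · intro m m' hm
    obtain ⟨a, -, rfl⟩ := (PMF.mem_support_map_iff _ _ _).1 hm
    refine Finset.card_le_card fun x hx => ?_
    obtain ⟨y, hy, rfl⟩ := Finset.mem_image.1 hx
    refine Finset.mem_image.2 ⟨_, Finset.mem_union_left _ (Finset.mem_image_of_mem _ hy), rfl⟩
  · intro m o
    dsimp only
    split_ifs <;> exact le_rfl
  · trivial

end Encoding

/-! ### Agreement of a majority of groups -/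

open scoped Classical in
/-- A number that, up to the relative error `ε / 4`, agrees with a majority of the values `v`. -/
def consensus {r : ℕ} (ε : ℝ) (v : Fin r → ℝ) : ℝ :=
  if h : ∃ y : ℝ, 0 ≤ y ∧ r < 2 * (Finset.univ.filter fun i => |v i - y| ≤ ε / 4 * y).card then
    h.choose
  else 0

open scoped Classical in
theorem abs_consensus_sub_le {r : ℕ} {ε T : ℝ} (hε : 0 < ε) (hε1 : ε ≤ 1) (hT : 0 ≤ T)
    {v : Fin r → ℝ} (h : ¬r ≤ 2 * (Finset.univ.filter fun i => ε / 4 * T < |v i - T|).card) :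
    |consensus ε v - T| ≤ ε * T := by
  have hgood : r < 2 * (Finset.univ.filter fun i => |v i - T| ≤ ε / 4 * T).card := by
    have h1 := Finset.card_filter_add_card_filter_not (s := (Finset.univ : Finset (Fin r)))
      fun i => ε / 4 * T < |v i - T|
    simp only [not_lt, Finset.card_univ, Fintype.card_fin] at h1
    omega
  have hex : ∃ y : ℝ, 0 ≤ y ∧
      r < 2 * (Finset.univ.filter fun i => |v i - y| ≤ ε / 4 * y).card := ⟨T, hT, hgood⟩
  rw [consensus, dif_pos hex]
  obtain ⟨hy0, hy⟩ := hex.choose_spec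
  set y := hex.choose
  -- two majorities have a common element
  obtain ⟨i, hi⟩ : ((Finset.univ.filter fun i => |v i - y| ≤ ε / 4 * y) ∩
      (Finset.univ.filter fun i => |v i - T| ≤ ε / 4 * T)).Nonempty := by
    rw [← Finset.card_pos]
    have h1 := Finset.card_union_add_card_inter
      (Finset.univ.filter fun i => |v i - y| ≤ ε / 4 * y)
      (Finset.univ.filter fun i => |v i - T| ≤ ε / 4 * T)
    have h2 := Finset.card_le_univ ((Finset.univ.filter fun i => |v i - y| ≤ ε / 4 * y) ∪
      (Finset.univ.filter fun i => |v i - T| ≤ ε / 4 * T))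
    rw [Fintype.card_fin] at h2
    omega
  rw [Finset.mem_inter, Finset.mem_filter, Finset.mem_filter] at hi
  have h1 := abs_le.1 hi.1.2
  have h2 := abs_le.1 hi.2.2
  have hεy : ε * y ≤ y := mul_le_of_le_one_left hy0 hε1
  have hεT : ε * T ≤ T := mul_le_of_le_one_left hT hε1
  have hyT : y ≤ 2 * T := by linarith
  have : ε * y ≤ ε * (2 * T) := mul_le_mul_of_nonneg_left hyT hε.le
  rw [abs_le]
  constructor <;> linarith [mul_nonneg hε.le hT]

/-! ### The algorithm and its guarantees -/

section Algorithm

variable {n M J : ℕ} {Seed : Type} [Fintype Seed] [Nonempty Seed]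
  (smp : Seed → Fin n → Bool) {κ q : ℝ} (hκ : 0 ≤ κ ∧ κ ≤ 1) (hq : 0 ≤ q ∧ q ≤ 1) {r K Q w : ℕ}
  (Θ : QubitSpace Q ≃ₗᵢ[ℂ] EuclideanSpace ℂ (Fin r × Fin K → QLabel n M J))
  (e : MemSymbol n M Seed ↪ (Fin w → Bool)) {p₀ : ℝ} (hp₀ : 0 ≤ p₀ ∧ p₀ ≤ 1) (A B ε : ℝ)

open scoped Classical in
/-- With probability `p₀`, run `r` groups of `K` independent copies in parallel, average the
estimates in every group and return a number on which a majority of the groups agrees; otherwise,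
do nothing and use no memory. -/
def copiesAlgorithm : HybridStreamingAlgorithm (Token n) where
  init := (PMF.ofFintype (fun b => ENNReal.ofReal (coinWeight p₀ b)) (by
      rw [← ENNReal.ofReal_sum_of_nonneg fun b _ => coinWeight_nonneg hp₀.1 hp₀.2 b,
        sum_coinWeight, ENNReal.ofReal_one])).bind fun b =>
    if b = true then (PMF.piFintype fun _ : Fin r × Fin K => PMF.uniformOfFintype Seed).map
      fun s => (encodeMems e fun j => initMem (s j), Q)
    else PMF.pure ([], 0)
  onToken tok := (tokenProg smp hκ hq tok).map (parallelInstr Θ (encodeMems e))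
  onEnd := []
  answer b :=
    if h : ∃ c, encodeMems e c = b then
      consensus ε fun i : Fin r => (∑ k : Fin K, estimate A B (h.choose (i, k))) / K
    else 0

variable (hΘ : Θ (QubitState.zero Q).1 = WithLp.toLp 2 (tensorVec fun _ => initState n M J))
  (hw : 0 < w)
include hΘ hw

/-- The final memories of the copies are independent and have the law `copyDist`. -/
theorem lexp_branchExp_copies (S : List (Token n)) (f : List Bool → ℝ≥0∞)
    (t : (Fin r × Fin K → Seed) → ℕ) :
    (PMF.piFintype fun _ : Fin r × Fin K => PMF.uniformOfFintype Seed).lexp (fun s =>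
      branchExp Q (fun b _ => f b)
        ((S.flatMap (tokenProg smp hκ hq)).map (parallelInstr Θ (encodeMems e)))
        (encodeMems e fun j => initMem (s j)) (QubitState.zero Q).1 (t s)) =
      ∑ c : Fin r × Fin K → CopyMem n M Seed,
        ENNReal.ofReal (∏ j, copyDist smp hκ hq S J (c j)) * f (encodeMems e c) := by
  have hz : (QubitState.zero Q).1 =
      Θ.symm (WithLp.toLp 2 (tensorVec fun _ => initState n M J)) := by
    rw [← hΘ, Θ.symm_apply_apply]
  simp only [hz, branchExp_parallel Θ (encodeMems_injective e hw), PMF.lexp_fintype,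
    Finset.mul_sum]
  rw [Finset.sum_comm]
  refine Finset.sum_congr rfl fun c _ => ?_
  simp only [← mul_assoc, ← Finset.sum_mul]
  congr 1
  have hN : (0 : ℝ) < Fintype.card Seed := by exact_mod_cast Fintype.card_pos
  have hu : ∀ s : Seed, PMF.uniformOfFintype Seed s =
      ENNReal.ofReal (1 / Fintype.card Seed) := fun s => by
    rw [PMF.uniformOfFintype_apply, one_div, ENNReal.ofReal_inv_of_pos hN, ENNReal.ofReal_natCast]
  simp only [PMF.piFintype, PMF.ofFintype_apply, ← Finset.prod_mul_distrib, hu]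
  rw [ENNReal.ofReal_prod_of_nonneg fun j _ => copyDist_nonneg smp hκ hq S (c j)]
  have : ∀ j, ENNReal.ofReal (copyDist smp hκ hq S J (c j)) =
      ∑ s : Seed, ENNReal.ofReal (1 / Fintype.card Seed) * ENNReal.ofReal
        (copyLaw (S.flatMap (tokenProg smp hκ hq)) (initMem s) (initState n M J) (c j)) :=
      fun j => by
    rw [copyDist, Finset.sum_div, ENNReal.ofReal_sum_of_nonneg]
    · refine Finset.sum_congr rfl fun s _ => ?_
      rw [← ENNReal.ofReal_mul (by positivity)]
      congr 1
      ring
    · exact fun s _ => div_nonneg (copyLaw_nonneg _ _ _ _) hN.le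
  simp only [this]
  rw [Finset.prod_univ_sum]
  simp

omit hΘ in
theorem lexp_execution_copies (S : List (Token n)) (F : ℝ × ℕ → ℝ≥0∞) (hrK : 0 < r * K) :
    ((copiesAlgorithm smp hκ hq Θ e hp₀ A B ε).execution S).lexp F =
      ENNReal.ofReal p₀ * (PMF.piFintype fun _ : Fin r × Fin K => PMF.uniformOfFintype Seed).lexp
        (fun s => branchExp Q
          (fun b t => F ((copiesAlgorithm smp hκ hq Θ e hp₀ A B ε).answer b, t))
          ((S.flatMap (tokenProg smp hκ hq)).map (parallelInstr Θ (encodeMems e)))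
          (encodeMems e fun j => initMem (s j)) (QubitState.zero Q).1
          ((encodeMems e fun j => initMem (M := M) (n := n) (s j)).length + Q)) +
      ENNReal.ofReal (1 - p₀) *
        F ((copiesAlgorithm smp hκ hq Θ e hp₀ A B ε).answer [], 0) := by
  have hne : ∀ c : Fin r × Fin K → CopyMem n M Seed, encodeMems e c ≠ [] := fun c h => by
    have h1 := length_encodeMems e c
    rw [h, List.length_nil] at h1
    have h2 : 0 < ∑ j, (1 + (c j).size) := by
      have : Nonempty (Fin r × Fin K) := by
        rw [← Fintype.card_pos_iff, Fintype.card_prod, Fintype.card_fin, Fintype.card_fin]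
        exact hrK
      exact Finset.sum_pos (fun j _ => by omega) Finset.univ_nonempty
    exact (Nat.mul_pos hw h2).ne h1
  have hprog : S.flatMap (copiesAlgorithm smp hκ hq Θ e hp₀ A B ε).onToken ++
      (copiesAlgorithm smp hκ hq Θ e hp₀ A B ε).onEnd =
      (S.flatMap (tokenProg smp hκ hq)).map (parallelInstr Θ (encodeMems e)) := by
    simp only [copiesAlgorithm, List.append_nil]
    rw [List.map_flatMap]
  rw [HybridStreamingAlgorithm.lexp_execution, hprog]
  have hinit : (copiesAlgorithm smp hκ hq Θ e hp₀ A B ε).init = (PMF.ofFintype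
      (fun b => ENNReal.ofReal (coinWeight p₀ b)) (by
        rw [← ENNReal.ofReal_sum_of_nonneg fun b _ => coinWeight_nonneg hp₀.1 hp₀.2 b,
          sum_coinWeight, ENNReal.ofReal_one])).bind fun b =>
      if b = true then (PMF.piFintype fun _ : Fin r × Fin K => PMF.uniformOfFintype Seed).map
        fun s => (encodeMems e fun j => initMem (s j), Q)
      else PMF.pure ([], 0) := rfl
  rw [hinit, PMF.lexp_bind, PMF.lexp_fintype, Fintype.sum_bool]
  simp only [PMF.ofFintype_apply, coinWeight, if_true, Bool.false_eq_true, if_false,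
    PMF.lexp_pure, PMF.lexp_map, Function.comp_def, List.length_nil, zero_add]
  rw [branchExp_parallel_nil Θ hne, (QubitState.zero 0).2]
  simp

omit hΘ hw [Nonempty Seed] in
theorem sum_copyDist_mul_ofReal (S : List (Token n)) {g : (Fin r × Fin K → CopyMem n M Seed) → ℝ}
    (hg : ∀ c, 0 ≤ g c) :
    ∑ c : Fin r × Fin K → CopyMem n M Seed,
      ENNReal.ofReal (∏ j, copyDist smp hκ hq S J (c j)) * ENNReal.ofReal (g c) =
      ENNReal.ofReal (iidExp (copyDist smp hκ hq S J) g) := by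
  have h0 : ∀ c : Fin r × Fin K → CopyMem n M Seed, 0 ≤ ∏ j, copyDist smp hκ hq S J (c j) :=
    fun c => Finset.prod_nonneg fun j _ => copyDist_nonneg smp hκ hq S (c j)
  rw [iidExp, ENNReal.ofReal_sum_of_nonneg fun c _ => mul_nonneg (h0 c) (hg c)]
  exact Finset.sum_congr rfl fun c _ => (ENNReal.ofReal_mul (h0 c)).symm

open scoped Classical in
omit hΘ in
theorem copiesAlgorithm_answer (c : Fin r × Fin K → CopyMem n M Seed) :
    (copiesAlgorithm smp hκ hq Θ e hp₀ A B ε).answer (encodeMems e c) =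
      consensus ε fun i : Fin r => (∑ k : Fin K, estimate A B (c (i, k))) / K := by
  have h : ∃ c', encodeMems e c' = encodeMems e c := ⟨c, rfl⟩
  have hc : h.choose = c := encodeMems_injective e hw h.choose_spec
  refine (dif_pos h).trans ?_
  rw [hc]

theorem copiesAlgorithm_answerProb (hrK : 0 < r * K) (hε : 0 < ε) (hε1 : ε ≤ 1)
    (S : List (Token n)) {T V : ℝ} (hT : 0 < T)
    (hmean : ∑ c : CopyMem n M Seed, copyDist smp hκ hq S J c * estimate A B c = T)
    (hsq : ∑ c : CopyMem n M Seed, copyDist smp hκ hq S J c * estimate A B c ^ 2 ≤ V)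
    (hV : 256 * V ≤ K * (ε * T) ^ 2) :
    ENNReal.ofReal (p₀ * (1 - (1 / 2) ^ r)) ≤
      (copiesAlgorithm smp hκ hq Θ e hp₀ A B ε).answerProb S {R | |R - T| ≤ ε * T} := by
  classical
  rw [HybridStreamingAlgorithm.answerProb_eq_lexp,
    lexp_execution_copies smp hκ hq Θ e hp₀ A B ε hw S _ hrK]
  refine le_trans ?_ le_self_add
  rw [ENNReal.ofReal_mul hp₀.1]
  refine mul_le_mul_right ?_ _
  have h1 := lexp_branchExp_copies smp hκ hq Θ e hΘ hw S (fun b =>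
    if (copiesAlgorithm smp hκ hq Θ e hp₀ A B ε).answer b ∈ {R | |R - T| ≤ ε * T} then 1 else 0)
    fun s => (encodeMems e fun j => initMem (M := M) (n := n) (s j)).length + Q
  refine le_of_le_of_eq ?_ h1.symm
  simp only [copiesAlgorithm_answer smp hκ hq Θ e hp₀ A B ε hw]
  set p := copyDist (M := M) smp hκ hq S J with hp
  have hp0 : ∀ c, 0 ≤ p c := copyDist_nonneg smp hκ hq S
  have hp1 : ∑ c, p c = 1 := sum_copyDist smp hκ hq S
  have hKpos : 0 < K := Nat.pos_of_mul_pos_left hrK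
  have : Nonempty (Fin K) := ⟨⟨0, hKpos⟩⟩
  set bad : (Fin K → CopyMem n M Seed) → Prop := fun d =>
    ε / 4 * T < |(∑ k, estimate A B (d k)) / K - T| with hbad
  have hη : 0 < ε / 4 * T := by positivity
  have hbadp : ∑ d : Fin K → CopyMem n M Seed, (∏ k, p (d k)) * (if bad d then 1 else 0) ≤
      1 / 16 := by
    -- Chebyshev's inequality for the average of the group
    have h2 := iidExp_mean_far_le (ι := Fin K) hp0 hp1 hmean hsq hη
    rw [Fintype.card_fin] at h2
    refine le_trans (le_of_eq ?_) (h2.trans ?_)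
    · rfl
    · have hK0 : (0 : ℝ) < K := by exact_mod_cast hKpos
      rw [div_le_iff₀ (by positivity)]
      nlinarith
  have h3 := iidExp_half_bad_le (r := r)
    (fun d : Fin K → CopyMem n M Seed => Finset.prod_nonneg fun k _ => hp0 (d k))
    (sum_prod_weight hp1) bad hbadp
  rw [← iidExp_curry p fun d : Fin r → Fin K → CopyMem n M Seed =>
    if r ≤ 2 * (Finset.univ.filter fun i => bad (d i)).card then (1 : ℝ) else 0] at h3
  have h4 : ∀ c : Fin r × Fin K → CopyMem n M Seed,
      ENNReal.ofReal (1 - if r ≤ 2 * (Finset.univ.filter fun i => bad fun k => c (i, k)).card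
        then (1 : ℝ) else 0) ≤
      if (consensus ε fun i : Fin r => (∑ k : Fin K, estimate A B (c (i, k))) / K) ∈
        {R | |R - T| ≤ ε * T} then 1 else 0 := fun c => by
    by_cases h : r ≤ 2 * (Finset.univ.filter fun i => bad fun k => c (i, k)).card
    · simp [h]
    · rw [if_neg h, if_pos]
      · simp
      · exact abs_consensus_sub_le hε hε1 hT.le h
  refine le_trans ?_ (Finset.sum_le_sum fun c _ => mul_le_mul_right (h4 c) _)
  rw [sum_copyDist_mul_ofReal smp hκ hq S fun c => by split_ifs <;> norm_num]
  refine ENNReal.ofReal_le_ofReal ?_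
  have h5 := iidExp_add p
    (fun c : Fin r × Fin K → CopyMem n M Seed => 1 -
      if r ≤ 2 * (Finset.univ.filter fun i => bad fun k => c (i, k)).card then (1 : ℝ) else 0)
    (fun c => if r ≤ 2 * (Finset.univ.filter fun i => bad fun k => c (i, k)).card
      then (1 : ℝ) else 0)
  simp only [sub_add_cancel, iidExp_const hp1] at h5
  linarith

theorem copiesAlgorithm_expectedSpace (hrK : 0 < r * K)
    (S : List (Token n)) {I : ℝ}
    (hI : ∑ c : CopyMem n M Seed, copyDist smp hκ hq S J c * (c.items.card : ℝ) ≤ I) :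
    (copiesAlgorithm smp hκ hq Θ e hp₀ A B ε).expectedSpace S ≤
      ENNReal.ofReal (p₀ * (Q + w * (r * K * (1 + I)))) := by
  rw [HybridStreamingAlgorithm.expectedSpace_eq_lexp,
    lexp_execution_copies smp hκ hq Θ e hp₀ A B ε hw S _ hrK]
  have hp0 : ∀ c, 0 ≤ copyDist (M := M) smp hκ hq S J c := copyDist_nonneg smp hκ hq S
  have hp1 : ∑ c, copyDist (M := M) smp hκ hq S J c = 1 := sum_copyDist smp hκ hq S
  simp only [Nat.cast_zero, mul_zero, add_zero]
  have hmono : ∀ c c' : Fin r × Fin K → CopyMem n M Seed, (∀ j, (c j).size ≤ (c' j).size) →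
      (encodeMems e c).length ≤ (encodeMems e c').length := fun c c' h => by
    rw [length_encodeMems, length_encodeMems]
    exact Nat.mul_le_mul_left _ (Finset.sum_le_sum fun j _ => Nat.add_le_add_left (h j) 1)
  have hgrow : ∀ I ∈ S.flatMap (tokenProg (M := M) (J := J) smp hκ hq), I.Grows CopyMem.size :=
    fun I hI => by
      obtain ⟨tok, -, h⟩ := List.mem_flatMap.1 hI
      exact tokenProg_grows smp hκ hq tok I h
  simp only [branchExp_parallel_peak Θ (encodeMems_injective e hw) CopyMem.size hmono
    (fun t => (t : ℝ≥0∞)) _ hgrow _ _ _ 0 rfl]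
  rw [lexp_branchExp_copies smp hκ hq Θ e hΘ hw S (fun b => ((b.length + Q : ℕ) : ℝ≥0∞)) fun _ => 0,
    ENNReal.ofReal_mul hp₀.1]
  refine mul_le_mul_right ?_ _
  have h1 : ∀ c : Fin r × Fin K → CopyMem n M Seed,
      (((encodeMems e c).length + Q : ℕ) : ℝ≥0∞) ≤
        ENNReal.ofReal (Q + w * ∑ j, (1 + ((c j).items.card : ℝ))) := fun c => by
    rw [← ENNReal.ofReal_natCast]
    refine ENNReal.ofReal_le_ofReal ?_
    rw [length_encodeMems]
    push_cast
    rw [add_comm]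
    refine add_le_add_right (mul_le_mul_of_nonneg_left (Finset.sum_le_sum fun j _ => ?_)
      (Nat.cast_nonneg _)) _
    exact add_le_add_right (Nat.cast_le.2 (c j).size_le) _
  refine (Finset.sum_le_sum fun c _ => mul_le_mul_right (h1 c) _).trans ?_
  rw [sum_copyDist_mul_ofReal smp hκ hq S fun c => by positivity]
  refine ENNReal.ofReal_le_ofReal ?_
  rw [iidExp_const_add hp1, iidExp_mul_left, iidExp_sum]
  refine add_le_add_right (mul_le_mul_of_nonneg_left ?_ (Nat.cast_nonneg _)) _
  have h2 : ∀ j : Fin r × Fin K, iidExp (copyDist (M := M) smp hκ hq S J)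
      (fun c => 1 + ((c j).items.card : ℝ)) ≤ 1 + I := fun j => by
    rw [iidExp_const_add hp1, iidExp_single hp1 (fun m => (m.items.card : ℝ)) j]
    exact add_le_add_right hI 1
  refine (Finset.sum_le_sum fun j _ => h2 j).trans (le_of_eq ?_)
  rw [Finset.sum_const, nsmul_eq_mul, Finset.card_univ, Fintype.card_prod, Fintype.card_fin,
    Fintype.card_fin]
  push_cast
  rfl

end Algorithm

/-! ### The number of bits and qubits of one copy -/

theorem clog_le_log {n k x : ℕ} (hn : 3 ≤ n) (hx0 : 0 < x) (hx : x ≤ n ^ k) :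
    (Nat.clog 2 x : ℝ) ≤ (2 * k + 1) * Real.log n := by
  have h3 : (3 : ℝ) ≤ n := by exact_mod_cast hn
  have hlog : 1 ≤ Real.log n := by
    rw [Real.le_log_iff_exp_le (by linarith)]
    linarith [Real.exp_one_lt_d9]
  have h2 := Real.log_two_gt_d9
  have hx0' : (0 : ℝ) < x := by exact_mod_cast hx0
  have h1 : Real.log x ≤ k * Real.log n := by
    rw [← Real.log_pow]
    exact Real.log_le_log hx0' (by exact_mod_cast hx)
  have hx1 : 0 ≤ Real.log x := Real.log_natCast_nonneg x
  have h4 : Real.logb 2 x ≤ 2 * Real.log x := by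
    rw [Real.logb, div_le_iff₀ (by linarith)]
    nlinarith
  have h5 := Nat.ceil_lt_add_one (a := Real.logb 2 x)
    (Real.logb_nonneg one_lt_two (by exact_mod_cast hx0))
  have h6 := Real.natCeil_logb_natCast 2 x
  push_cast at h6
  rw [h6] at h5
  nlinarith

theorem card_symbols_le {n M p : ℕ} (hn : 3 ≤ n) (hM : M ≤ n ^ 2) [Fact p.Prime]
    (hp : p ≤ 2 * n ^ 2) : Fintype.card (MemSymbol n M (ZMod p × ZMod p)) ≤ n ^ 14 := by
  have hS : Fintype.card SignType = 3 := rfl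
  have hU : Fintype.card ℤˣ = 2 := rfl
  simp only [Fintype.card_sum, Fintype.card_prod, ZMod.card, Fintype.card_bool, hS, hU,
    Fintype.card_fin]
  have h9 : 9 ≤ n ^ 2 := by nlinarith
  have h27 : 27 ≤ n ^ 3 := by nlinarith [pow_succ n 2]
  have h1 : p * p * (2 * (3 * ((M + 1) * (n ^ 3 + 1)))) ≤
      (2 * n ^ 2) * (2 * n ^ 2) * (2 * (3 * ((2 * n ^ 2) * (2 * n ^ 3)))) := by
    gcongr <;> omega
  have h2 : n * (n * 2) * (2 * 2) ≤ 8 * n ^ 9 := by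
    have : n ^ 2 ≤ n ^ 9 := Nat.pow_le_pow_right (by omega) (by norm_num)
    nlinarith
  have h5 : 243 ≤ n ^ 5 := by
    calc 243 = 3 ^ 5 := by norm_num
      _ ≤ n ^ 5 := Nat.pow_le_pow_left hn 5
  calc _ ≤ (2 * n ^ 2) * (2 * n ^ 2) * (2 * (3 * ((2 * n ^ 2) * (2 * n ^ 3)))) + 8 * n ^ 9 :=
        add_le_add h1 h2
    _ = 104 * n ^ 9 := by ring
    _ ≤ n ^ 5 * n ^ 9 := Nat.mul_le_mul_right _ (by omega)
    _ = n ^ 14 := by ring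

theorem card_labels_le {n M : ℕ} (hn : 3 ≤ n) (hM : M ≤ n ^ 2) :
    Fintype.card ((ZMod (M + 1) × Bool) ⊕ Entry n) ≤ n ^ 4 := by
  have hU : Fintype.card ℤˣ = 2 := rfl
  simp only [Fintype.card_sum, Fintype.card_prod, ZMod.card, Fintype.card_bool, hU,
    Fintype.card_fin]
  have h9 : 9 ≤ n ^ 2 := by nlinarith
  calc (M + 1) * 2 + n * (n * 2) ≤ (n ^ 2 + 1) * 2 + n * (n * 2) := by gcongr
    _ = 4 * n ^ 2 + 2 := by ring
    _ ≤ 9 * n ^ 2 := by omega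
    _ ≤ n ^ 2 * n ^ 2 := Nat.mul_le_mul_right _ h9
    _ = n ^ 4 := by ring

/-- The algorithm with given sampling rates, its success probability and its expected space. -/
theorem exists_algorithm {n M p t r K : ℕ} (hn : 3 ≤ n) (hM : M ≤ n ^ 2) [Fact p.Prime]
    (hp : p ≤ 2 * n ^ 2) (ht : t ≤ p) {κ q : ℝ} (hκ : 0 ≤ κ ∧ κ ≤ 1)
    (hq : 0 ≤ q ∧ q ≤ 1) {A B ε p₀ : ℝ} (hA : A * ((t / p : ℝ) * q ^ 2) = 1)
    (hB : B * κ = M + 1 ∨ κ = 1 ∧ B = 0) (hr : 0 < r) (hK : 0 < K) (hp₀ : 0 ≤ p₀ ∧ p₀ ≤ 1)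
    (hε : 0 < ε) (hε1 : ε ≤ 1) :
    ∃ alg : HybridStreamingAlgorithm (Token n), ∀ (G : SignedGraph (Fin n)) (S : List (Token n)),
      G.IsStream S → S.length ≤ M → 0 < G.T 1 → ∀ V : ℝ,
      ∑ s : ZMod p × ZMod p, iidExp (coinsWeight κ q)
        (fun ρ => ((foundWedges (L := S) (affineSample n p t) s ρ).card : ℝ) ^ 2) ≤
          Fintype.card (ZMod p × ZMod p) * V →
      256 * (2 * A ^ 2 * V + 2 * B ^ 2) ≤ K * (ε * G.T 1) ^ 2 →
      ENNReal.ofReal (p₀ * (1 - (1 / 2) ^ r)) ≤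
          alg.answerProb S {R : ℝ | |R - (G.T 1 : ℝ)| ≤ ε * (G.T 1 : ℝ)} ∧
        alg.expectedSpace S ≤
          ENNReal.ofReal (38 * Real.log n * (p₀ * r * K * (1 + 2 * M * (t / p : ℝ) * q))) := by
  classical
  set x := Fintype.card ((ZMod (M + 1) × Bool) ⊕ Entry n) with hx
  set ℓ := Nat.clog 2 x with hℓ
  set w := Nat.clog 2 (Fintype.card (MemSymbol n M (ZMod p × ZMod p))) with hw
  have hxpos : 0 < x := Fintype.card_pos_iff.2 ⟨Sum.inl (0, true)⟩
  have hypos : 1 < Fintype.card (MemSymbol n M (ZMod p × ZMod p)) :=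
    Fintype.one_lt_card_iff.2 ⟨Sum.inl ((0, 0), true, 0, 0, 0), Sum.inl ((0, 0), false, 0, 0, 0),
      by simp⟩
  have hwpos : 0 < w := Nat.clog_pos one_lt_two hypos
  have hxl : x ≤ 2 ^ ℓ := Nat.le_pow_clog one_lt_two x
  have hyw : Fintype.card (MemSymbol n M (ZMod p × ZMod p)) ≤ Fintype.card (Fin w → Bool) := by
    rw [Fintype.card_fun, Fintype.card_bool, Fintype.card_fin]
    exact Nat.le_pow_clog one_lt_two _
  obtain ⟨e⟩ := Function.Embedding.nonempty_of_card_le hyw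
  set J := 2 ^ ℓ - x with hJ
  have hcard : Fintype.card (QLabel n M J) = 2 ^ ℓ := by
    rw [Fintype.card_sum, Fintype.card_fin, ← hx]
    omega
  set Q := r * K * ℓ with hQ
  have hfin : Module.finrank ℂ (QubitSpace Q) =
      Module.finrank ℂ (EuclideanSpace ℂ (Fin r × Fin K → QLabel n M J)) := by
    rw [finrank_euclideanSpace, finrank_euclideanSpace, Fintype.card_fun, Fintype.card_fun, hcard,
      Fintype.card_prod, Fintype.card_fin, Fintype.card_fin, Fintype.card_fin, Fintype.card_bool,
      ← pow_mul, hQ, mul_comm ℓ]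
  have hb : ‖(WithLp.toLp 2 (tensorVec fun _ => initState n M J) :
      EuclideanSpace ℂ (Fin r × Fin K → QLabel n M J))‖ = 1 := by
    have h1 : ‖(WithLp.toLp 2 (tensorVec fun _ => initState n M J) :
      EuclideanSpace ℂ (Fin r × Fin K → QLabel n M J))‖ ^ 2 = 1 := by
      rw [EuclideanSpace.norm_sq_eq]
      refine (normSqVec_tensorVec fun _ : Fin r × Fin K => initState n M J).trans ?_
      simp [normSqVec_initState]
    exact (pow_eq_one_iff_of_nonneg (norm_nonneg _) two_ne_zero).1 h1
  obtain ⟨Θ, hΘ⟩ := exists_linearIsometryEquiv_map_eq hfin (QubitState.zero Q).2 hb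
  set smp := affineSample n p t with hsmp
  refine ⟨copiesAlgorithm smp hκ hq Θ e hp₀ A B ε, fun G S hS hlen hT V hV hKV => ?_⟩
  have hrK : 0 < r * K := Nat.mul_pos hr hK
  have hT' : (0 : ℝ) < G.T 1 := by exact_mod_cast hT
  refine ⟨copiesAlgorithm_answerProb smp hκ hq Θ e hp₀ A B ε hΘ hwpos hrK hε hε1 S hT'
    (copyDist_estimate smp hκ hq hS hlen (sum_affineSample ht) hA hB)
    (copyDist_estimate_sq_le smp hκ hq hS hV) hKV, ?_⟩
  refine (copiesAlgorithm_expectedSpace smp hκ hq Θ e hp₀ A B ε hΘ hwpos hrK S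
    (copyDist_items_le smp hκ hq hS (sum_affineSample ht))).trans (ENNReal.ofReal_le_ofReal ?_)
  have hl := clog_le_log hn hxpos (card_labels_le hn hM)
  have hwl := clog_le_log hn (zero_lt_one.trans hypos) (card_symbols_le (p := p) hn hM hp)
  rw [← hℓ] at hl
  rw [← hw] at hwl
  have hlog : 0 ≤ Real.log n := Real.log_natCast_nonneg n
  set I := 2 * (M : ℝ) * (t / p : ℝ) * q with hI
  have hq0 := hq.1
  have hI0 : 0 ≤ I := by positivity
  have hSI : 2 * (S.length : ℝ) * (t / p : ℝ) * q ≤ I := by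
    rw [hI]
    have : (S.length : ℝ) ≤ M := by exact_mod_cast hlen
    gcongr
  calc p₀ * ((Q : ℝ) + w * (r * K * (1 + 2 * S.length * (t / p : ℝ) * q)))
      ≤ p₀ * (r * K * (9 * Real.log n) + (29 * Real.log n) * (r * K * (1 + I))) := by
        refine mul_le_mul_of_nonneg_left (add_le_add ?_ ?_) hp₀.1
        · rw [hQ]
          push_cast
          refine mul_le_mul_of_nonneg_left (hl.trans (le_of_eq ?_)) (by positivity)
          norm_num
        · refine mul_le_mul (hwl.trans (le_of_eq ?_)) ?_ (by positivity) (by positivity)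
          · norm_num
          · gcongr
    _ = Real.log n * p₀ * (r * K) * (38 + 29 * I) := by ring
    _ ≤ Real.log n * p₀ * (r * K) * (38 * (1 + I)) := by
        refine mul_le_mul_of_nonneg_left (by linarith) ?_
        have := hp₀.1
        positivity
    _ = 38 * Real.log n * (p₀ * r * K * (1 + I)) := by ring

/-! ### The choice of the parameters -/

/-- The number `r` of groups and the probability `p₀` of running the algorithm at all. For a failure
probability `δ` close to `1` the logarithm in the space bound is close to `0`, so that the algorithm
may not even run with certainty. -/
theorem exists_amplification {δ : ℝ} (hδ : 0 < δ) (hδ1 : δ ≤ 1) :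
    ∃ (r : ℕ) (p₀ : ℝ), 0 < r ∧ (0 ≤ p₀ ∧ p₀ ≤ 1) ∧ 1 - δ ≤ p₀ * (1 - (1 / 2) ^ r) ∧
      p₀ * r ≤ 4 * Real.log (1 / δ) := by
  have hlog : 1 - δ ≤ Real.log (1 / δ) := by
    have := Real.log_le_sub_one_of_pos hδ
    rw [one_div, Real.log_inv]
    linarith
  rcases le_total (1 / 2) δ with h | h
  · refine ⟨1, 2 * (1 - δ), one_pos, ⟨by linarith, by linarith⟩, ?_, ?_⟩
    · rw [pow_one]
      linarith
    · push_cast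
      linarith
  · have h2 := Real.log_two_gt_d9
    have h2' := Real.log_two_lt_d9
    have hinv : 2 ≤ 1 / δ := by
      rw [le_div_iff₀ hδ]
      linarith
    have h3 : 1 ≤ Real.logb 2 (1 / δ) := by
      rw [Real.le_logb_iff_rpow_le one_lt_two (by positivity)]
      simpa using hinv
    refine ⟨⌈Real.logb 2 (1 / δ)⌉₊, 1, Nat.ceil_pos.2 (by linarith), ⟨zero_le_one, le_rfl⟩, ?_, ?_⟩
    · rw [one_mul]
      have h4 : 1 / δ ≤ 2 ^ ⌈Real.logb 2 (1 / δ)⌉₊ := by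
        rw [← Real.rpow_natCast, ← Real.logb_le_iff_le_rpow one_lt_two (by positivity)]
        exact Nat.le_ceil _
      have h5 : (1 / 2 : ℝ) ^ ⌈Real.logb 2 (1 / δ)⌉₊ ≤ δ := by
        rw [one_div_pow, one_div_le (by positivity) hδ]
        exact h4
      linarith
    · have h4 := Nat.ceil_lt_add_one (a := Real.logb 2 (1 / δ)) (by linarith)
      have h5 : Real.logb 2 (1 / δ) ≤ 2 * Real.log (1 / δ) := by
        rw [Real.logb, div_le_iff₀ (by linarith)]
        nlinarith
      linarith

/-- The bound on the variance is handled through its fifth power, which is rational. -/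
theorem bound_pow_five {M D τ : ℝ} (hM : 0 ≤ M) (hD : 0 ≤ D) (hτ : 0 ≤ τ) :
    (M ^ (8 / 5 : ℝ) * τ ^ (-(6 / 5) : ℝ) * D ^ (4 / 5 : ℝ)) ^ 5 = M ^ 8 * D ^ 4 / τ ^ 6 := by
  have h : ∀ x : ℝ, 0 ≤ x → ∀ a : ℝ, (x ^ a) ^ 5 = x ^ (a * 5) := fun x hx a => by
    rw [← Real.rpow_natCast, ← Real.rpow_mul hx]
    norm_num
  rw [mul_pow, mul_pow, h M hM, h D hD, h τ hτ]
  norm_num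
  rw [mul_right_comm, div_eq_mul_inv]

/-- The bound on the second moment of the number of triangles found classically. -/
def countSqBound (a κ q T D M : ℝ) : ℝ :=
  a ^ 2 * q ^ 4 * T ^ 2 + a * q ^ 2 * T + 2 * a * q ^ 3 * T * D + 2 * a * q ^ 4 * κ * T * D * M

/-- The second moment of the estimate of one copy in terms of `x = √M` and `y = √k`, where `1 / k`
is the rate of measurements: vertices are sampled at a rate of about `1 / (x y)` and entries are
stored at the rate `y / x`. The equation `D τ = x y ^ 5` balances the variance of the classical
estimator and that of the quantum estimator. -/
theorem estimate_variance_le {a x y D τ T : ℝ} (hy : 1 ≤ y) (hyx : y ≤ x) (hD : 1 ≤ D)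
    (hτ : 0 < τ) (hτT : τ ≤ T) (hDτ : D * τ = x * y ^ 5) (ha : 1 / (x * y) ≤ a)
    (hL : τ ≤ x ^ 2 * y ^ 2) :
    2 * (1 / (a * (y / x) ^ 2)) ^ 2 * countSqBound a (1 / y ^ 2) (y / x) T D (x ^ 2) +
      2 * ((x ^ 2 + 1) * y ^ 2) ^ 2 ≤ 20 * (x ^ 2 * y ^ 2 / τ) ^ 2 * T ^ 2 := by
  have hy0 : 0 < y := by linarith
  have hx0 : 0 < x := by linarith
  have hx1 : 1 ≤ x := hy.trans hyx
  have ha0 : 0 < a := lt_of_lt_of_le (by positivity) ha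
  have hT0 : 0 < T := hτ.trans_le hτT
  have hainv : 1 / a ≤ x * y := by
    rw [div_le_iff₀ ha0]
    rwa [div_le_iff₀ (by positivity), mul_comm] at ha
  set L := (x ^ 2 * y ^ 2 / τ) ^ 2 with hLdef
  have hτL : τ * L = x ^ 4 * y ^ 4 / τ := by
    rw [hLdef]
    field_simp
  have hL1 : 1 ≤ L := one_le_pow₀ ((one_le_div hτ).2 hL)
  have e : (1 / (a * (y / x) ^ 2)) ^ 2 * countSqBound a (1 / y ^ 2) (y / x) T D (x ^ 2) =
      T ^ 2 + T * ((1 / a) * (x ^ 2 / y ^ 2)) + 2 * T * ((1 / a) * (D * (x / y))) +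
        2 * T * ((1 / a) * (D * (x ^ 2 / y ^ 2))) := by
    unfold countSqBound
    field_simp
  -- each error term is at most `τ L`, and `τ L T ≤ L T ^ 2`
  have hxy : D * (x ^ 3 / y) = τ * L := by
    rw [hτL]
    field_simp
    linear_combination hDτ
  have h3 : (1 / a) * (D * (x ^ 2 / y ^ 2)) ≤ τ * L := by
    rw [← hxy]
    calc _ ≤ (x * y) * (D * (x ^ 2 / y ^ 2)) := by gcongr
      _ = D * (x ^ 3 / y) := by field_simp
  have h1 : (1 / a) * (x ^ 2 / y ^ 2) ≤ τ * L := by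
    refine le_trans ?_ h3
    have : x ^ 2 / y ^ 2 ≤ D * (x ^ 2 / y ^ 2) := le_mul_of_one_le_left (by positivity) hD
    gcongr
  have h2 : (1 / a) * (D * (x / y)) ≤ τ * L := by
    refine le_trans ?_ h3
    have : x / y ≤ x ^ 2 / y ^ 2 := by
      rw [← div_pow]
      exact le_self_pow₀ ((one_le_div hy0).2 hyx) two_ne_zero
    gcongr
  have h4 : ((x ^ 2 + 1) * y ^ 2) ^ 2 ≤ 4 * (τ ^ 2 * L) := by
    have : τ ^ 2 * L = (x ^ 2 * y ^ 2) ^ 2 := by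
      rw [hLdef]
      field_simp
    rw [this]
    have hx2 : x ^ 2 + 1 ≤ 2 * x ^ 2 := by nlinarith
    calc ((x ^ 2 + 1) * y ^ 2) ^ 2 ≤ (2 * x ^ 2 * y ^ 2) ^ 2 := by gcongr
      _ = 4 * (x ^ 2 * y ^ 2) ^ 2 := by ring
  have hTT : T * (τ * L) ≤ L * T ^ 2 := by
    calc T * (τ * L) ≤ T * (T * L) := by gcongr
      _ = L * T ^ 2 := by ring
  have hττ : τ ^ 2 * L ≤ L * T ^ 2 := by
    calc τ ^ 2 * L ≤ T ^ 2 * L := by gcongr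
      _ = L * T ^ 2 := by ring
  have hT2 : T ^ 2 ≤ L * T ^ 2 := le_mul_of_one_le_left (by positivity) hL1
  rw [mul_assoc 2, e]
  have := mul_le_mul_of_nonneg_left h1 hT0.le
  have := mul_le_mul_of_nonneg_left h2 hT0.le
  have := mul_le_mul_of_nonneg_left h3 hT0.le
  nlinarith

/-- Rates for which one copy has small second moment and expected memory. The number `p` is the size
of the field of the hash function, `t / p` the rate at which vertices are sampled, and `A`, `B` are
the factors of the two estimators. -/
theorem exists_rates {n M D τ : ℕ} (hn : 3 ≤ n) (hM : M ≤ n ^ 2) (hM1 : 1 ≤ M) (hD : 1 ≤ D)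
    (hDM : D ≤ M) (hτ : 1 ≤ τ) (hτM : τ ≤ M * D) :
    ∃ (p t : ℕ) (κ q A B L : ℝ), p.Prime ∧ n ≤ p ∧ p ≤ 2 * n ^ 2 ∧ t ≤ p ∧
      (0 ≤ κ ∧ κ ≤ 1) ∧ (0 ≤ q ∧ q ≤ 1) ∧ A * ((t / p : ℝ) * q ^ 2) = 1 ∧
      (B * κ = M + 1 ∨ κ = 1 ∧ B = 0) ∧ 1 ≤ L ∧
      L * (1 + 2 * M * (t / p : ℝ) * q) ≤
        5 * ((M : ℝ) ^ (8 / 5 : ℝ) * (τ : ℝ) ^ (-(6 / 5) : ℝ) * (D : ℝ) ^ (4 / 5 : ℝ)) ∧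
      ∀ T : ℝ, τ ≤ T → ∃ V : ℝ, (V = T ^ 2 ∨ V = countSqBound (t / p) κ q T D M) ∧
        2 * A ^ 2 * V + 2 * B ^ 2 ≤ 20 * L * T ^ 2 := by
  obtain ⟨p, hp, hnp, hp2⟩ := Nat.exists_prime_lt_and_le_two_mul (n ^ 2)
    (by have := Nat.pow_pos (n := 2) (show 0 < n by omega); omega)
  have hn2 : n ≤ n ^ 2 := Nat.le_self_pow two_ne_zero n
  have hp0 : (0 : ℝ) < p := by exact_mod_cast hp.pos
  have hM1' : (1 : ℝ) ≤ M := by exact_mod_cast hM1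
  have hD1' : (1 : ℝ) ≤ D := by exact_mod_cast hD
  have hτ1' : (1 : ℝ) ≤ τ := by exact_mod_cast hτ
  have hDM' : (D : ℝ) ≤ M := by exact_mod_cast hDM
  have hτM' : (τ : ℝ) ≤ M * D := by exact_mod_cast hτM
  set bnd := (M : ℝ) ^ (8 / 5 : ℝ) * (τ : ℝ) ^ (-(6 / 5) : ℝ) * (D : ℝ) ^ (4 / 5 : ℝ) with hbnd
  have hbnd0 : 0 ≤ bnd := by positivity
  have hbnd5 : bnd ^ 5 = (M : ℝ) ^ 8 * D ^ 4 / τ ^ 6 :=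
    bound_pow_five (by positivity) (by positivity) (by positivity)
  set x := Real.sqrt M with hx
  have hx2 : x ^ 2 = M := Real.sq_sqrt (by positivity)
  have hx1 : 1 ≤ x := Real.one_le_sqrt.2 hM1'
  have hx0 : 0 < x := by linarith
  set y := ((D : ℝ) * τ / x) ^ (1 / 5 : ℝ) with hy
  have hy0 : 0 < y := Real.rpow_pos_of_pos (by positivity) _
  have hy5 : y ^ 5 = D * τ / x := by
    rw [hy, ← Real.rpow_natCast, ← Real.rpow_mul (by positivity)]
    norm_num
  have hDτ : D * τ = x * y ^ 5 := by
    rw [hy5]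
    field_simp
  rcases lt_or_ge y 1 with hy1 | hy1
  · -- few triangles per edge: every entry is stored, and nothing is left to the quantum registers
    refine ⟨p, p, 1, 1, 1, 0, 1, hp, by omega, hp2, le_rfl, by norm_num, by norm_num, ?_,
      Or.inr ⟨rfl, rfl⟩, le_rfl, ?_, fun T hT => ⟨T ^ 2, Or.inl rfl, ?_⟩⟩
    · rw [div_self hp0.ne']
      norm_num
    · rw [div_self hp0.ne']
      have h1 : (D : ℝ) * τ ≤ x := by
        rw [hDτ]
        exact mul_le_of_le_one_right hx0.le (pow_le_one₀ hy0.le hy1.le)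
      have h2 : (τ : ℝ) ≤ x := by nlinarith
      have h3 : (M : ℝ) ≤ bnd := by
        rw [← pow_le_pow_iff_left₀ (by positivity) hbnd0 (show (5 : ℕ) ≠ 0 by norm_num), hbnd5,
          le_div_iff₀ (by positivity)]
        have h4 : (τ : ℝ) ^ 6 ≤ M ^ 3 := by
          calc (τ : ℝ) ^ 6 ≤ x ^ 6 := by gcongr
            _ = (M : ℝ) ^ 3 := by rw [← hx2]; ring
        calc (M : ℝ) ^ 5 * τ ^ 6 ≤ (M : ℝ) ^ 5 * (M : ℝ) ^ 3 := by gcongr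
          _ = (M : ℝ) ^ 8 * 1 := by ring
          _ ≤ (M : ℝ) ^ 8 * (D : ℝ) ^ 4 := by
            gcongr
            exact one_le_pow₀ hD1'
      linarith
    · nlinarith [sq_nonneg T]
  · have hyx : y ≤ x := by
      rw [← pow_le_pow_iff_left₀ hy0.le hx0.le (show (5 : ℕ) ≠ 0 by norm_num), hy5,
        div_le_iff₀ hx0]
      calc (D : ℝ) * τ ≤ M * (M * M) := by
            have : (τ : ℝ) ≤ M * M := hτM'.trans (by gcongr)
            gcongr
        _ = x ^ 5 * x := by rw [← hx2]; ring
    have hL : (τ : ℝ) ≤ x ^ 2 * y ^ 2 := by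
      rw [← pow_le_pow_iff_left₀ (by positivity) (by positivity) (show (5 : ℕ) ≠ 0 by norm_num)]
      have h1 : (x ^ 2 * y ^ 2) ^ 5 = M ^ 4 * (D * τ) ^ 2 := by
        rw [hDτ, ← hx2]
        ring
      rw [h1]
      have h2 : (τ : ℝ) ^ 3 ≤ M ^ 4 * D ^ 2 := by
        calc (τ : ℝ) ^ 3 ≤ ((M : ℝ) * D) ^ 3 := by gcongr
          _ = (M : ℝ) ^ 3 * (D : ℝ) ^ 2 * D := by ring
          _ ≤ (M : ℝ) ^ 3 * (D : ℝ) ^ 2 * M := by gcongr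
          _ = (M : ℝ) ^ 4 * (D : ℝ) ^ 2 := by ring
      calc (τ : ℝ) ^ 5 = (τ : ℝ) ^ 3 * (τ : ℝ) ^ 2 := by ring
        _ ≤ (M : ℝ) ^ 4 * (D : ℝ) ^ 2 * (τ : ℝ) ^ 2 := by gcongr
        _ = (M : ℝ) ^ 4 * ((D : ℝ) * τ) ^ 2 := by ring
    have hLb : (x ^ 2 * y ^ 2 / τ) ^ 2 = bnd := by
      rw [← pow_left_inj₀ (by positivity) hbnd0 (show (5 : ℕ) ≠ 0 by norm_num), hbnd5]
      have h1 : (x ^ 2 * y ^ 2) ^ 10 = M ^ 8 * (D * τ) ^ 4 := by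
        rw [hDτ, ← hx2]
        ring
      rw [← pow_mul, div_pow, h1]
      field_simp
    have hxy1 : 1 ≤ x * y := one_le_mul_of_one_le_of_one_le hx1 hy1
    set t := ⌈(p : ℝ) / (x * y)⌉₊ with ht
    have htp : t ≤ p := Nat.ceil_le.2 (div_le_self hp0.le hxy1)
    have hxyp : x * y ≤ p := by
      calc x * y ≤ x * x := by gcongr
        _ = M := by rw [← hx2]; ring
        _ ≤ p := by exact_mod_cast hM.trans hnp.le
    have ha : 1 / (x * y) ≤ (t / p : ℝ) := by
      rw [le_div_iff₀ hp0, one_div_mul_eq_div]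
      exact Nat.le_ceil _
    have ha2 : (t / p : ℝ) ≤ 2 / (x * y) := by
      rw [div_le_iff₀ hp0]
      have h1 := Nat.ceil_lt_add_one (a := (p : ℝ) / (x * y)) (by positivity)
      have h2 : 1 ≤ (p : ℝ) / (x * y) := (one_le_div (by positivity)).2 hxyp
      calc (t : ℝ) ≤ (p : ℝ) / (x * y) + p / (x * y) := by linarith
        _ = 2 / (x * y) * p := by ring
    have ha0 : (0 : ℝ) < t / p := lt_of_lt_of_le (by positivity) ha
    refine ⟨p, t, 1 / y ^ 2, y / x, 1 / ((t / p : ℝ) * (y / x) ^ 2), (x ^ 2 + 1) * y ^ 2,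
      (x ^ 2 * y ^ 2 / τ) ^ 2, hp, by omega, hp2, htp, ⟨by positivity, ?_⟩, ⟨by positivity, ?_⟩, ?_,
      Or.inl ?_, ?_, ?_, fun T hT => ⟨_, Or.inr rfl, ?_⟩⟩
    · exact div_le_one_of_le₀ (one_le_pow₀ hy1) (by positivity)
    · exact div_le_one_of_le₀ hyx hx0.le
    · exact one_div_mul_cancel (by positivity)
    · rw [hx2]
      field_simp
    · exact one_le_pow₀ ((one_le_div (by linarith)).2 hL)
    · rw [hLb, mul_comm]
      refine mul_le_mul_of_nonneg_right ?_ hbnd0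
      have : 2 * (M : ℝ) * (t / p) * (y / x) ≤ 2 * M * (2 / (x * y)) * (y / x) := by gcongr
      have e : 2 * (M : ℝ) * (2 / (x * y)) * (y / x) = 4 := by
        rw [← hx2]
        field_simp
        norm_num
      linarith
    · have := estimate_variance_le hy1 hyx hD1' (by linarith) hT hDτ ha hL
      rwa [hx2] at this ⊢

/-! ### The theorem -/

theorem mainTheorem1 :
    ∃ C : ℝ, 0 < C ∧
      ∀ ε δ : ℝ, 0 < ε → ε ≤ 1 → 0 < δ → δ ≤ 1 →
        -- the size of the vertex set, and the known bounds on `m`, `Δ_E` and `T_1`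
        ∀ n M D τ : ℕ, 1 ≤ τ →
          ∃ A : HybridStreamingAlgorithm (Sym2 (Fin n) × ℤˣ),
            ∀ (G : SignedGraph (Fin n)) (S : List (Sym2 (Fin n) × ℤˣ)),
              G.IsStream S → G.numEdges ≤ M → G.maxEdgeTriangles ≤ D → τ ≤ G.T 1 →
                ENNReal.ofReal (1 - δ) ≤
                    A.answerProb S {R : ℝ | |R - (G.T 1 : ℝ)| ≤ ε * (G.T 1 : ℝ)} ∧
                  A.expectedSpace S ≤
                    ENNReal.ofReal
                      (C * ((M : ℝ) ^ (8 / 5 : ℝ) * (τ : ℝ) ^ (-(6 / 5) : ℝ) *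
                        (D : ℝ) ^ (4 / 5 : ℝ) * Real.log n * (1 / ε ^ 2) *
                        Real.log (1 / δ))) := by
  refine ⟨38 * 4 * 5121 * 5, by norm_num, fun ε δ hε hε1 hδ hδ1 n M D τ hτ => ?_⟩
  by_cases hex : ∃ (G : SignedGraph (Fin n)) (S : List (Sym2 (Fin n) × ℤˣ)),
      G.IsStream S ∧ G.numEdges ≤ M ∧ G.maxEdgeTriangles ≤ D ∧ τ ≤ G.T 1
  swap
  · exact ⟨⟨PMF.pure ([], 0), fun _ => [], [], fun _ => 0⟩,
      fun G S h1 h2 h3 h4 => absurd ⟨G, S, h1, h2, h3, h4⟩ hex⟩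
  obtain ⟨G₀, S₀, h1, h2, h3, h4⟩ := hex
  -- the bounds are replaced by smaller ones that hold for every graph on `n` vertices
  set M' := min M (n ^ 2) with hM'
  set D' := min D M' with hD'
  have hbounds : ∀ G : SignedGraph (Fin n), G.numEdges ≤ M → G.maxEdgeTriangles ≤ D →
      G.numEdges ≤ M' ∧ G.maxEdgeTriangles ≤ D' := fun G hm hd =>
    have := le_min hm G.numEdges_le_sq
    ⟨this, le_min hd (G.maxEdgeTriangles_le_numEdges.trans this)⟩
  obtain ⟨h2', h3'⟩ := hbounds G₀ h2 h3
  have hn : 3 ≤ n := SignedGraph.three_le_of_T_pos (hτ.trans h4)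
  have hτM : τ ≤ M' * D' := by
    refine h4.trans (h1.T_le.trans ?_)
    rw [h1.length_eq]
    exact Nat.mul_le_mul h2' h3'
  have hM1 : 1 ≤ M' := Nat.one_le_iff_ne_zero.2 fun h => by simp [h] at hτM; omega
  have hD1 : 1 ≤ D' := Nat.one_le_iff_ne_zero.2 fun h => by simp [h] at hτM; omega
  obtain ⟨p, t, κ, q, A, B, L, hp, hnp, hp2, htp, hκ, hq, hA, hB, hL1, hL, hV⟩ :=
    exists_rates hn (min_le_right M (n ^ 2)) hM1 hD1 (min_le_right D M') hτ hτM
  obtain ⟨r, p₀, hr, hp₀, hδr, hrlog⟩ := exists_amplification hδ hδ1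
  have : Fact p.Prime := ⟨hp⟩
  set K := ⌈5120 * L / ε ^ 2⌉₊ with hK
  have hε2 : ε ^ 2 ≤ 1 := pow_le_one₀ hε.le hε1
  have hK0 : 0 < K := Nat.ceil_pos.2 (by positivity)
  have hKle : (K : ℝ) ≤ 5121 * L / ε ^ 2 := by
    have h5 := Nat.ceil_lt_add_one (a := 5120 * L / ε ^ 2) (by positivity)
    have h6 : 1 ≤ L / ε ^ 2 := (one_le_div (by positivity)).2 (by linarith)
    calc (K : ℝ) ≤ 5120 * L / ε ^ 2 + L / ε ^ 2 := by linarith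
      _ = 5121 * L / ε ^ 2 := by ring
  obtain ⟨alg, halg⟩ := exists_algorithm (r := r) (K := K) hn (min_le_right M (n ^ 2)) hp2 htp hκ hq
    hA hB hr hK0 hp₀ hε hε1
  refine ⟨alg, fun G S hS hm hd hτT => ?_⟩
  obtain ⟨hm', hd'⟩ := hbounds G hm hd
  have hlen : S.length ≤ M' := hS.length_eq.trans_le hm'
  obtain ⟨V, hVor, hVle⟩ := hV (G.T 1) (by exact_mod_cast hτT)
  have ha : (0 : ℝ) ≤ t / p := by positivity
  have hκ0 := hκ.1
  have hq0 := hq.1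
  have hVsum : ∑ s : ZMod p × ZMod p, iidExp (coinsWeight κ q)
      (fun ρ => ((foundWedges (L := S) (affineSample n p t) s ρ).card : ℝ) ^ 2) ≤
        Fintype.card (ZMod p × ZMod p) * V := by
    rcases hVor with rfl | rfl
    · rw [← nsmul_eq_mul]
      refine Finset.sum_le_card_nsmul _ _ _ fun s _ => ?_
      rw [← iidExp_const (ι := Fin S.length) (sum_coinsWeight κ q) ((G.T 1 : ℝ) ^ 2)]
      refine iidExp_mono (coinsWeight_nonneg hκ hq) fun ρ => ?_
      have := card_foundWedges_le (affineSample n p t) hS s ρ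
      gcongr
    · refine (sum_iidExp_card_foundWedges_sq_le (affineSample n p t) hS hκ hq ha
        (sum_affineSample htp) (fun x y hxy => sum_affineSample_mul hnp htp hxy)
        (D := D') (by exact_mod_cast hd')).trans ?_
      unfold countSqBound
      gcongr
  have hT0 : 0 < G.T 1 := hτ.trans hτT
  obtain ⟨hprob, hspace⟩ := halg G S hS hlen hT0 V hVsum (by
    calc 256 * (2 * A ^ 2 * V + 2 * B ^ 2) ≤ 256 * (20 * L * (G.T 1 : ℝ) ^ 2) := by gcongr
      _ = 5120 * L / ε ^ 2 * (ε * G.T 1) ^ 2 := by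
        field_simp
        norm_num
      _ ≤ K * (ε * G.T 1) ^ 2 := by
        gcongr
        exact Nat.le_ceil _)
  refine ⟨(ENNReal.ofReal_le_ofReal hδr).trans hprob,
    hspace.trans (ENNReal.ofReal_le_ofReal ?_)⟩
  have hlogn : 0 ≤ Real.log n := Real.log_natCast_nonneg n
  have hlogδ : 0 ≤ Real.log (1 / δ) := Real.log_nonneg ((one_le_div hδ).2 hδ1)
  set I := 2 * (M' : ℝ) * (t / p : ℝ) * q with hI
  have hI0 : 0 ≤ I := by positivity
  have hp₀0 := hp₀.1
  calc 38 * Real.log n * (p₀ * r * K * (1 + I))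
      ≤ 38 * Real.log n * ((4 * Real.log (1 / δ)) * (5121 * L / ε ^ 2) * (1 + I)) := by
        gcongr
    _ = 38 * 4 * 5121 * ((L * (1 + I)) * Real.log n * (1 / ε ^ 2) * Real.log (1 / δ)) := by ring
    _ ≤ 38 * 4 * 5121 * ((5 * ((M' : ℝ) ^ (8 / 5 : ℝ) * (τ : ℝ) ^ (-(6 / 5) : ℝ) *
          (D' : ℝ) ^ (4 / 5 : ℝ))) * Real.log n * (1 / ε ^ 2) * Real.log (1 / δ)) := by
        gcongr
    _ = 38 * 4 * 5121 * 5 * ((M' : ℝ) ^ (8 / 5 : ℝ) * (τ : ℝ) ^ (-(6 / 5) : ℝ) *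
          (D' : ℝ) ^ (4 / 5 : ℝ) * Real.log n * (1 / ε ^ 2) * Real.log (1 / δ)) := by ring
    _ ≤ _ := by
        have hMM : (M' : ℝ) ≤ M := by exact_mod_cast min_le_left M (n ^ 2)
        have hDD : (D' : ℝ) ≤ D := by exact_mod_cast min_le_left D M'
        gcongr

end
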